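/- Let $R$ be a local principal ideal domain of characteristic zero, let $H$ be a Hopf algebra over $R$, and let $C$ and $D$ be $R$-coalgebras; $H$, $C$, $D$ are assumed flat as $R$-modules and $\otimes=\otimes_R$. **Coactions.** A coaction of $H$ on a coalgebra $C$ is an $H$-comodule structure $\delta\colon C\to C\otimes H$, $\delta(c)=c^{(0)}\otimes c^{(1)}$, with $c_{(1)}^{(0)}\otimes c_{(2)}^{(0)}\otimes c_{(1)}^{(1)}c_{(2)}^{(1)}=(c^{(0)})_{(1)}\otimes(c^{(0)})_{(2)}\otimes c^{(1)}$ and $\varepsilon(c^{(0)})\,c^{(1)}=\varepsilon(c)\,1$. Let $H$ coact in this sense on $C$ and on $D$. **First homoschism group.** Let $\Gamma(C\circlearrowright H)$ be the group, under convolution $\ast$, of the convolution invertible $\phi\in\operatorname{Hom}_R(C,H)$ with $\varepsilon_H\circ\phi=\varepsilon_C$, $\;\phi(c)_{(1)}\otimes\phi(c)_{(2)}=\phi(c_{(1)}^{(0)})\otimes c_{(1)}^{(1)}\phi(c_{(2)})$ and $c_{(1)}^{(0)}\otimes c_{(1)}^{(1)}\phi(c_{(2)})=c_{(2)}^{(0)}\otimes\phi(c_{(1)})c_{(2)}^{(1)}$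 for all $c\in C$. A coalgebra morphism $p\colon C\to E$ is cocentral if $p(c_{(1)})\otimes c_{(2)}=p(c_{(2)})\otimes c_{(1)}$ for all $c$; a functional on the cocentre $Z(C)$ (the universal cocentral quotient of $C$) is a linear map $C\to R$ that factors through a cocentral coalgebra morphism. Each convolution invertible functional $v$ on the cocentre (that is, $v$ and $v^{\ast-1}$ are both functionals on the cocentre) defines an inner cocharacter $\big((v\otimes\mathrm{id})\circ\delta\big)\ast(v\otimes 1)^{\ast-1}\in\Gamma(C\circlearrowright H)$. The inner cocharacters form a normal subgroup, and $S^1(H,C)$ is the quotient of $\Gamma(C\circlearrowright H)$ by it. **Morita–Takeuchi bicomodules.** A $(C,D)$-bicomodule $M$ is a Morita–Takeuchi bicomodule if (i) it is quasi-finite: the functor $-\mathbin{\square}_C M$ from right $C$-comodules to right $D$-comodules has a left adjoint $\mathsf{CoHom}(M,-)$; (ii) it is an injector: $\mathsf{CoHom}(M,-)$ is exact; (iii) it is faithfully coflat: $M\mathbin{\square}_D-$ from left $D$-comodules to $R$-modules is exact and faithful; (iv) the canonical map $\mathsf{CoEnd}(M)=\mathsf{CoHom}(M,M)\to C$ induced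 by the left coaction $M\to C\otimes M$ is an isomorphism. The coalgebras $C$ and $D$ are Morita–Takeuchi equivalent if such an $M$ exists. **Equivariant Picard set.** An $H$-equivariant comodule is a comodule with an $H$-comodule structure for which the $C$-coaction (resp. $D$-coaction) is $H$-colinear, tensor products carrying the codiagonal coaction $x\otimes y\mapsto x^{(0)}\otimes y^{(0)}\otimes x^{(1)}y^{(1)}$; an equivariant bicomodule is a bicomodule with an $H$-comodule structure that is compatible in this way with both coactions. An $H$-equivariant Morita–Takeuchi bicomodule is an $H$-equivariant $(C,D)$-bicomodule whose underlying bicomodule is a Morita–Takeuchi bicomodule and which satisfies (i)–(iv) also in the categories of $H$-equivariant comodules and $H$-colinear comodule morphisms. $\mathsf{Pic}_H(C,D)$ is the set of isomorphism classes of $H$-equivariant Morita–Takeuchi $(C,D)$-bicomodules. **Proposition.** If $C$ and $D$ are Morita–Takeuchi equivalent, then the groups $S^1(H,C)$ and $S^1(H,D)$ are isomorphic, or $\mathsf{Pic}_H(C,D)=\emptyset$ (or both). -/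

import Mathlib

open TensorProduct Coalgebra

universe u

namespace MoritaTakeuchi

/-! ### Comodules and colinear maps -/

section Comodules

variable {R C M : Type u} [CommRing R] [AddCommGroup C] [Module R C] [Coalgebra R C]
  [AddCommGroup M] [Module R M]

/-- `ρ : M → M ⊗ C` makes `M` a right `C`-comodule (coassociativity and counitarity). -/
structure IsRightComodule (ρ : M →ₗ[R] M ⊗[R] C) : Prop where
  coassoc : (TensorProduct.assoc R M C C).toLinearMap ∘ₗ ρ.rTensor C ∘ₗ ρ = comul.lTensor M ∘ₗ ρ
  counit : counit.lTensor M ∘ₗ ρ = (TensorProduct.mk R M R).flip 1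

/-- `l : M → C ⊗ M` makes `M` a left `C`-comodule. -/
structure IsLeftComodule (l : M →ₗ[R] C ⊗[R] M) : Prop where
  coassoc : (TensorProduct.assoc R C C M).toLinearMap ∘ₗ comul.rTensor M ∘ₗ l = l.lTensor C ∘ₗ l
  counit : counit.rTensor M ∘ₗ l = TensorProduct.mk R R M 1

end Comodules

/-- `f` is compatible with the maps `ρM : M → M ⊗ C` and `ρN : N → N ⊗ C`
(a morphism of right comodules if these are coactions). Only the module structure of `C` enters. -/
def IsRightColinear {R C M N : Type u} [CommRing R] [AddCommGroup C] [Module R C]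
    [AddCommGroup M] [Module R M] [AddCommGroup N] [Module R N]
    (ρM : M →ₗ[R] M ⊗[R] C) (ρN : N →ₗ[R] N ⊗[R] C) (f : M →ₗ[R] N) : Prop :=
  ρN ∘ₗ f = f.rTensor C ∘ₗ ρM

/-- The left-handed analogue of `IsRightColinear`. -/
def IsLeftColinear {R C M N : Type u} [CommRing R] [AddCommGroup C] [Module R C]
    [AddCommGroup M] [Module R M] [AddCommGroup N] [Module R N]
    (lM : M →ₗ[R] C ⊗[R] M) (lN : N →ₗ[R] C ⊗[R] N) (f : M →ₗ[R] N) : Prop :=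
  lN ∘ₗ f = f.lTensor C ∘ₗ lM

/-- The codiagonal map `x ⊗ y ↦ x⁽⁰⁾ ⊗ y⁽⁰⁾ ⊗ x⁽¹⁾ y⁽¹⁾` on `X ⊗ Y`. -/
noncomputable def codiag {R X Y H : Type u} [CommRing R] [AddCommGroup X] [Module R X]
    [AddCommGroup Y] [Module R Y] [Ring H] [HopfAlgebra R H]
    (δX : X →ₗ[R] X ⊗[R] H) (δY : Y →ₗ[R] Y ⊗[R] H) :
    X ⊗[R] Y →ₗ[R] (X ⊗[R] Y) ⊗[R] H :=
  (LinearMap.mul' R H).lTensor (X ⊗[R] Y) ∘ₗ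
    (TensorProduct.tensorTensorTensorComm R X H Y H).toLinearMap ∘ₗ TensorProduct.map δX δY

/-- A (right) coaction of a Hopf algebra `H` on a coalgebra `C`: an `H`-comodule structure
`δ c = c⁽⁰⁾ ⊗ c⁽¹⁾` on `C` that is coflat, i.e.
`c₍₁₎⁽⁰⁾ ⊗ c₍₂₎⁽⁰⁾ ⊗ c₍₁₎⁽¹⁾ c₍₂₎⁽¹⁾ = (c⁽⁰⁾)₍₁₎ ⊗ (c⁽⁰⁾)₍₂₎ ⊗ c⁽¹⁾` and `ε(c⁽⁰⁾) ⊗ c⁽¹⁾ = ε(c) ⊗ 1`. -/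
structure HopfCoaction (R C H : Type u) [CommRing R] [AddCommGroup C] [Module R C]
    [Coalgebra R C] [Ring H] [HopfAlgebra R H] where
  δ : C →ₗ[R] C ⊗[R] H
  isComodule : IsRightComodule δ
  comul_colinear : codiag δ δ ∘ₗ comul = comul.rTensor H ∘ₗ δ
  counit_colinear : counit.rTensor H ∘ₗ δ = (TensorProduct.mk R R H).flip 1 ∘ₗ counit

/-! ### Cocharacters, the cocentre and the first homoschism group -/

section Homoschism

open LinearMap WithConv

variable {R C H : Type u} [CommRing R] [AddCommGroup C] [Module R C] [Coalgebra R C]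
    [Ring H] [HopfAlgebra R H]

/-- The conditions defining an `H`-equivariant cocharacter, apart from convolution invertibility:
`ε ∘ φ = ε`, `φ(c)₍₁₎ ⊗ φ(c)₍₂₎ = φ(c₍₁₎⁽⁰⁾) ⊗ c₍₁₎⁽¹⁾ φ(c₍₂₎)` and
`c₍₁₎⁽⁰⁾ ⊗ c₍₁₎⁽¹⁾ φ(c₍₂₎) = c₍₂₎⁽⁰⁾ ⊗ φ(c₍₁₎) c₍₂₎⁽¹⁾`. -/
structure IsCocharacter (a : HopfCoaction R C H) (φ : C →ₗ[R] H) : Prop where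
  counit_condition : counit ∘ₗ φ = counit
  coaction_condition : comul ∘ₗ φ = (mul' R H).lTensor H ∘ₗ
    (TensorProduct.assoc R H H H).toLinearMap ∘ₗ map (φ.rTensor H ∘ₗ a.δ) φ ∘ₗ comul
  comodule_condition :
    (mul' R H).lTensor C ∘ₗ (TensorProduct.assoc R C H H).toLinearMap ∘ₗ map a.δ φ ∘ₗ comul =
      (mul' R H).lTensor C ∘ₗ (TensorProduct.leftComm R H C H).toLinearMap ∘ₗ
        map φ a.δ ∘ₗ comul

/-- Composition with an algebra homomorphism, as a homomorphism of convolution monoids. -/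
noncomputable def convMap {A B : Type u} [Ring A] [Algebra R A] [Ring B] [Algebra R B]
    (h : A →ₐ[R] B) : WithConv (C →ₗ[R] A) →* WithConv (C →ₗ[R] B) where
  toFun f := toConv (h.toLinearMap ∘ₗ f.ofConv)
  map_one' := by ext c; simp
  map_mul' f g := by rw [algHom_comp_convMul_distrib]

/-- `f ↦ (f ⊗ id) ∘ δ`, as a homomorphism of convolution monoids. -/
noncomputable def coactMap (a : HopfCoaction R C H) (A : Type u) [Ring A] [Algebra R A] :
    WithConv (C →ₗ[R] A) →* WithConv (C →ₗ[R] A ⊗[R] H) where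
  toFun f := toConv (f.ofConv.rTensor H ∘ₗ a.δ)
  map_one' := by
    ext c
    have := LinearMap.congr_fun a.counit_colinear c
    simp only [LinearMap.comp_apply] at this
    simp only [LinearMap.convOne_def, LinearMap.comp_apply, ofConv_toConv, rTensor_comp, this]
    simp [Algebra.algebraMap_eq_smul_one, smul_tmul', Algebra.TensorProduct.one_def]
  map_mul' f g := by
    have h : mul' R (A ⊗[R] H) ∘ₗ map (f.ofConv.rTensor H) (g.ofConv.rTensor H) =
        (mul' R A ∘ₗ map f.ofConv g.ofConv).rTensor H ∘ₗ
          (mul' R H).lTensor (C ⊗[R] C) ∘ₗ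
            (tensorTensorTensorComm R C H C H).toLinearMap := by
      ext; simp
    ext c
    have e := LinearMap.congr_fun a.comul_colinear c
    have h' := LinearMap.congr_fun h (map a.δ a.δ (comul c))
    simp only [LinearMap.comp_apply, codiag, LinearEquiv.coe_coe] at e h'
    rw [e] at h'
    simp only [LinearMap.convMul_def, LinearMap.comp_apply, ofConv_toConv, rTensor_comp, map_comp] at h' ⊢
    exact h'.symm

theorem coactMap_mul (a : HopfCoaction R C H) {A : Type u} [Ring A] [Algebra R A]
    (f : WithConv (C →ₗ[R] A)) (φ : WithConv (C →ₗ[R] H)) :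
    coactMap a A f * convMap Algebra.TensorProduct.includeRight φ =
      toConv (f.ofConv.rTensor H ∘ₗ (mul' R H).lTensor C ∘ₗ
        (TensorProduct.assoc R C H H).toLinearMap ∘ₗ map a.δ φ.ofConv ∘ₗ comul) := by
  have h : mul' R (A ⊗[R] H) ∘ₗ map (f.ofConv.rTensor H)
      ((Algebra.TensorProduct.includeRight : H →ₐ[R] A ⊗[R] H).toLinearMap) =
      f.ofConv.rTensor H ∘ₗ (mul' R H).lTensor C ∘ₗ
        (TensorProduct.assoc R C H H).toLinearMap := by
    ext; simp
  ext c
  have h' := LinearMap.congr_fun h (map a.δ φ.ofConv (comul c))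
  simp only [LinearMap.comp_apply] at h'
  simp only [LinearMap.convMul_def, coactMap, convMap, MonoidHom.coe_mk, OneHom.coe_mk, ofConv_toConv,
    LinearMap.comp_apply, map_comp]
  exact h'

theorem mul_coactMap (a : HopfCoaction R C H) {A : Type u} [Ring A] [Algebra R A]
    (f : WithConv (C →ₗ[R] A)) (φ : WithConv (C →ₗ[R] H)) :
    convMap Algebra.TensorProduct.includeRight φ * coactMap a A f =
      toConv (f.ofConv.rTensor H ∘ₗ (mul' R H).lTensor C ∘ₗ
        (TensorProduct.leftComm R H C H).toLinearMap ∘ₗ map φ.ofConv a.δ ∘ₗ comul) := by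
  have h : mul' R (A ⊗[R] H) ∘ₗ map
      ((Algebra.TensorProduct.includeRight : H →ₐ[R] A ⊗[R] H).toLinearMap)
      (f.ofConv.rTensor H) =
      f.ofConv.rTensor H ∘ₗ (mul' R H).lTensor C ∘ₗ
        (TensorProduct.leftComm R H C H).toLinearMap := by
    ext; simp
  ext c
  have h' := LinearMap.congr_fun h (map φ.ofConv a.δ (comul c))
  simp only [LinearMap.comp_apply] at h'
  simp only [LinearMap.convMul_def, coactMap, convMap, MonoidHom.coe_mk, OneHom.coe_mk, ofConv_toConv,
    LinearMap.comp_apply, map_comp]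
  exact h'


theorem comodule_condition_iff (a : HopfCoaction R C H) (φ : WithConv (C →ₗ[R] H)) :
    (mul' R H).lTensor C ∘ₗ (TensorProduct.assoc R C H H).toLinearMap ∘ₗ
        map a.δ φ.ofConv ∘ₗ comul =
      (mul' R H).lTensor C ∘ₗ (TensorProduct.leftComm R H C H).toLinearMap ∘ₗ
        map φ.ofConv a.δ ∘ₗ comul ↔
    Commute (coactMap a (TensorAlgebra R C) (toConv (TensorAlgebra.ι R)))
      (convMap Algebra.TensorProduct.includeRight φ) := by
  rw [commute_iff_eq, coactMap_mul, mul_coactMap]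
  constructor
  · intro h; rw [h]
  · intro h
    have h2 : (TensorAlgebra.ιInv (R := R) (M := C)).rTensor H ∘ₗ
        (TensorAlgebra.ι R).rTensor H = LinearMap.id := by
      rw [← rTensor_comp]
      have : TensorAlgebra.ιInv ∘ₗ TensorAlgebra.ι R = (LinearMap.id : C →ₗ[R] C) :=
        LinearMap.ext TensorAlgebra.ι_leftInverse
      rw [this, rTensor_id]
    have h3 := congrArg (fun f => (TensorAlgebra.ιInv (R := R) (M := C)).rTensor H ∘ₗ f)
      (toConv_injective h)
    simpa only [← LinearMap.comp_assoc, h2, LinearMap.id_comp] using h3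

theorem comm_of_comodule_condition {a : HopfCoaction R C H} {φ : WithConv (C →ₗ[R] H)}
    (h : (mul' R H).lTensor C ∘ₗ (TensorProduct.assoc R C H H).toLinearMap ∘ₗ
        map a.δ φ.ofConv ∘ₗ comul =
      (mul' R H).lTensor C ∘ₗ (TensorProduct.leftComm R H C H).toLinearMap ∘ₗ
        map φ.ofConv a.δ ∘ₗ comul) {A : Type u} [Ring A] [Algebra R A]
    (f : WithConv (C →ₗ[R] A)) :
    Commute (coactMap a A f) (convMap Algebra.TensorProduct.includeRight φ) := by
  rw [commute_iff_eq, coactMap_mul, mul_coactMap, h]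

theorem counit_condition_iff (φ : WithConv (C →ₗ[R] H)) :
    counit ∘ₗ φ.ofConv = (counit : C →ₗ[R] R) ↔ convMap (Bialgebra.counitAlgHom R H) φ = 1 := by
  constructor
  · intro h; ext c; simpa [convMap] using LinearMap.congr_fun h c
  · intro h; ext c; simpa [convMap] using LinearMap.congr_fun (congrArg ofConv h) c

theorem coaction_condition_iff (a : HopfCoaction R C H) (φ : WithConv (C →ₗ[R] H)) :
    comul ∘ₗ φ.ofConv = (mul' R H).lTensor H ∘ₗ
      (TensorProduct.assoc R H H H).toLinearMap ∘ₗ map (φ.ofConv.rTensor H ∘ₗ a.δ) φ.ofConv ∘ₗ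
        comul ↔
    convMap (Bialgebra.comulAlgHom R H) φ =
      coactMap a H φ * convMap Algebra.TensorProduct.includeRight φ := by
  have h : (mul' R H).lTensor H ∘ₗ
      (TensorProduct.assoc R H H H).toLinearMap ∘ₗ map (φ.ofConv.rTensor H ∘ₗ a.δ) φ.ofConv =
      φ.ofConv.rTensor H ∘ₗ (mul' R H).lTensor C ∘ₗ
        (TensorProduct.assoc R C H H).toLinearMap ∘ₗ map a.δ φ.ofConv := by
    have h1 : (mul' R H).lTensor H ∘ₗ
      (TensorProduct.assoc R H H H).toLinearMap ∘ₗ (φ.ofConv.rTensor H).rTensor H = 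
      φ.ofConv.rTensor H ∘ₗ (mul' R H).lTensor C ∘ₗ
        (TensorProduct.assoc R C H H).toLinearMap := by
      ext; simp
    have h2 : map (φ.ofConv.rTensor H ∘ₗ a.δ) φ.ofConv =
        (φ.ofConv.rTensor H).rTensor H ∘ₗ map a.δ φ.ofConv := by
      ext; simp
    rw [h2]
    simpa only [LinearMap.comp_assoc] using congrArg (fun f => f ∘ₗ map a.δ φ.ofConv) h1
  have h' := congrArg (fun f => f ∘ₗ (comul : C →ₗ[R] C ⊗[R] C)) h
  simp only [LinearMap.comp_assoc] at h'
  rw [h', coactMap_mul]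
  exact ⟨fun e => congrArg toConv e, fun e => toConv_injective e⟩

theorem isCocharacter_iff (a : HopfCoaction R C H) (φ : WithConv (C →ₗ[R] H)) :
    IsCocharacter a φ.ofConv ↔ convMap (Bialgebra.counitAlgHom R H) φ = 1 ∧
      convMap (Bialgebra.comulAlgHom R H) φ =
        coactMap a H φ * convMap Algebra.TensorProduct.includeRight φ ∧
      Commute (coactMap a (TensorAlgebra R C) (toConv (TensorAlgebra.ι R)))
        (convMap Algebra.TensorProduct.includeRight φ) := by
  rw [← counit_condition_iff, ← coaction_condition_iff, ← comodule_condition_iff]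
  exact ⟨fun h => ⟨h.1, h.2, h.3⟩, fun h => ⟨h.1, h.2.1, h.2.2⟩⟩

/-- The group `Γ(C ↻ H)` of `H`-equivariant cocharacters, a subgroup of the group of convolution
invertible linear maps `C → H`. -/
noncomputable def cocharacterGroup (a : HopfCoaction R C H) :
    Subgroup (WithConv (C →ₗ[R] H))ˣ where
  carrier := {φ | IsCocharacter a (φ : WithConv (C →ₗ[R] H)).ofConv}
  one_mem' := by
    rw [Set.mem_ofPred_eq, isCocharacter_iff]
    simp
  mul_mem' := by
    intro φ ψ hφ hψ
    rw [Set.mem_ofPred_eq] at hφ hψ ⊢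
    have hc := comm_of_comodule_condition hφ.3 (ψ : WithConv (C →ₗ[R] H))
    rw [isCocharacter_iff] at hφ hψ ⊢
    obtain ⟨a1, a2, a3⟩ := hφ
    obtain ⟨b1, b2, b3⟩ := hψ
    refine ⟨by simp [a1, b1], ?_, ?_⟩
    · rw [Units.val_mul, map_mul, map_mul, map_mul, a2, b2]
      rw [mul_assoc, ← mul_assoc (convMap _ _) (coactMap a H _), ← hc.eq]
      simp only [mul_assoc]
    · rw [Units.val_mul, map_mul]
      exact a3.mul_right b3
  inv_mem' := by
    intro φ hφ
    rw [Set.mem_ofPred_eq] at hφ ⊢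
    have hc := comm_of_comodule_condition hφ.3 ((φ⁻¹ : (WithConv (C →ₗ[R] H))ˣ) : WithConv (C →ₗ[R] H))
    rw [isCocharacter_iff] at hφ ⊢
    obtain ⟨a1, a2, a3⟩ := hφ
    have e1 : Units.map (convMap (C := C) (Bialgebra.counitAlgHom R H)) φ = 1 := Units.ext a1
    have e2 : Units.map (convMap (C := C) (Bialgebra.comulAlgHom R H)) φ =
        Units.map (coactMap a H) φ *
          Units.map (convMap (Algebra.TensorProduct.includeRight (A := H))) φ := Units.ext a2
    have e3 : Commute (Units.map (coactMap a H) φ⁻¹)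
        (Units.map (convMap (Algebra.TensorProduct.includeRight (A := H))) φ) := Units.ext hc
    refine ⟨?_, ?_, ?_⟩
    · have := congrArg Units.val (inv_eq_one.mpr e1)
      rwa [← map_inv] at this
    · have h := congrArg (fun x => x⁻¹) e2
      have h' : Units.map (convMap (C := C) (Bialgebra.comulAlgHom R H)) φ⁻¹ =
          Units.map (coactMap a H) φ⁻¹ *
            Units.map (convMap (Algebra.TensorProduct.includeRight (A := H))) φ⁻¹ := by
        simp only [mul_inv_rev] at h
        have h4 := e3.inv_right.eq
        rw [map_inv (Units.map (convMap (C := C) (Bialgebra.comulAlgHom R H))) φ, h,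
          map_inv (Units.map (convMap (C := C)
            (Algebra.TensorProduct.includeRight (A := H) (B := H) (R := R)))) φ, h4,
          map_inv (Units.map (coactMap a H)) φ]
      exact congrArg Units.val h'
    · exact Commute.units_inv_right
        (u := Units.map (convMap (Algebra.TensorProduct.includeRight (A := TensorAlgebra R C))) φ)
        a3

/-- A linear map `p` on a coalgebra is cocentral if `p(c₍₁₎) ⊗ c₍₂₎ = p(c₍₂₎) ⊗ c₍₁₎`. -/
def IsCocentral {E : Type u} [AddCommGroup E] [Module R E] (p : C →ₗ[R] E) : Prop :=
  p.rTensor C ∘ₗ comul =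
    p.rTensor C ∘ₗ (TensorProduct.comm R C C).toLinearMap ∘ₗ comul

/-- `f` is a linear functional on the cocentre of `C`, the universal cocentral quotient coalgebra:
it factors through some cocentral coalgebra morphism `C → E`. -/
def IsCocentreFunctional (f : C →ₗ[R] R) : Prop :=
  ∃ (E : Type u) (_ : AddCommGroup E) (_ : Module R E) (_ : Coalgebra R E) (p : C →ₗc[R] E)
    (g : E →ₗ[R] R), IsCocentral p.toLinearMap ∧ f = g ∘ₗ p.toLinearMap

theorem IsCocentreFunctional.isCocentral {f : C →ₗ[R] R} (h : IsCocentreFunctional f) :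
    IsCocentral f := by
  obtain ⟨E, _, _, _, p, g, hp, rfl⟩ := h
  unfold IsCocentral at *
  rw [rTensor_comp, LinearMap.comp_assoc, hp]
  rfl

theorem isCocentral_counit : IsCocentral (counit : C →ₗ[R] R) := by
  unfold IsCocentral
  have h : (counit : C →ₗ[R] R).rTensor C ∘ₗ (TensorProduct.comm R C C).toLinearMap =
      (TensorProduct.comm R C R).toLinearMap ∘ₗ (counit : C →ₗ[R] R).lTensor C := by
    ext; simp
  rw [← LinearMap.comp_assoc, h, LinearMap.comp_assoc, rTensor_counit_comp_comul,
    lTensor_counit_comp_comul]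
  ext; simp

theorem isCocentreFunctional_one : IsCocentreFunctional (1 : WithConv (C →ₗ[R] R)).ofConv := by
  refine ⟨R, inferInstance, inferInstance, inferInstance, counitCoalgHom R C, LinearMap.id,
    isCocentral_counit, ?_⟩
  ext c; simp

theorem IsCocentral.map_swap {E F : Type u} [AddCommGroup E] [Module R E] [AddCommGroup F] [Module R F]
    {p : C →ₗ[R] E} (hp : IsCocentral p) (q : C →ₗ[R] F) :
    map q p ∘ₗ comul = map q p ∘ₗ (TensorProduct.comm R C C).toLinearMap ∘ₗ comul := by
  have h1 : map q p = (TensorProduct.comm R E F).toLinearMap ∘ₗ q.lTensor E ∘ₗ p.rTensor C ∘ₗ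
      (TensorProduct.comm R C C).toLinearMap := by ext; simp
  have h2 : (TensorProduct.comm R C C).toLinearMap ∘ₗ (TensorProduct.comm R C C).toLinearMap =
    LinearMap.id := by ext; simp
  unfold IsCocentral at hp
  have h3 : (TensorProduct.comm R C C).toLinearMap ∘ₗ (TensorProduct.comm R C C).toLinearMap ∘ₗ
      comul = (comul : C →ₗ[R] C ⊗[R] C) := by
    rw [← LinearMap.comp_assoc, h2, LinearMap.id_comp]
  rw [h1]
  simp only [LinearMap.comp_assoc]
  rw [h3, hp]

theorem comul_four : map comul comul ∘ₗ (comul : C →ₗ[R] C ⊗[R] C) =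
    (TensorProduct.assoc R C C (C ⊗[R] C)).symm.toLinearMap ∘ₗ
    ((TensorProduct.assoc R C C C).toLinearMap ∘ₗ comul.rTensor C ∘ₗ comul).lTensor C ∘ₗ comul := by
  simp only [coassoc_simps]

theorem comul_pair {E F : Type u} [AddCommGroup E] [Module R E] [AddCommGroup F] [Module R F]
    [Coalgebra R E] [Coalgebra R F] (p : C →ₗc[R] E) (q : C →ₗc[R] F) (hp : IsCocentral p.toLinearMap) :
  map (map p.toLinearMap q.toLinearMap ∘ₗ comul) (map p.toLinearMap q.toLinearMap ∘ₗ comul) ∘ₗ comul = comul ∘ₗ map p.toLinearMap q.toLinearMap ∘ₗ comul := by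
  have a1 : map (map p.toLinearMap q.toLinearMap) (map p.toLinearMap q.toLinearMap) ∘ₗ
     (TensorProduct.assoc R C C (C ⊗[R] C)).symm.toLinearMap ∘ₗ
     (TensorProduct.assoc R C C C).toLinearMap.lTensor C = 
     (TensorProduct.assoc R E F (E ⊗[R] F)).symm.toLinearMap ∘ₗ
     (TensorProduct.assoc R F E F).toLinearMap.lTensor E ∘ₗ map p.toLinearMap (map (map q.toLinearMap p.toLinearMap) q.toLinearMap) := by ext; simp
  have a2 : (tensorTensorTensorComm R C C C C).toLinearMap ∘ₗ
     (TensorProduct.assoc R C C (C ⊗[R] C)).symm.toLinearMap ∘ₗ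
     (TensorProduct.assoc R C C C).toLinearMap.lTensor C = 
     (TensorProduct.assoc R C C (C ⊗[R] C)).symm.toLinearMap ∘ₗ
     (TensorProduct.assoc R C C C).toLinearMap.lTensor C ∘ₗ ((TensorProduct.comm R C C).toLinearMap.rTensor C).lTensor C := by ext; simp
  have a3 : comul ∘ₗ map p.toLinearMap q.toLinearMap = map (map p.toLinearMap q.toLinearMap) (map p.toLinearMap q.toLinearMap) ∘ₗ (tensorTensorTensorComm R C C C C).toLinearMap ∘ₗ map comul comul := by
    have : (tensorTensorTensorComm R E E F F).toLinearMap ∘ₗ map (map p.toLinearMap p.toLinearMap) (map q.toLinearMap q.toLinearMap) = map (map p.toLinearMap q.toLinearMap) (map p.toLinearMap q.toLinearMap) ∘ₗ (tensorTensorTensorComm R C C C C).toLinearMap := by ext; simp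
    rw [← LinearMap.comp_assoc, ← this, LinearMap.comp_assoc, ← map_comp, p.map_comp_comul, q.map_comp_comul, map_comp]
    rfl
  rw [← LinearMap.comp_assoc, a3, map_comp]
  simp only [LinearMap.comp_assoc]
  rw [comul_four, lTensor_comp]
  have b1 := congrArg (fun f => f ∘ₗ (comul.rTensor C ∘ₗ comul).lTensor C ∘ₗ (comul : C →ₗ[R] C ⊗[R] C)) a1
  have b2 := congrArg (fun f => map (map p.toLinearMap q.toLinearMap) (map p.toLinearMap q.toLinearMap) ∘ₗ f ∘ₗ (comul.rTensor C ∘ₗ comul).lTensor C ∘ₗ (comul : C →ₗ[R] C ⊗[R] C)) a2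
  have b3 := congrArg (fun f => f ∘ₗ ((TensorProduct.comm R C C).toLinearMap.rTensor C).lTensor C ∘ₗ (comul.rTensor C ∘ₗ comul).lTensor C ∘ₗ (comul : C →ₗ[R] C ⊗[R] C)) a1
  simp only [LinearMap.comp_assoc] at b1 b2 b3 ⊢
  rw [b1, b2, b3]
  congr 2
  have key := hp.map_swap q.toLinearMap
  rw [← LinearMap.comp_assoc, ← LinearMap.comp_assoc, ← LinearMap.comp_assoc]
  congr 1
  rw [map_comp_lTensor, LinearMap.comp_assoc, ← lTensor_comp, map_comp_lTensor]
  congr 1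
  rw [← LinearMap.comp_assoc, ← LinearMap.comp_assoc, ← LinearMap.comp_assoc, map_comp_rTensor, map_comp_rTensor, map_comp_rTensor, key, LinearMap.comp_assoc]

theorem cocentral_pair {E F : Type u} [AddCommGroup E] [Module R E] [AddCommGroup F] [Module R F]
    (p : C →ₗ[R] E) (q : C →ₗ[R] F) (hp : IsCocentral p) (hq : IsCocentral q) :
  IsCocentral (map p q ∘ₗ comul) := by
  unfold IsCocentral at *
  have e1 : (map p q).rTensor C ∘ₗ (TensorProduct.assoc R C C C).symm.toLinearMap =
      (TensorProduct.assoc R E F C).symm.toLinearMap ∘ₗ p.rTensor (F ⊗[R] C) ∘ₗ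
        (q.rTensor C).lTensor C := by ext; simp
  have e2 : (TensorProduct.assoc R E F C).symm.toLinearMap ∘ₗ p.rTensor (F ⊗[R] C) ∘ₗ
        (q.rTensor C ∘ₗ (TensorProduct.comm R C C).toLinearMap).lTensor C ∘ₗ
          (TensorProduct.assoc R C C C).toLinearMap =
      (TensorProduct.rightComm R E C F).toLinearMap ∘ₗ q.lTensor (E ⊗[R] C) ∘ₗ
        (p.rTensor C).rTensor C := by ext; simp
  have e3 : (TensorProduct.rightComm R E C F).toLinearMap ∘ₗ q.lTensor (E ⊗[R] C) ∘ₗ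
        (p.rTensor C ∘ₗ (TensorProduct.comm R C C).toLinearMap).rTensor C =
      (map p q).rTensor C ∘ₗ (TensorProduct.comm R C (C ⊗[R] C)).toLinearMap ∘ₗ
        (TensorProduct.assoc R C C C).toLinearMap := by ext; simp
  have e4 : (comul : C →ₗ[R] C ⊗[R] C).rTensor C ∘ₗ (TensorProduct.comm R C C).toLinearMap =
      (TensorProduct.comm R C (C ⊗[R] C)).toLinearMap ∘ₗ comul.lTensor C := by ext; simp
  have c1 : comul.rTensor C ∘ₗ comul = (TensorProduct.assoc R C C C).symm.toLinearMap ∘ₗ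
      comul.lTensor C ∘ₗ (comul : C →ₗ[R] C ⊗[R] C) := by rw [coassoc_symm]
  have c2 : (TensorProduct.assoc R C C C).toLinearMap ∘ₗ comul.rTensor C ∘ₗ comul =
      comul.lTensor C ∘ₗ (comul : C →ₗ[R] C ⊗[R] C) := coassoc
  calc (map p q ∘ₗ comul).rTensor C ∘ₗ comul
      = ((map p q).rTensor C ∘ₗ (TensorProduct.assoc R C C C).symm.toLinearMap) ∘ₗ
          comul.lTensor C ∘ₗ comul := by
        rw [rTensor_comp, LinearMap.comp_assoc, c1, LinearMap.comp_assoc]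
    _ = ((TensorProduct.assoc R E F C).symm.toLinearMap ∘ₗ p.rTensor (F ⊗[R] C)) ∘ₗ
          (q.rTensor C ∘ₗ comul).lTensor C ∘ₗ comul := by
        rw [e1, lTensor_comp]; simp only [LinearMap.comp_assoc]
    _ = ((TensorProduct.assoc R E F C).symm.toLinearMap ∘ₗ p.rTensor (F ⊗[R] C) ∘ₗ
        (q.rTensor C ∘ₗ (TensorProduct.comm R C C).toLinearMap).lTensor C ∘ₗ
          (TensorProduct.assoc R C C C).toLinearMap) ∘ₗ comul.rTensor C ∘ₗ comul := by
        rw [hq, ← LinearMap.comp_assoc _ _ (q.rTensor C), lTensor_comp]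
        simp only [LinearMap.comp_assoc]
        rw [c2]
    _ = ((TensorProduct.rightComm R E C F).toLinearMap ∘ₗ q.lTensor (E ⊗[R] C)) ∘ₗ
          (p.rTensor C ∘ₗ comul).rTensor C ∘ₗ comul := by
        rw [e2, rTensor_comp]; simp only [LinearMap.comp_assoc]
    _ = ((TensorProduct.rightComm R E C F).toLinearMap ∘ₗ q.lTensor (E ⊗[R] C) ∘ₗ
        (p.rTensor C ∘ₗ (TensorProduct.comm R C C).toLinearMap).rTensor C) ∘ₗ
          comul.rTensor C ∘ₗ comul := by
        rw [hp, ← LinearMap.comp_assoc _ _ (p.rTensor C), rTensor_comp]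
        simp only [LinearMap.comp_assoc]
    _ = (map p q ∘ₗ comul).rTensor C ∘ₗ (TensorProduct.comm R C C).toLinearMap ∘ₗ comul := by
        have e5 := congrArg (fun f => f ∘ₗ (comul : C →ₗ[R] C ⊗[R] C)) e4
        simp only [LinearMap.comp_assoc] at e5
        rw [e3, rTensor_comp]
        simp only [LinearMap.comp_assoc]
        rw [c2, e5]

theorem IsCocentreFunctional.mul {f g : WithConv (C →ₗ[R] R)}
    (hf : IsCocentreFunctional f.ofConv) (hg : IsCocentreFunctional g.ofConv) :
    IsCocentreFunctional (f * g).ofConv := by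
  obtain ⟨E, _, _, _, p, x, hp, hx⟩ := hf
  obtain ⟨F, _, _, _, q, y, hq, hy⟩ := hg
  let r : C →ₗ[R] E ⊗[R] F := map p.toLinearMap q.toLinearMap ∘ₗ comul
  let r' : C →ₗc[R] E ⊗[R] F :=
    { r with
      counit_comp := by
        have h : (counit : E ⊗[R] F →ₗ[R] R) ∘ₗ map p.toLinearMap q.toLinearMap =
            (TensorProduct.lid R R).toLinearMap ∘ₗ (counit : C →ₗ[R] R).lTensor R ∘ₗ
              (counit : C →ₗ[R] R).rTensor C := by
          ext; simp [mul_comm]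
        change counit ∘ₗ map p.toLinearMap q.toLinearMap ∘ₗ comul = counit
        rw [← LinearMap.comp_assoc, h, LinearMap.comp_assoc, LinearMap.comp_assoc,
          rTensor_counit_comp_comul]
        ext; simp
      map_comp_comul := comul_pair p q hp }
  refine ⟨E ⊗[R] F, inferInstance, inferInstance, inferInstance, r',
    mul' R R ∘ₗ map x y, cocentral_pair p.toLinearMap q.toLinearMap hp hq, ?_⟩
  have : r'.toLinearMap = r := rfl
  rw [this]
  simp only [r, LinearMap.convMul_def, ofConv_toConv, hx, hy, map_comp, LinearMap.comp_assoc]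

/-- The group of convolution invertible functionals on the cocentre of `C`. -/
def cocentreUnits (R C : Type u) [CommRing R] [AddCommGroup C] [Module R C] [Coalgebra R C] :
    Subgroup (WithConv (C →ₗ[R] R))ˣ where
  carrier := {v | IsCocentreFunctional (v : WithConv (C →ₗ[R] R)).ofConv ∧
    IsCocentreFunctional ((v⁻¹ : (WithConv (C →ₗ[R] R))ˣ) : WithConv (C →ₗ[R] R)).ofConv}
  one_mem' := by
    rw [Set.mem_ofPred_eq, inv_one]
    exact ⟨isCocentreFunctional_one, isCocentreFunctional_one⟩
  mul_mem' := by
    intro v w hv hw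
    rw [Set.mem_ofPred_eq] at *
    rw [mul_inv_rev]
    exact ⟨hv.1.mul hw.1, hw.2.mul hv.2⟩
  inv_mem' := by
    intro v hv
    rw [Set.mem_ofPred_eq] at *
    rw [inv_inv]
    exact ⟨hv.2, hv.1⟩

/-- `f ↦ (f ⊗ id) ∘ δ` for functionals `f`, with values in `R ⊗ H = H`. -/
noncomputable def coactFunctional (a : HopfCoaction R C H) :
    WithConv (C →ₗ[R] R) →* WithConv (C →ₗ[R] H) :=
  (convMap (Algebra.TensorProduct.lid R H).toAlgHom).comp (coactMap a R)

/-- `f ↦ f ⊗ 1` for functionals `f`, with values in `R ⊗ H = H`. -/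
noncomputable def scalarFunctional (H : Type u) [Ring H] [HopfAlgebra R H] :
    WithConv (C →ₗ[R] R) →* WithConv (C →ₗ[R] H) :=
  convMap (Algebra.ofId R H)

theorem commute_scalar {f : WithConv (C →ₗ[R] R)} (hf : IsCocentral f.ofConv)
    {A : Type u} [Ring A] [Algebra R A] (x : WithConv (C →ₗ[R] A)) :
    Commute (convMap (Algebra.ofId R A) f) x := by
  have h : mul' R A ∘ₗ map ((Algebra.ofId R A).toLinearMap ∘ₗ f.ofConv) x.ofConv =
      (TensorProduct.lid R A).toLinearMap ∘ₗ x.ofConv.lTensor R ∘ₗ f.ofConv.rTensor C := by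
    ext; simp [Algebra.ofId_apply, Algebra.smul_def]
  have h' : mul' R A ∘ₗ map x.ofConv ((Algebra.ofId R A).toLinearMap ∘ₗ f.ofConv) =
      (TensorProduct.lid R A).toLinearMap ∘ₗ x.ofConv.lTensor R ∘ₗ f.ofConv.rTensor C ∘ₗ
        (TensorProduct.comm R C C).toLinearMap := by
    ext; simp [Algebra.ofId_apply, Algebra.smul_def, Algebra.commutes]
  unfold IsCocentral at hf
  rw [commute_iff_eq]
  change toConv (mul' R A ∘ₗ map ((Algebra.ofId R A).toLinearMap ∘ₗ f.ofConv) x.ofConv ∘ₗ comul) =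
    toConv (mul' R A ∘ₗ map x.ofConv ((Algebra.ofId R A).toLinearMap ∘ₗ f.ofConv) ∘ₗ comul)
  rw [← LinearMap.comp_assoc, ← LinearMap.comp_assoc, h, h']
  simp only [LinearMap.comp_assoc]
  rw [hf]

theorem commute_coactFunctional {a : HopfCoaction R C H} {φ : WithConv (C →ₗ[R] H)}
    (hφ : IsCocharacter a φ.ofConv) (f : WithConv (C →ₗ[R] R)) :
    Commute (coactFunctional a f) φ := by
  have h := (comm_of_comodule_condition hφ.3 f).map
    (convMap (C := C) (Algebra.TensorProduct.lid R H).toAlgHom)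
  have e : convMap (Algebra.TensorProduct.lid R H).toAlgHom
      (convMap (Algebra.TensorProduct.includeRight (R := R) (A := R)) φ) = φ := by
    ext; simp [convMap]
  rw [e] at h
  exact h

theorem coact_scalar (a : HopfCoaction R C H) (A : Type u) [Ring A] [Algebra R A]
    (f : WithConv (C →ₗ[R] R)) :
    coactMap a A (convMap (Algebra.ofId R A) f) =
      convMap Algebra.TensorProduct.includeRight (coactFunctional a f) := by
  have h : ((Algebra.ofId R A).toLinearMap).rTensor H =
      (Algebra.TensorProduct.includeRight (R := R) (A := A) (B := H)).toLinearMap ∘ₗ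
        (Algebra.TensorProduct.lid R H).toAlgHom.toLinearMap := by
    ext; simp
  change toConv (((Algebra.ofId R A).toLinearMap ∘ₗ f.ofConv).rTensor H ∘ₗ a.δ) = toConv _
  rw [rTensor_comp, h]
  rfl

theorem comul_coactFunctional (a : HopfCoaction R C H) (f : WithConv (C →ₗ[R] R)) :
    convMap (Bialgebra.comulAlgHom R H) (coactFunctional a f) =
      coactMap a H (coactFunctional a f) := by
  have h1 : comul ∘ₗ (TensorProduct.lid R H).toLinearMap ∘ₗ f.ofConv.rTensor H =
      (TensorProduct.lid R (H ⊗[R] H)).toLinearMap ∘ₗ f.ofConv.rTensor (H ⊗[R] H) ∘ₗ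
        comul.lTensor C := by
    ext; simp
  have h2 : ((TensorProduct.lid R H).toLinearMap ∘ₗ f.ofConv.rTensor H).rTensor H =
      (TensorProduct.lid R (H ⊗[R] H)).toLinearMap ∘ₗ f.ofConv.rTensor (H ⊗[R] H) ∘ₗ
        (TensorProduct.assoc R C H H).toLinearMap := by
    ext; simp [smul_tmul']
  apply congrArg toConv
  change comul ∘ₗ (TensorProduct.lid R H).toLinearMap ∘ₗ f.ofConv.rTensor H ∘ₗ a.δ =
    ((TensorProduct.lid R H).toLinearMap ∘ₗ f.ofConv.rTensor H ∘ₗ a.δ).rTensor H ∘ₗ a.δ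
  rw [← LinearMap.comp_assoc a.δ (f.ofConv.rTensor H), rTensor_comp, h2,
    ← LinearMap.comp_assoc, ← LinearMap.comp_assoc]
  rw [LinearMap.comp_assoc _ _ comul, h1]
  simp only [LinearMap.comp_assoc]
  rw [a.isComodule.coassoc]

theorem comul_scalar (f : WithConv (C →ₗ[R] R)) :
    convMap (Bialgebra.comulAlgHom R H) (scalarFunctional H f) =
      convMap Algebra.TensorProduct.includeRight (scalarFunctional H f) := by
  ext c
  simp [convMap, scalarFunctional, Algebra.ofId_apply, Algebra.algebraMap_eq_smul_one, smul_tmul',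
    Algebra.TensorProduct.one_def]

theorem counit_coactFunctional (a : HopfCoaction R C H) (f : WithConv (C →ₗ[R] R)) :
    convMap (Bialgebra.counitAlgHom R H) (coactFunctional a f) = f := by
  have h1 : counit ∘ₗ (TensorProduct.lid R H).toLinearMap ∘ₗ f.ofConv.rTensor H =
      (TensorProduct.rid R R).toLinearMap ∘ₗ f.ofConv.rTensor R ∘ₗ counit.lTensor C := by
    ext; simp [mul_comm]
  apply congrArg toConv
  change counit ∘ₗ (TensorProduct.lid R H).toLinearMap ∘ₗ f.ofConv.rTensor H ∘ₗ a.δ = f.ofConv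
  rw [← LinearMap.comp_assoc, ← LinearMap.comp_assoc, LinearMap.comp_assoc _ _ counit, h1]
  simp only [LinearMap.comp_assoc]
  rw [a.isComodule.counit]
  ext; simp

theorem counit_scalar (f : WithConv (C →ₗ[R] R)) :
    convMap (Bialgebra.counitAlgHom R H) (scalarFunctional H f) = f := by
  ext c; simp [convMap, scalarFunctional]

/-- The map `v ↦ ((v ⊗ id) ∘ δ) * (v ⊗ 1)⁻¹` for convolution invertible functionals `v`. -/
noncomputable def innerMap (a : HopfCoaction R C H) (v : (WithConv (C →ₗ[R] R))ˣ) :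
    (WithConv (C →ₗ[R] H))ˣ :=
  Units.map (coactFunctional a) v * (Units.map (scalarFunctional H) v)⁻¹

theorem innerMap_mem (a : HopfCoaction R C H) {v : (WithConv (C →ₗ[R] R))ˣ}
    (hv : v ∈ cocentreUnits R C) : innerMap a v ∈ cocharacterGroup a := by
  change IsCocharacter a _
  have h1 := hv.1.isCocentral
  have h2 := hv.2.isCocentral
  rw [isCocharacter_iff, innerMap, ← map_inv, Units.val_mul, Units.coe_map, Units.coe_map]
  simp only [map_mul]
  refine ⟨?_, ?_, ?_⟩
  · rw [counit_coactFunctional, counit_scalar, Units.mul_inv]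
  · rw [comul_coactFunctional, comul_scalar, scalarFunctional, coact_scalar, mul_assoc,
      ← mul_assoc (convMap _ (coactFunctional a _)), ← map_mul,
      ← map_mul (coactFunctional a), Units.inv_mul, map_one, map_one, one_mul]
  · refine Commute.mul_right ?_ ?_
    · rw [← coact_scalar]
      exact ((commute_scalar h1 _).symm).map (coactMap a _)
    · have e : convMap (Algebra.TensorProduct.includeRight (R := R) (A := TensorAlgebra R C))
          (scalarFunctional H ((v⁻¹ : (WithConv (C →ₗ[R] R))ˣ) : WithConv (C →ₗ[R] R))) =
          convMap (Algebra.ofId R (TensorAlgebra R C ⊗[R] H))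
            ((v⁻¹ : (WithConv (C →ₗ[R] R))ˣ) : WithConv (C →ₗ[R] R)) := by
        ext
        simp [convMap, scalarFunctional, Algebra.ofId_apply, Algebra.algebraMap_eq_smul_one,
          smul_tmul', Algebra.TensorProduct.one_def]
      rw [e]
      exact (commute_scalar h2 _).symm

theorem innerMap_central (a : HopfCoaction R C H) {v : (WithConv (C →ₗ[R] R))ˣ}
    (hv : v ∈ cocentreUnits R C) {φ : (WithConv (C →ₗ[R] H))ˣ} (hφ : φ ∈ cocharacterGroup a) :
    Commute (innerMap a v) φ := by
  refine Commute.mul_left (Units.ext (commute_coactFunctional hφ _)) (Commute.inv_left ?_)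
  exact Units.ext (commute_scalar hv.1.isCocentral _)

/-- The homomorphism sending a convolution invertible functional on the cocentre to the
corresponding inner cocharacter. -/
noncomputable def innerCocharacter (a : HopfCoaction R C H) :
    cocentreUnits R C →* cocharacterGroup a where
  toFun v := ⟨innerMap a v, innerMap_mem a v.2⟩
  map_one' := by ext1; simp [innerMap]
  map_mul' v w := by
    ext1
    have h : Commute (Units.map (scalarFunctional (R := R) (C := C) H) v.1)
        (Units.map (coactFunctional a) w.1) :=
      Units.ext (commute_scalar v.2.1.isCocentral _)
    have h' : Commute (Units.map (scalarFunctional (R := R) (C := C) H) v.1)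
        (Units.map (scalarFunctional (R := R) (C := C) H) w.1) :=
      Units.ext (commute_scalar v.2.1.isCocentral _)
    simp only [innerMap, Subgroup.coe_mul, map_mul, mul_inv_rev]
    rw [← (h'.inv_left.inv_right).eq, mul_assoc, mul_assoc,
      ← mul_assoc (Units.map (coactFunctional a) w.1), ← h.inv_left.eq, mul_assoc]

instance innerCocharacter_range_normal (a : HopfCoaction R C H) :
    (innerCocharacter a).range.Normal where
  conj_mem := by
    rintro _ ⟨v, rfl⟩ φ
    have h : innerCocharacter a v * φ = φ * innerCocharacter a v :=
      Subtype.ext (innerMap_central a v.2 φ.2).eq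
    rw [← h, mul_inv_cancel_right]
    exact ⟨v, rfl⟩

/-- The first homoschism group `S¹(H, C)`: cocharacters modulo inner cocharacters. -/
abbrev FirstHomoschism (a : HopfCoaction R C H) : Type u :=
  cocharacterGroup a ⧸ (innerCocharacter a).range

end Homoschism

/-! ### Cotensor products and Morita-Takeuchi bicomodules -/

section MoritaTakeuchi

variable {R C D : Type u} [CommRing R] [AddCommGroup C] [Module R C] [Coalgebra R C]
  [AddCommGroup D] [Module R D] [Coalgebra R D]

/-- The cotensor product `M □_C N`, as a submodule of `M ⊗ N`. -/
noncomputable def cotensor {M N : Type u} [AddCommGroup M] [Module R M] [AddCommGroup N]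
    [Module R N] (ρM : M →ₗ[R] M ⊗[R] C) (lN : N →ₗ[R] C ⊗[R] N) : Submodule R (M ⊗[R] N) :=
  LinearMap.eqLocus ((TensorProduct.assoc R M C N).toLinearMap ∘ₗ ρM.rTensor N) (lN.lTensor M)

set_option linter.unusedSectionVars false in
theorem lTensor_mem_cotensor {M Y Z : Type u} [AddCommGroup M] [Module R M] [AddCommGroup Y]
    [Module R Y] [AddCommGroup Z] [Module R Z] (ρM : M →ₗ[R] M ⊗[R] C) {lY : Y →ₗ[R] C ⊗[R] Y}
    {lZ : Z →ₗ[R] C ⊗[R] Z} {f : Y →ₗ[R] Z} (hf : IsLeftColinear lY lZ f) :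
    ∀ x ∈ cotensor ρM lY, f.lTensor M x ∈ cotensor ρM lZ := by
  intro x hx
  simp only [cotensor, LinearMap.mem_eqLocus, LinearMap.comp_apply] at hx ⊢
  have h1 : (TensorProduct.assoc R M C Z).toLinearMap ∘ₗ ρM.rTensor Z ∘ₗ f.lTensor M =
      (f.lTensor C).lTensor M ∘ₗ (TensorProduct.assoc R M C Y).toLinearMap ∘ₗ ρM.rTensor Y := by
    have e : ρM.rTensor Z ∘ₗ f.lTensor M = f.lTensor (M ⊗[R] C) ∘ₗ ρM.rTensor Y := by ext; simp
    have e' : (TensorProduct.assoc R M C Z).toLinearMap ∘ₗ f.lTensor (M ⊗[R] C) =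
        (f.lTensor C).lTensor M ∘ₗ (TensorProduct.assoc R M C Y).toLinearMap := by ext; simp
    rw [e, ← LinearMap.comp_assoc, e', LinearMap.comp_assoc]
  have h2 : lZ.lTensor M ∘ₗ f.lTensor M = (f.lTensor C).lTensor M ∘ₗ lY.lTensor M := by
    rw [← LinearMap.lTensor_comp, ← LinearMap.lTensor_comp, hf]
  have h1' := LinearMap.congr_fun h1 x
  have h2' := LinearMap.congr_fun h2 x
  simp only [LinearMap.comp_apply] at h1' h2'
  rw [h1', h2', hx]

/-- The map `M □_C f : M □_C Y → M □_C Z` induced by a morphism `f : Y → Z` of left comodules. -/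
noncomputable def cotensorMap {M Y Z : Type u} [AddCommGroup M] [Module R M] [AddCommGroup Y]
    [Module R Y] [AddCommGroup Z] [Module R Z] (ρM : M →ₗ[R] M ⊗[R] C) {lY : Y →ₗ[R] C ⊗[R] Y}
    {lZ : Z →ₗ[R] C ⊗[R] Z} (f : Y →ₗ[R] Z) (hf : IsLeftColinear lY lZ f) :
    cotensor ρM lY →ₗ[R] cotensor ρM lZ :=
  (f.lTensor M).restrict (lTensor_mem_cotensor ρM hf)

/-- `0 → X → Y → Z → 0` is exact. -/
structure IsShortExact {X Y Z : Type u} [AddCommGroup X] [Module R X] [AddCommGroup Y]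
    [Module R Y] [AddCommGroup Z] [Module R Z] (f : X →ₗ[R] Y) (g : Y →ₗ[R] Z) : Prop where
  injective : Function.Injective f
  exact : Function.Exact f g
  surjective : Function.Surjective g

section Bicomodule

variable {M : Type u} [AddCommGroup M] [Module R M]

/-- `(C, D)`-bicomodules: left `C`-comodules and right `D`-comodules with compatible coactions. -/
structure IsBicomodule (lM : M →ₗ[R] C ⊗[R] M) (ρM : M →ₗ[R] M ⊗[R] D) : Prop where
  left : IsLeftComodule lM
  right : IsRightComodule ρM
  comm : (TensorProduct.assoc R C M D).toLinearMap ∘ₗ lM.rTensor D ∘ₗ ρM = ρM.lTensor C ∘ₗ lM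

/-- `t : Y → X ⊗ M` is a morphism of right `D`-comodules `Y → X □_C M`. -/
structure IsCotensorMorphism {X Y : Type u} [AddCommGroup X] [Module R X] [AddCommGroup Y]
    [Module R Y] (lM : M →ₗ[R] C ⊗[R] M) (ρM : M →ₗ[R] M ⊗[R] D) (ρX : X →ₗ[R] X ⊗[R] C)
    (ρY : Y →ₗ[R] Y ⊗[R] D) (t : Y →ₗ[R] X ⊗[R] M) : Prop where
  mem_cotensor : ∀ y, t y ∈ cotensor ρX lM
  colinear : IsRightColinear ρY ((TensorProduct.assoc R X M D).symm.toLinearMap ∘ₗ ρM.lTensor X) t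

/-- `(E, ρE)` is `CoHom(M, Y)`, the value at the right `D`-comodule `Y` of the left adjoint of
`- □_C M` from right `C`-comodules to right `D`-comodules, with unit `θ : Y → E □_C M`. -/
structure IsCoHom {Y E : Type u} [AddCommGroup Y] [Module R Y] [AddCommGroup E] [Module R E]
    (lM : M →ₗ[R] C ⊗[R] M) (ρM : M →ₗ[R] M ⊗[R] D) (ρY : Y →ₗ[R] Y ⊗[R] D)
    (ρE : E →ₗ[R] E ⊗[R] C) (θ : Y →ₗ[R] E ⊗[R] M) : Prop where
  comodule : IsRightComodule ρE
  unit : IsCotensorMorphism lM ρM ρE ρY θ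
  universal : ∀ (X : Type u) [AddCommGroup X] [Module R X] (ρX : X →ₗ[R] X ⊗[R] C)
    (t : Y →ₗ[R] X ⊗[R] M), IsRightComodule ρX → IsCotensorMorphism lM ρM ρX ρY t →
    ∃! f : E →ₗ[R] X, IsRightColinear ρE ρX f ∧ f.rTensor M ∘ₗ θ = t

/-- `M` is quasi-finite: `- □_C M` from right `C`-comodules to right `D`-comodules has a left
adjoint. -/
def IsQuasiFinite (lM : M →ₗ[R] C ⊗[R] M) (ρM : M →ₗ[R] M ⊗[R] D) : Prop :=
  ∀ (Y : Type u) [AddCommGroup Y] [Module R Y] (ρY : Y →ₗ[R] Y ⊗[R] D), IsRightComodule ρY →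
    ∃ (E : Type u) (_ : AddCommGroup E) (_ : Module R E) (ρE : E →ₗ[R] E ⊗[R] C)
      (θ : Y →ₗ[R] E ⊗[R] M), IsCoHom lM ρM ρY ρE θ

/-- `M` is an injector: the functor `CoHom(M, -)` is exact. Here `Fᵢ` is the value of this functor
at `fᵢ`. -/
def IsInjector (lM : M →ₗ[R] C ⊗[R] M) (ρM : M →ₗ[R] M ⊗[R] D) : Prop :=
  ∀ (Y₁ Y₂ Y₃ E₁ E₂ E₃ : Type u) [AddCommGroup Y₁] [Module R Y₁] [AddCommGroup Y₂] [Module R Y₂]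
    [AddCommGroup Y₃] [Module R Y₃] [AddCommGroup E₁] [Module R E₁] [AddCommGroup E₂] [Module R E₂]
    [AddCommGroup E₃] [Module R E₃]
    (ρ₁ : Y₁ →ₗ[R] Y₁ ⊗[R] D) (ρ₂ : Y₂ →ₗ[R] Y₂ ⊗[R] D) (ρ₃ : Y₃ →ₗ[R] Y₃ ⊗[R] D)
    (σ₁ : E₁ →ₗ[R] E₁ ⊗[R] C) (σ₂ : E₂ →ₗ[R] E₂ ⊗[R] C) (σ₃ : E₃ →ₗ[R] E₃ ⊗[R] C)
    (θ₁ : Y₁ →ₗ[R] E₁ ⊗[R] M) (θ₂ : Y₂ →ₗ[R] E₂ ⊗[R] M) (θ₃ : Y₃ →ₗ[R] E₃ ⊗[R] M)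
    (f₁ : Y₁ →ₗ[R] Y₂) (f₂ : Y₂ →ₗ[R] Y₃) (F₁ : E₁ →ₗ[R] E₂) (F₂ : E₂ →ₗ[R] E₃),
    IsRightComodule ρ₁ → IsRightComodule ρ₂ → IsRightComodule ρ₃ →
    IsRightColinear ρ₁ ρ₂ f₁ → IsRightColinear ρ₂ ρ₃ f₂ → IsShortExact f₁ f₂ →
    IsCoHom lM ρM ρ₁ σ₁ θ₁ → IsCoHom lM ρM ρ₂ σ₂ θ₂ → IsCoHom lM ρM ρ₃ σ₃ θ₃ →
    IsRightColinear σ₁ σ₂ F₁ → F₁.rTensor M ∘ₗ θ₁ = θ₂ ∘ₗ f₁ →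
    IsRightColinear σ₂ σ₃ F₂ → F₂.rTensor M ∘ₗ θ₂ = θ₃ ∘ₗ f₂ →
    IsShortExact F₁ F₂

/-- The right `D`-comodule `M` is faithfully coflat: `M □_D -` from left `D`-comodules to
`R`-modules is exact and faithful. -/
structure IsFaithfullyCoflat (ρM : M →ₗ[R] M ⊗[R] D) : Prop where
  exact : ∀ (Y₁ Y₂ Y₃ : Type u) [AddCommGroup Y₁] [Module R Y₁] [AddCommGroup Y₂] [Module R Y₂]
    [AddCommGroup Y₃] [Module R Y₃] (l₁ : Y₁ →ₗ[R] D ⊗[R] Y₁) (l₂ : Y₂ →ₗ[R] D ⊗[R] Y₂)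
    (l₃ : Y₃ →ₗ[R] D ⊗[R] Y₃) (f₁ : Y₁ →ₗ[R] Y₂) (f₂ : Y₂ →ₗ[R] Y₃)
    (h₁ : IsLeftColinear l₁ l₂ f₁) (h₂ : IsLeftColinear l₂ l₃ f₂),
    IsLeftComodule l₁ → IsLeftComodule l₂ → IsLeftComodule l₃ → IsShortExact f₁ f₂ →
    IsShortExact (cotensorMap ρM f₁ h₁) (cotensorMap ρM f₂ h₂)
  faithful : ∀ (Y Z : Type u) [AddCommGroup Y] [Module R Y] [AddCommGroup Z] [Module R Z]
    (lY : Y →ₗ[R] D ⊗[R] Y) (lZ : Z →ₗ[R] D ⊗[R] Z) (f g : Y →ₗ[R] Z)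
    (hf : IsLeftColinear lY lZ f) (hg : IsLeftColinear lY lZ g),
    IsLeftComodule lY → IsLeftComodule lZ → cotensorMap ρM f hf = cotensorMap ρM g hg → f = g

/-- Morita-Takeuchi `(C, D)`-bicomodules. The condition `coend` says that the canonical map
`CoEnd(M) = CoHom(M, M) → C` induced by the left coaction `M → C ⊗ M` is an isomorphism, i.e. that
`C` with this coaction has the universal property of `CoEnd(M)`; the coalgebra structure of
`CoEnd(M)` is the one determined by this property, so this is an isomorphism of coalgebras. -/
structure IsMoritaTakeuchi (lM : M →ₗ[R] C ⊗[R] M) (ρM : M →ₗ[R] M ⊗[R] D) : Prop where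
  bicomodule : IsBicomodule lM ρM
  quasiFinite : IsQuasiFinite lM ρM
  injector : IsInjector lM ρM
  faithfullyCoflat : IsFaithfullyCoflat ρM
  coend : IsCoHom lM ρM ρM (comul : C →ₗ[R] C ⊗[R] C) lM

end Bicomodule

/-- The coalgebras `C` and `D` are Morita-Takeuchi equivalent: there is a Morita-Takeuchi
`(C, D)`-bicomodule. -/
def MoritaTakeuchiEquivalent (R C D : Type u) [CommRing R] [AddCommGroup C] [Module R C]
    [Coalgebra R C] [AddCommGroup D] [Module R D] [Coalgebra R D] : Prop :=
  ∃ (M : Type u) (_ : AddCommGroup M) (_ : Module R M) (lM : M →ₗ[R] C ⊗[R] M)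
    (ρM : M →ₗ[R] M ⊗[R] D), IsMoritaTakeuchi lM ρM

end MoritaTakeuchi

/-! ### The equivariant notions -/

section Equivariant

variable {R C D H : Type u} [CommRing R] [AddCommGroup C] [Module R C] [Coalgebra R C]
  [AddCommGroup D] [Module R D] [Coalgebra R D] [Ring H] [HopfAlgebra R H]

/-- `H`-equivariant right `C`-comodules. -/
structure IsEquivariantRight {X : Type u} [AddCommGroup X] [Module R X] (a : HopfCoaction R C H)
    (ρX : X →ₗ[R] X ⊗[R] C) (δX : X →ₗ[R] X ⊗[R] H) : Prop where
  comodule : IsRightComodule ρX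
  coaction : IsRightComodule δX
  compatible : IsRightColinear δX (codiag δX a.δ) ρX

/-- `H`-equivariant left `C`-comodules. -/
structure IsEquivariantLeft {X : Type u} [AddCommGroup X] [Module R X] (a : HopfCoaction R C H)
    (lX : X →ₗ[R] C ⊗[R] X) (δX : X →ₗ[R] X ⊗[R] H) : Prop where
  comodule : IsLeftComodule lX
  coaction : IsRightComodule δX
  compatible : IsRightColinear δX (codiag a.δ δX) lX

variable {M : Type u} [AddCommGroup M] [Module R M]

/-- `H`-equivariant `(C, D)`-bicomodules. -/
structure IsEquivariantBicomodule (a : HopfCoaction R C H) (b : HopfCoaction R D H)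
    (lM : M →ₗ[R] C ⊗[R] M) (ρM : M →ₗ[R] M ⊗[R] D) (δM : M →ₗ[R] M ⊗[R] H) : Prop where
  bicomodule : IsBicomodule lM ρM
  left : IsEquivariantLeft a lM δM
  right : IsEquivariantRight b ρM δM

/-- `(E, ρE, δE)` is `CoHom_H(M, Y)`, the value at the equivariant right `D`-comodule `Y` of the
left adjoint of `- □_C M` from equivariant right `C`-comodules to equivariant right `D`-comodules
(`X □_C M` carries the codiagonal coaction of `H`), with unit `θ : Y → E □_C M`. -/
structure IsEquivariantCoHom {Y E : Type u} [AddCommGroup Y] [Module R Y] [AddCommGroup E]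
    [Module R E] (a : HopfCoaction R C H) (lM : M →ₗ[R] C ⊗[R] M) (ρM : M →ₗ[R] M ⊗[R] D)
    (δM : M →ₗ[R] M ⊗[R] H) (ρY : Y →ₗ[R] Y ⊗[R] D) (δY : Y →ₗ[R] Y ⊗[R] H)
    (ρE : E →ₗ[R] E ⊗[R] C) (δE : E →ₗ[R] E ⊗[R] H) (θ : Y →ₗ[R] E ⊗[R] M) : Prop where
  comodule : IsEquivariantRight a ρE δE
  unit : IsCotensorMorphism lM ρM ρE ρY θ
  unit_equivariant : IsRightColinear δY (codiag δE δM) θ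
  universal : ∀ (X : Type u) [AddCommGroup X] [Module R X] (ρX : X →ₗ[R] X ⊗[R] C)
    (δX : X →ₗ[R] X ⊗[R] H) (t : Y →ₗ[R] X ⊗[R] M), IsEquivariantRight a ρX δX →
    IsCotensorMorphism lM ρM ρX ρY t → IsRightColinear δY (codiag δX δM) t →
    ∃! f : E →ₗ[R] X, (IsRightColinear ρE ρX f ∧ IsRightColinear δE δX f) ∧ f.rTensor M ∘ₗ θ = t

/-- `M` is quasi-finite in the equivariant sense. -/
def IsEquivariantQuasiFinite (a : HopfCoaction R C H) (b : HopfCoaction R D H)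
    (lM : M →ₗ[R] C ⊗[R] M) (ρM : M →ₗ[R] M ⊗[R] D) (δM : M →ₗ[R] M ⊗[R] H) : Prop :=
  ∀ (Y : Type u) [AddCommGroup Y] [Module R Y] (ρY : Y →ₗ[R] Y ⊗[R] D) (δY : Y →ₗ[R] Y ⊗[R] H),
    IsEquivariantRight b ρY δY →
    ∃ (E : Type u) (_ : AddCommGroup E) (_ : Module R E) (ρE : E →ₗ[R] E ⊗[R] C)
      (δE : E →ₗ[R] E ⊗[R] H) (θ : Y →ₗ[R] E ⊗[R] M),
      IsEquivariantCoHom a lM ρM δM ρY δY ρE δE θ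

/-- `M` is an injector in the equivariant sense: `CoHom_H(M, -)` is exact. -/
def IsEquivariantInjector (a : HopfCoaction R C H) (b : HopfCoaction R D H)
    (lM : M →ₗ[R] C ⊗[R] M) (ρM : M →ₗ[R] M ⊗[R] D) (δM : M →ₗ[R] M ⊗[R] H) : Prop :=
  ∀ (Y₁ Y₂ Y₃ E₁ E₂ E₃ : Type u) [AddCommGroup Y₁] [Module R Y₁] [AddCommGroup Y₂] [Module R Y₂]
    [AddCommGroup Y₃] [Module R Y₃] [AddCommGroup E₁] [Module R E₁] [AddCommGroup E₂] [Module R E₂]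
    [AddCommGroup E₃] [Module R E₃]
    (ρ₁ : Y₁ →ₗ[R] Y₁ ⊗[R] D) (ρ₂ : Y₂ →ₗ[R] Y₂ ⊗[R] D) (ρ₃ : Y₃ →ₗ[R] Y₃ ⊗[R] D)
    (δ₁ : Y₁ →ₗ[R] Y₁ ⊗[R] H) (δ₂ : Y₂ →ₗ[R] Y₂ ⊗[R] H) (δ₃ : Y₃ →ₗ[R] Y₃ ⊗[R] H)
    (σ₁ : E₁ →ₗ[R] E₁ ⊗[R] C) (σ₂ : E₂ →ₗ[R] E₂ ⊗[R] C) (σ₃ : E₃ →ₗ[R] E₃ ⊗[R] C)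
    (η₁ : E₁ →ₗ[R] E₁ ⊗[R] H) (η₂ : E₂ →ₗ[R] E₂ ⊗[R] H) (η₃ : E₃ →ₗ[R] E₃ ⊗[R] H)
    (θ₁ : Y₁ →ₗ[R] E₁ ⊗[R] M) (θ₂ : Y₂ →ₗ[R] E₂ ⊗[R] M) (θ₃ : Y₃ →ₗ[R] E₃ ⊗[R] M)
    (f₁ : Y₁ →ₗ[R] Y₂) (f₂ : Y₂ →ₗ[R] Y₃) (F₁ : E₁ →ₗ[R] E₂) (F₂ : E₂ →ₗ[R] E₃),
    IsEquivariantRight b ρ₁ δ₁ → IsEquivariantRight b ρ₂ δ₂ → IsEquivariantRight b ρ₃ δ₃ →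
    IsRightColinear ρ₁ ρ₂ f₁ → IsRightColinear δ₁ δ₂ f₁ →
    IsRightColinear ρ₂ ρ₃ f₂ → IsRightColinear δ₂ δ₃ f₂ → IsShortExact f₁ f₂ →
    IsEquivariantCoHom a lM ρM δM ρ₁ δ₁ σ₁ η₁ θ₁ →
    IsEquivariantCoHom a lM ρM δM ρ₂ δ₂ σ₂ η₂ θ₂ →
    IsEquivariantCoHom a lM ρM δM ρ₃ δ₃ σ₃ η₃ θ₃ →
    IsRightColinear σ₁ σ₂ F₁ → IsRightColinear η₁ η₂ F₁ → F₁.rTensor M ∘ₗ θ₁ = θ₂ ∘ₗ f₁ →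
    IsRightColinear σ₂ σ₃ F₂ → IsRightColinear η₂ η₃ F₂ → F₂.rTensor M ∘ₗ θ₂ = θ₃ ∘ₗ f₂ →
    IsShortExact F₁ F₂

/-- `M` is faithfully coflat in the equivariant sense: `M □_D -` is exact and faithful on
equivariant left `D`-comodules. -/
structure IsEquivariantFaithfullyCoflat (b : HopfCoaction R D H) (ρM : M →ₗ[R] M ⊗[R] D) :
    Prop where
  exact : ∀ (Y₁ Y₂ Y₃ : Type u) [AddCommGroup Y₁] [Module R Y₁] [AddCommGroup Y₂] [Module R Y₂]
    [AddCommGroup Y₃] [Module R Y₃] (l₁ : Y₁ →ₗ[R] D ⊗[R] Y₁) (l₂ : Y₂ →ₗ[R] D ⊗[R] Y₂)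
    (l₃ : Y₃ →ₗ[R] D ⊗[R] Y₃) (δ₁ : Y₁ →ₗ[R] Y₁ ⊗[R] H) (δ₂ : Y₂ →ₗ[R] Y₂ ⊗[R] H)
    (δ₃ : Y₃ →ₗ[R] Y₃ ⊗[R] H) (f₁ : Y₁ →ₗ[R] Y₂) (f₂ : Y₂ →ₗ[R] Y₃)
    (h₁ : IsLeftColinear l₁ l₂ f₁) (h₂ : IsLeftColinear l₂ l₃ f₂),
    IsRightColinear δ₁ δ₂ f₁ → IsRightColinear δ₂ δ₃ f₂ →
    IsEquivariantLeft b l₁ δ₁ → IsEquivariantLeft b l₂ δ₂ → IsEquivariantLeft b l₃ δ₃ →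
    IsShortExact f₁ f₂ → IsShortExact (cotensorMap ρM f₁ h₁) (cotensorMap ρM f₂ h₂)
  faithful : ∀ (Y Z : Type u) [AddCommGroup Y] [Module R Y] [AddCommGroup Z] [Module R Z]
    (lY : Y →ₗ[R] D ⊗[R] Y) (lZ : Z →ₗ[R] D ⊗[R] Z) (δY : Y →ₗ[R] Y ⊗[R] H)
    (δZ : Z →ₗ[R] Z ⊗[R] H) (f g : Y →ₗ[R] Z)
    (hf : IsLeftColinear lY lZ f) (hg : IsLeftColinear lY lZ g),
    IsRightColinear δY δZ f → IsRightColinear δY δZ g →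
    IsEquivariantLeft b lY δY → IsEquivariantLeft b lZ δZ →
    cotensorMap ρM f hf = cotensorMap ρM g hg → f = g

/-- `H`-equivariant Morita-Takeuchi `(C, D)`-bicomodules: equivariant bicomodules, Morita-Takeuchi
as bicomodules, which satisfy the Morita-Takeuchi conditions in the equivariant category. -/
structure IsEquivariantMoritaTakeuchi (a : HopfCoaction R C H) (b : HopfCoaction R D H)
    (lM : M →ₗ[R] C ⊗[R] M) (ρM : M →ₗ[R] M ⊗[R] D) (δM : M →ₗ[R] M ⊗[R] H) : Prop where
  equivariant : IsEquivariantBicomodule a b lM ρM δM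
  underlying : IsMoritaTakeuchi lM ρM
  quasiFinite : IsEquivariantQuasiFinite a b lM ρM δM
  injector : IsEquivariantInjector a b lM ρM δM
  faithfullyCoflat : IsEquivariantFaithfullyCoflat b ρM
  coend : IsEquivariantCoHom a lM ρM δM ρM δM (comul : C →ₗ[R] C ⊗[R] C) a.δ lM

/-- Bundled `H`-equivariant Morita-Takeuchi `(C, D)`-bicomodules. -/
structure EquivariantMTBicomodule (a : HopfCoaction R C H) (b : HopfCoaction R D H) :
    Type (u + 1) where
  carrier : Type u
  [addCommGroup : AddCommGroup carrier]
  [module : Module R carrier]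
  l : carrier →ₗ[R] C ⊗[R] carrier
  ρ : carrier →ₗ[R] carrier ⊗[R] D
  δ : carrier →ₗ[R] carrier ⊗[R] H
  isEquivariantMoritaTakeuchi : IsEquivariantMoritaTakeuchi a b l ρ δ

attribute [instance] EquivariantMTBicomodule.addCommGroup EquivariantMTBicomodule.module

/-- Isomorphism of equivariant bicomodules. -/
def EquivariantMTBicomodule.Iso {a : HopfCoaction R C H} {b : HopfCoaction R D H}
    (M N : EquivariantMTBicomodule a b) : Prop :=
  ∃ e : M.carrier ≃ₗ[R] N.carrier, IsLeftColinear M.l N.l e.toLinearMap ∧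
    IsRightColinear M.ρ N.ρ e.toLinearMap ∧ IsRightColinear M.δ N.δ e.toLinearMap

theorem IsRightColinear.symm {A X Y : Type u} [AddCommGroup A] [Module R A] [AddCommGroup X]
    [Module R X] [AddCommGroup Y] [Module R Y] {ρX : X →ₗ[R] X ⊗[R] A} {ρY : Y →ₗ[R] Y ⊗[R] A}
    {e : X ≃ₗ[R] Y} (h : IsRightColinear ρX ρY e.toLinearMap) :
    IsRightColinear ρY ρX e.symm.toLinearMap := by
  have h1 : e.symm.toLinearMap.rTensor A ∘ₗ e.toLinearMap.rTensor A = LinearMap.id := by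
    rw [← LinearMap.rTensor_comp, LinearEquiv.symm_comp, LinearMap.rTensor_id]
  calc ρX ∘ₗ e.symm.toLinearMap
      = (e.symm.toLinearMap.rTensor A ∘ₗ e.toLinearMap.rTensor A) ∘ₗ ρX ∘ₗ e.symm.toLinearMap := by
        rw [h1, LinearMap.id_comp]
    _ = e.symm.toLinearMap.rTensor A ∘ₗ (e.toLinearMap.rTensor A ∘ₗ ρX) ∘ₗ e.symm.toLinearMap := by
        simp only [LinearMap.comp_assoc]
    _ = e.symm.toLinearMap.rTensor A ∘ₗ ρY := by
        rw [← show ρY ∘ₗ e.toLinearMap = e.toLinearMap.rTensor A ∘ₗ ρX from h,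
          LinearMap.comp_assoc, LinearEquiv.comp_symm, LinearMap.comp_id]

theorem IsLeftColinear.symm {A X Y : Type u} [AddCommGroup A] [Module R A] [AddCommGroup X]
    [Module R X] [AddCommGroup Y] [Module R Y] {lX : X →ₗ[R] A ⊗[R] X} {lY : Y →ₗ[R] A ⊗[R] Y}
    {e : X ≃ₗ[R] Y} (h : IsLeftColinear lX lY e.toLinearMap) :
    IsLeftColinear lY lX e.symm.toLinearMap := by
  have h1 : e.symm.toLinearMap.lTensor A ∘ₗ e.toLinearMap.lTensor A = LinearMap.id := by
    rw [← LinearMap.lTensor_comp, LinearEquiv.symm_comp, LinearMap.lTensor_id]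
  calc lX ∘ₗ e.symm.toLinearMap
      = (e.symm.toLinearMap.lTensor A ∘ₗ e.toLinearMap.lTensor A) ∘ₗ lX ∘ₗ e.symm.toLinearMap := by
        rw [h1, LinearMap.id_comp]
    _ = e.symm.toLinearMap.lTensor A ∘ₗ (e.toLinearMap.lTensor A ∘ₗ lX) ∘ₗ e.symm.toLinearMap := by
        simp only [LinearMap.comp_assoc]
    _ = e.symm.toLinearMap.lTensor A ∘ₗ lY := by
        rw [← show lY ∘ₗ e.toLinearMap = e.toLinearMap.lTensor A ∘ₗ lX from h,
          LinearMap.comp_assoc, LinearEquiv.comp_symm, LinearMap.comp_id]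

theorem IsRightColinear.trans {A X Y Z : Type u} [AddCommGroup A] [Module R A] [AddCommGroup X]
    [Module R X] [AddCommGroup Y] [Module R Y] [AddCommGroup Z] [Module R Z]
    {ρX : X →ₗ[R] X ⊗[R] A} {ρY : Y →ₗ[R] Y ⊗[R] A} {ρZ : Z →ₗ[R] Z ⊗[R] A}
    {f : X →ₗ[R] Y} {g : Y →ₗ[R] Z} (hf : IsRightColinear ρX ρY f) (hg : IsRightColinear ρY ρZ g) :
    IsRightColinear ρX ρZ (g ∘ₗ f) := by
  unfold IsRightColinear at *
  rw [← LinearMap.comp_assoc, hg, LinearMap.comp_assoc, hf, LinearMap.rTensor_comp,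
    LinearMap.comp_assoc]

theorem IsLeftColinear.trans {A X Y Z : Type u} [AddCommGroup A] [Module R A] [AddCommGroup X]
    [Module R X] [AddCommGroup Y] [Module R Y] [AddCommGroup Z] [Module R Z]
    {lX : X →ₗ[R] A ⊗[R] X} {lY : Y →ₗ[R] A ⊗[R] Y} {lZ : Z →ₗ[R] A ⊗[R] Z}
    {f : X →ₗ[R] Y} {g : Y →ₗ[R] Z} (hf : IsLeftColinear lX lY f) (hg : IsLeftColinear lY lZ g) :
    IsLeftColinear lX lZ (g ∘ₗ f) := by
  unfold IsLeftColinear at *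
  rw [← LinearMap.comp_assoc, hg, LinearMap.comp_assoc, hf, LinearMap.lTensor_comp,
    LinearMap.comp_assoc]

/-- Isomorphism of equivariant Morita-Takeuchi bicomodules as an equivalence relation. -/
def EquivariantMTBicomodule.setoid (a : HopfCoaction R C H) (b : HopfCoaction R D H) :
    Setoid (EquivariantMTBicomodule a b) where
  r := EquivariantMTBicomodule.Iso
  iseqv :=
    { refl := fun M => ⟨LinearEquiv.refl R M.carrier, by
        simp [IsLeftColinear, IsRightColinear, LinearMap.lTensor_id, LinearMap.rTensor_id]⟩
      symm := fun ⟨e, h1, h2, h3⟩ => ⟨e.symm, h1.symm, h2.symm, h3.symm⟩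
      trans := fun ⟨e, h1, h2, h3⟩ ⟨e', k1, k2, k3⟩ =>
        ⟨e.trans e', h1.trans k1, h2.trans k2, h3.trans k3⟩ }

/-- The equivariant Picard set `Pic_H(C, D)` of isomorphism classes of `H`-equivariant
Morita-Takeuchi `(C, D)`-bicomodules. -/
def PicH (a : HopfCoaction R C H) (b : HopfCoaction R D H) : Type (u + 1) :=
  Quotient (EquivariantMTBicomodule.setoid a b)

end Equivariant

end MoritaTakeuchi

/-!
An `H`-equivariant Morita-Takeuchi `(C, D)`-bicomodule `M` yields an isomorphism between the first
homoschism groups of `C` and `D`; if there is none, then `Pic_H(C, D)` is empty.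

Linear maps `φ : C → A` act on linear maps `t` out of `M` by `(φ · t)(m) = φ(m₍₋₁₎) t(m₍₀₎)`, and maps
`ψ : D → A` act by `(t · ψ)(m) = t(m₍₀₎) ψ(m₍₁₎)`; these are actions of the convolution algebras, and
they commute. Write `d` for the coaction `m ↦ m⁽⁰⁾ ⊗ m⁽¹⁾` of `H` on `M`. The maps `φ : C → H` and
`ψ : D → H` are *intertwined* if `φ · d = d · ψ`. This relation is multiplicative, and equivariance of
`M` together with the antipode shows that it is single-valued in both directions and that it carries
the conditions defining a cocharacter from one side to the other
(`Intertwines.isCocharacter_right`, `Intertwines.isCocharacter_left`).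

Existence of a partner rests on two duality statements. Right `D`-colinear maps `M → V ⊗ M` are given
by linear maps `C → V` (`IsMoritaTakeuchi.existsUnique_rTensor_comp`), which is the universal property
of `CoEnd(M) = C` for cofree comodules. Left `C`-colinear maps `M → M ⊗ V` are given by linear maps
`D → V` if `V` is flat (`IsMoritaTakeuchi.exists_lTensor_comp`); for this, the bicomodule
`N = CoHom(M, D)` is shown to be an inverse of `M`, with `M □_D N = C` because `CoHom(M, -)` is exact
and `N □_C M = D` because `M □_D -` is exact and faithful. Applied to `V = H`, after stripping off the
coaction `d` with the antipode, these statements give partners of all cocharacters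
(`exists_intertwines_left`, `exists_intertwines_right`), and intertwining becomes an isomorphism of
cocharacter groups.

To compare inner cocharacters, the same duality is applied to a cocentral morphism `p : C → E`, where
`E` may be taken flat after dividing out torsion, `R` being a principal ideal domain. The map
`m ↦ m₍₀₎ ⊗ p(m₍₋₁₎)` is left colinear, so it is `m ↦ m₍₀₎ ⊗ q(m₍₁₎)` for some `q : D → E`, and by
uniqueness `q` is again a cocentral coalgebra morphism. In this way functionals on the cocentres of `C`
and `D` correspond to each other (`exists_corresponds_right`, `exists_corresponds_left`), and the inner
cocharacters of corresponding functionals are intertwined.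
-/

namespace MoritaTakeuchi

/-! ### Inflated comodules and cotensor products -/

section Inflation

variable {R C D V X Y Z E M : Type u} [CommRing R] [AddCommGroup C] [Module R C]
  [AddCommGroup D] [Module R D] [AddCommGroup V] [Module R V]
  [AddCommGroup X] [Module R X] [AddCommGroup Y] [Module R Y] [AddCommGroup Z] [Module R Z]
  [AddCommGroup E] [Module R E] [AddCommGroup M] [Module R M]

/-- The right coaction `V ⊗ ρ` on `V ⊗ X`, for a right coaction `ρ` on `X`. -/
noncomputable def inflateRight (V : Type u) [AddCommGroup V] [Module R V] (ρ : X →ₗ[R] X ⊗[R] C) :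
    V ⊗[R] X →ₗ[R] (V ⊗[R] X) ⊗[R] C :=
  (TensorProduct.assoc R V X C).symm.toLinearMap ∘ₗ ρ.lTensor V

/-- The left coaction `l ⊗ V` on `X ⊗ V`, for a left coaction `l` on `X`. -/
noncomputable def inflateLeft (V : Type u) [AddCommGroup V] [Module R V] (l : X →ₗ[R] C ⊗[R] X) :
    X ⊗[R] V →ₗ[R] C ⊗[R] (X ⊗[R] V) :=
  (TensorProduct.assoc R C X V).toLinearMap ∘ₗ l.rTensor V

theorem IsRightComodule.inflate [Coalgebra R C] {ρ : X →ₗ[R] X ⊗[R] C} (h : IsRightComodule ρ) :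
    IsRightComodule (inflateRight V ρ) := by
  constructor
  · apply TensorProduct.ext'
    intro v x
    have e := LinearMap.congr_fun h.coassoc x
    simp only [LinearMap.comp_apply, LinearEquiv.coe_coe, inflateRight, LinearMap.lTensor_tmul]
      at e ⊢
    have e1 : ∀ z : X ⊗[R] C, (TensorProduct.assoc R (V ⊗[R] X) C C)
        (((TensorProduct.assoc R V X C).symm.toLinearMap ∘ₗ ρ.lTensor V).rTensor C
          ((TensorProduct.assoc R V X C).symm (v ⊗ₜ z))) =
        (TensorProduct.assoc R V X (C ⊗[R] C)).symm
          (v ⊗ₜ (TensorProduct.assoc R X C C (ρ.rTensor C z))) := by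
      intro z
      induction z with
      | zero => simp
      | add a b ha hb => simp only [tmul_add, map_add, ha, hb]
      | tmul x c =>
        simp only [TensorProduct.assoc_symm_tmul, LinearMap.rTensor_tmul, LinearMap.comp_apply,
          LinearMap.lTensor_tmul, LinearEquiv.coe_coe]
        generalize ρ x = y
        induction y with
        | zero => simp
        | add a b ha hb => simp only [tmul_add, add_tmul, map_add, ha, hb]
        | tmul x' c' => simp
    have e2 : ∀ z : X ⊗[R] C, comul.lTensor (V ⊗[R] X) ((TensorProduct.assoc R V X C).symm (v ⊗ₜ z))
        = (TensorProduct.assoc R V X (C ⊗[R] C)).symm (v ⊗ₜ (comul.lTensor X z)) := by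
      intro z
      induction z with
      | zero => simp
      | add a b ha hb => simp only [tmul_add, map_add, ha, hb]
      | tmul x c => simp
    rw [e1, e2, e]
  · apply TensorProduct.ext'
    intro v x
    have e := LinearMap.congr_fun h.counit x
    simp only [LinearMap.comp_apply, LinearEquiv.coe_coe, inflateRight, LinearMap.lTensor_tmul]
      at e ⊢
    have e2 : ∀ z : X ⊗[R] C, (Coalgebra.counit : C →ₗ[R] R).lTensor (V ⊗[R] X)
        ((TensorProduct.assoc R V X C).symm (v ⊗ₜ z)) =
        (TensorProduct.assoc R V X R).symm
          (v ⊗ₜ ((Coalgebra.counit : C →ₗ[R] R).lTensor X z)) := by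
      intro z
      induction z with
      | zero => simp
      | add a b ha hb => simp only [tmul_add, map_add, ha, hb]
      | tmul x c => simp
    rw [e2, e]
    simp

theorem IsLeftComodule.inflate [Coalgebra R C] {l : X →ₗ[R] C ⊗[R] X} (h : IsLeftComodule l) :
    IsLeftComodule (inflateLeft V l) := by
  constructor
  · apply TensorProduct.ext'
    intro x v
    have e := LinearMap.congr_fun h.coassoc x
    simp only [LinearMap.comp_apply, LinearEquiv.coe_coe, inflateLeft, LinearMap.rTensor_tmul]
      at e ⊢
    have e1 : ∀ z : C ⊗[R] X, ((TensorProduct.assoc R C X V).toLinearMap ∘ₗ l.rTensor V).lTensor C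
          (TensorProduct.assoc R C X V (z ⊗ₜ v)) =
        (TensorProduct.assoc R C X V).toLinearMap.lTensor C
          (TensorProduct.assoc R C (C ⊗[R] X) V ((l.lTensor C z) ⊗ₜ v)) := by
      intro z
      induction z with
      | zero => simp
      | add a b ha hb => simp only [add_tmul, map_add, ha, hb]
      | tmul x c => simp
    have e2 : ∀ z : C ⊗[R] X, (TensorProduct.assoc R C C (X ⊗[R] V))
        (comul.rTensor (X ⊗[R] V) (TensorProduct.assoc R C X V (z ⊗ₜ v)))
        = (TensorProduct.assoc R C X V).toLinearMap.lTensor C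
          (TensorProduct.assoc R C (C ⊗[R] X) V
            ((TensorProduct.assoc R C C X (comul.rTensor X z)) ⊗ₜ v)) := by
      intro z
      induction z with
      | zero => simp
      | add a b ha hb => simp only [add_tmul, map_add, ha, hb]
      | tmul c x =>
        simp only [TensorProduct.assoc_tmul, LinearMap.rTensor_tmul]
        generalize comul (R := R) c = y
        induction y with
        | zero => simp
        | add a b ha hb => simp only [add_tmul, map_add, ha, hb]
        | tmul x' c' => simp
    rw [e1, e2, e]
  · apply TensorProduct.ext'
    intro x v
    have e := LinearMap.congr_fun h.counit x
    simp only [LinearMap.comp_apply, LinearEquiv.coe_coe, inflateLeft, LinearMap.rTensor_tmul]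
      at e ⊢
    have e2 : ∀ z : C ⊗[R] X, (Coalgebra.counit : C →ₗ[R] R).rTensor (X ⊗[R] V)
        (TensorProduct.assoc R C X V (z ⊗ₜ v)) =
        TensorProduct.assoc R R X V
          (((Coalgebra.counit : C →ₗ[R] R).rTensor X z) ⊗ₜ v) := by
      intro z
      induction z with
      | zero => simp
      | add a b ha hb => simp only [add_tmul, map_add, ha, hb]
      | tmul x c => simp
    rw [e2, e]
    simp

theorem isRightComodule_comul [Coalgebra R C] : IsRightComodule (comul : C →ₗ[R] C ⊗[R] C) :=
  ⟨Coalgebra.coassoc, Coalgebra.lTensor_counit_comp_comul⟩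

theorem isLeftComodule_comul [Coalgebra R C] : IsLeftComodule (comul : C →ₗ[R] C ⊗[R] C) :=
  ⟨Coalgebra.coassoc, Coalgebra.rTensor_counit_comp_comul⟩

theorem IsRightColinear.inflate {ρX : X →ₗ[R] X ⊗[R] C} {ρY : Y →ₗ[R] Y ⊗[R] C} {f : X →ₗ[R] Y}
    (h : IsRightColinear ρX ρY f) :
    IsRightColinear (inflateRight V ρX) (inflateRight V ρY) (f.lTensor V) := by
  have e : (TensorProduct.assoc R V Y C).symm.toLinearMap ∘ₗ (f.rTensor C).lTensor V =
      (f.lTensor V).rTensor C ∘ₗ (TensorProduct.assoc R V X C).symm.toLinearMap := by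
    ext; simp
  unfold IsRightColinear inflateRight at *
  rw [LinearMap.comp_assoc, ← LinearMap.lTensor_comp, h, LinearMap.lTensor_comp,
    ← LinearMap.comp_assoc, e, LinearMap.comp_assoc]

theorem IsRightComodule.colinear [Coalgebra R C] {ρ : X →ₗ[R] X ⊗[R] C} (h : IsRightComodule ρ) :
    IsRightColinear ρ (inflateRight X comul) ρ := by
  unfold IsRightColinear inflateRight
  rw [LinearMap.comp_assoc, ← h.coassoc, ← LinearMap.comp_assoc]
  ext; simp

/-- Tensoring on the left by a linear map is a morphism of inflated comodules. -/
theorem isRightColinear_rTensor (ρ : X →ₗ[R] X ⊗[R] C) (f : Y →ₗ[R] Z) :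
    IsRightColinear (inflateRight Y ρ) (inflateRight Z ρ) (f.rTensor X) := by
  apply TensorProduct.ext'
  intro y x
  simp only [LinearMap.comp_apply, LinearEquiv.coe_coe, inflateRight, LinearMap.lTensor_tmul,
    LinearMap.rTensor_tmul]
  generalize ρ x = z
  induction z with
  | zero => simp
  | add a b ha hb => simp only [tmul_add, map_add, ha, hb]
  | tmul x c => simp

theorem isLeftColinear_lTensor (l : X →ₗ[R] C ⊗[R] X) (f : Y →ₗ[R] Z) :
    IsLeftColinear (inflateLeft Y l) (inflateLeft Z l) (f.lTensor X) := by
  apply TensorProduct.ext'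
  intro x y
  simp only [LinearMap.comp_apply, LinearEquiv.coe_coe, inflateLeft, LinearMap.lTensor_tmul,
    LinearMap.rTensor_tmul]
  generalize l x = z
  induction z with
  | zero => simp
  | add a b ha hb => simp only [add_tmul, map_add, ha, hb]
  | tmul x c => simp

theorem isRightColinear_mk (ρ : X →ₗ[R] X ⊗[R] C) (v : V) :
    IsRightColinear ρ (inflateRight V ρ) (TensorProduct.mk R V X v) := by
  ext x
  simp only [LinearMap.comp_apply, LinearEquiv.coe_coe, inflateRight, LinearMap.lTensor_tmul,
    TensorProduct.mk_apply]
  generalize ρ x = z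
  induction z with
  | zero => simp
  | add a b ha hb => simp only [tmul_add, map_add, ha, hb]
  | tmul x c => simp

end Inflation

section Cotensor

variable {R C D V X Y Z E M : Type u} [CommRing R] [AddCommGroup C] [Module R C]
  [AddCommGroup D] [Module R D] [AddCommGroup V] [Module R V]
  [AddCommGroup X] [Module R X] [AddCommGroup Y] [Module R Y] [AddCommGroup Z] [Module R Z]
  [AddCommGroup E] [Module R E] [AddCommGroup M] [Module R M]
  {lM : M →ₗ[R] C ⊗[R] M} {ρM : M →ₗ[R] M ⊗[R] D}

theorem mem_cotensor_iff {ρX : X →ₗ[R] X ⊗[R] C} {z : X ⊗[R] M} :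
    z ∈ cotensor ρX lM ↔ TensorProduct.assoc R X C M (ρX.rTensor M z) = lM.lTensor X z :=
  Iff.rfl

theorem IsCotensorMorphism.comp {ρX : X →ₗ[R] X ⊗[R] C} {ρZ : Z →ₗ[R] Z ⊗[R] C}
    {ρY : Y →ₗ[R] Y ⊗[R] D} {t : Y →ₗ[R] X ⊗[R] M} (ht : IsCotensorMorphism lM ρM ρX ρY t)
    {f : X →ₗ[R] Z} (hf : IsRightColinear ρX ρZ f) :
    IsCotensorMorphism lM ρM ρZ ρY (f.rTensor M ∘ₗ t) := by
  constructor
  · intro y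
    have h := ht.mem_cotensor y
    rw [mem_cotensor_iff] at h ⊢
    have e1 : ρZ.rTensor M ∘ₗ f.rTensor M = (f.rTensor C).rTensor M ∘ₗ ρX.rTensor M := by
      rw [← LinearMap.rTensor_comp, hf, LinearMap.rTensor_comp]
    have e2 : (TensorProduct.assoc R Z C M).toLinearMap ∘ₗ (f.rTensor C).rTensor M =
      f.rTensor (C ⊗[R] M) ∘ₗ (TensorProduct.assoc R X C M).toLinearMap := by ext; simp
    have e3 : lM.lTensor Z ∘ₗ f.rTensor M = f.rTensor (C ⊗[R] M) ∘ₗ lM.lTensor X := by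
      ext; simp
    have e1' := LinearMap.congr_fun e1 (t y)
    have e2' := LinearMap.congr_fun e2 (ρX.rTensor M (t y))
    have e3' := LinearMap.congr_fun e3 (t y)
    simp only [LinearMap.comp_apply, LinearEquiv.coe_coe] at e1' e2' e3' ⊢
    rw [e1', e2', e3', h]
  · exact ht.colinear.trans (isRightColinear_rTensor ρM f)

theorem IsCotensorMorphism.precomp {ρX : X →ₗ[R] X ⊗[R] C} {ρZ : Z →ₗ[R] Z ⊗[R] D}
    {ρY : Y →ₗ[R] Y ⊗[R] D} {t : Y →ₗ[R] X ⊗[R] M} (ht : IsCotensorMorphism lM ρM ρX ρY t)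
    {f : Z →ₗ[R] Y} (hf : IsRightColinear ρZ ρY f) :
    IsCotensorMorphism lM ρM ρX ρZ (t ∘ₗ f) :=
  ⟨fun z => ht.mem_cotensor (f z), hf.trans ht.colinear⟩

theorem IsCotensorMorphism.inflate {ρX : X →ₗ[R] X ⊗[R] C}
    {ρY : Y →ₗ[R] Y ⊗[R] D} {t : Y →ₗ[R] X ⊗[R] M} (ht : IsCotensorMorphism lM ρM ρX ρY t) :
    IsCotensorMorphism lM ρM (inflateRight V ρX) (inflateRight V ρY)
      ((TensorProduct.assoc R V X M).symm.toLinearMap ∘ₗ t.lTensor V) := by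
  constructor
  · intro y
    have e1 : (TensorProduct.assoc R (V ⊗[R] X) C M).toLinearMap ∘ₗ
        (inflateRight V ρX).rTensor M ∘ₗ (TensorProduct.assoc R V X M).symm.toLinearMap =
        (TensorProduct.assoc R V X (C ⊗[R] M)).symm.toLinearMap ∘ₗ
        ((TensorProduct.assoc R X C M).toLinearMap ∘ₗ ρX.rTensor M).lTensor V := by
      ext v x m
      simp only [inflateRight, AlgebraTensorModule.curry_apply, LinearMap.restrictScalars_self,
        curry_apply, LinearMap.comp_apply, LinearEquiv.coe_coe, TensorProduct.assoc_symm_tmul,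
        LinearMap.rTensor_tmul, LinearMap.lTensor_tmul]
      generalize ρX x = z
      induction z with
      | zero => simp
      | add a b ha hb => simp only [add_tmul, tmul_add, map_add, ha, hb]
      | tmul x c => simp
    have e2 : lM.lTensor (V ⊗[R] X) ∘ₗ (TensorProduct.assoc R V X M).symm.toLinearMap =
        (TensorProduct.assoc R V X (C ⊗[R] M)).symm.toLinearMap ∘ₗ (lM.lTensor X).lTensor V := by
      ext; simp
    have e3 : ((TensorProduct.assoc R X C M).toLinearMap ∘ₗ ρX.rTensor M) ∘ₗ t =
        lM.lTensor X ∘ₗ t := LinearMap.ext ht.mem_cotensor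
    have e1' := LinearMap.congr_fun e1 (t.lTensor V y)
    have e2' := LinearMap.congr_fun e2 (t.lTensor V y)
    rw [mem_cotensor_iff]
    refine Eq.trans e1' (Eq.trans ?_ e2'.symm)
    simp only [LinearMap.comp_apply, ← LinearMap.lTensor_comp_apply, e3]
  · have h := ht.colinear.inflate (V := V)
    refine h.trans ?_
    unfold IsRightColinear inflateRight
    ext v x m
    simp only [AlgebraTensorModule.curry_apply, LinearMap.restrictScalars_self,
        curry_apply, LinearMap.comp_apply, LinearEquiv.coe_coe, TensorProduct.assoc_symm_tmul,
        LinearMap.lTensor_tmul]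
    generalize ρM m = z
    induction z with
    | zero => simp
    | add a b ha hb => simp only [tmul_add, map_add, ha, hb]
    | tmul x c => simp

variable {ρY : Y →ₗ[R] Y ⊗[R] D} {ρE : E →ₗ[R] E ⊗[R] C} {θ : Y →ₗ[R] E ⊗[R] M}

theorem IsCoHom.hom_ext [Coalgebra R C] (h : IsCoHom lM ρM ρY ρE θ) {ρX : X →ₗ[R] X ⊗[R] C}
    (hX : IsRightComodule ρX) {f g : E →ₗ[R] X} (hf : IsRightColinear ρE ρX f)
    (hg : IsRightColinear ρE ρX g) (e : f.rTensor M ∘ₗ θ = g.rTensor M ∘ₗ θ) : f = g :=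
  (h.universal X ρX (g.rTensor M ∘ₗ θ) hX (h.unit.comp hg)).unique ⟨hf, e⟩ ⟨hg, rfl⟩

theorem IsRightColinear.add {ρX : X →ₗ[R] X ⊗[R] C} {ρY : Y →ₗ[R] Y ⊗[R] C} {f g : X →ₗ[R] Y}
    (hf : IsRightColinear ρX ρY f) (hg : IsRightColinear ρX ρY g) :
    IsRightColinear ρX ρY (f + g) := by
  unfold IsRightColinear at *
  rw [LinearMap.comp_add, hf, hg, LinearMap.rTensor_add, LinearMap.add_comp]

theorem IsRightColinear.sub {ρX : X →ₗ[R] X ⊗[R] C} {ρY : Y →ₗ[R] Y ⊗[R] C} {f g : X →ₗ[R] Y}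
    (hf : IsRightColinear ρX ρY f) (hg : IsRightColinear ρX ρY g) :
    IsRightColinear ρX ρY (f - g) := by
  unfold IsRightColinear at *
  rw [LinearMap.comp_sub, hf, hg, LinearMap.rTensor_sub, LinearMap.sub_comp]

theorem IsRightColinear.smul {ρX : X →ₗ[R] X ⊗[R] C} {ρY : Y →ₗ[R] Y ⊗[R] C} {f : X →ₗ[R] Y}
    (hf : IsRightColinear ρX ρY f) (r : R) :
    IsRightColinear ρX ρY (r • f) := by
  unfold IsRightColinear at *
  rw [LinearMap.comp_smul, hf, LinearMap.rTensor_smul, LinearMap.smul_comp]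

/-- `CoHom(M, V ⊗ Y) = V ⊗ CoHom(M, Y)` for every `R`-module `V`. -/
theorem IsCoHom.inflate [Coalgebra R C] (h : IsCoHom lM ρM ρY ρE θ) :
    IsCoHom lM ρM (inflateRight V ρY) (inflateRight V ρE)
      ((TensorProduct.assoc R V E M).symm.toLinearMap ∘ₗ θ.lTensor V) := by
  refine ⟨h.comodule.inflate, h.unit.inflate, ?_⟩
  intro X _ _ ρX t hX ht
  have hv : ∀ v : V, ∃ f : E →ₗ[R] X, IsRightColinear ρE ρX f ∧
      f.rTensor M ∘ₗ θ = t ∘ₗ TensorProduct.mk R V Y v := fun v =>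
    (h.universal X ρX _ hX (ht.precomp (isRightColinear_mk ρY v))).exists
  choose f hf hft using hv
  let F : V →ₗ[R] E →ₗ[R] X :=
    { toFun := f
      map_add' := fun v w => by
        refine h.hom_ext hX (hf _) ((hf v).add (hf w)) ?_
        rw [hft, LinearMap.rTensor_add, LinearMap.add_comp, hft, hft, map_add, LinearMap.comp_add]
      map_smul' := fun r v => by
        refine h.hom_ext hX (hf _) ((hf v).smul r) ?_
        rw [hft, LinearMap.rTensor_smul, LinearMap.smul_comp, hft, map_smul,
          LinearMap.comp_smul, RingHom.id_apply] }
  have hmk : ∀ g : V ⊗[R] E →ₗ[R] X, ∀ v, g.rTensor M ∘ₗ ((TensorProduct.assoc R V E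
      M).symm.toLinearMap ∘ₗ θ.lTensor V) ∘ₗ TensorProduct.mk R V Y v =
      (g ∘ₗ TensorProduct.mk R V E v).rTensor M ∘ₗ θ := by
    intro g v
    ext y
    simp only [LinearMap.comp_apply, TensorProduct.mk_apply, LinearMap.lTensor_tmul,
      LinearEquiv.coe_coe]
    generalize θ y = z
    induction z with
    | zero => simp
    | add a b ha hb => simp only [tmul_add, map_add, ha, hb]
    | tmul x c => simp
  have hlift : ∀ v, lift F ∘ₗ TensorProduct.mk R V E v = f v := fun v => by ext; simp [F]
  refine ⟨lift F, ⟨?_, ?_⟩, ?_⟩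
  · apply TensorProduct.ext'
    intro v x
    have e := LinearMap.congr_fun (hf v) x
    simp only [LinearMap.comp_apply, inflateRight, lift.tmul, LinearMap.lTensor_tmul,
      LinearEquiv.coe_coe] at e ⊢
    refine e.trans ?_
    generalize ρE x = z
    induction z with
    | zero => simp
    | add a b ha hb => simp only [tmul_add, map_add, ha, hb]
    | tmul x c => simp [F]
  · apply TensorProduct.ext'
    intro v x
    have := LinearMap.congr_fun (hmk (lift F) v) x
    rw [hlift, hft] at this
    exact this
  · rintro g ⟨hg, hgt⟩
    apply TensorProduct.ext'
    intro v x
    have : g ∘ₗ TensorProduct.mk R V E v = f v := by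
      refine h.hom_ext hX ((isRightColinear_mk ρE v).trans hg) (hf v) ?_
      rw [← hmk, hft, ← hgt]
      simp only [LinearMap.comp_assoc]
    simpa [F] using LinearMap.congr_fun this x

theorem IsLeftColinear.sub {lX : X →ₗ[R] C ⊗[R] X} {lY : Y →ₗ[R] C ⊗[R] Y} {f g : X →ₗ[R] Y}
    (hf : IsLeftColinear lX lY f) (hg : IsLeftColinear lX lY g) :
    IsLeftColinear lX lY (f - g) := by
  unfold IsLeftColinear at *
  rw [LinearMap.comp_sub, hf, hg, LinearMap.lTensor_sub, LinearMap.sub_comp]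

theorem IsLeftColinear.inflate {lX : X →ₗ[R] C ⊗[R] X} {lY : Y →ₗ[R] C ⊗[R] Y} {f : X →ₗ[R] Y}
    (h : IsLeftColinear lX lY f) :
    IsLeftColinear (inflateLeft V lX) (inflateLeft V lY) (f.rTensor V) := by
  have e : (TensorProduct.assoc R C Y V).toLinearMap ∘ₗ (f.lTensor C).rTensor V =
      (f.rTensor V).lTensor C ∘ₗ (TensorProduct.assoc R C X V).toLinearMap := by
    ext; simp
  unfold IsLeftColinear inflateLeft at *
  rw [LinearMap.comp_assoc, ← LinearMap.rTensor_comp, h, LinearMap.rTensor_comp,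
    ← LinearMap.comp_assoc, e, LinearMap.comp_assoc]

theorem isLeftColinear_assoc (l : X →ₗ[R] C ⊗[R] X) :
    IsLeftColinear (inflateLeft Y (inflateLeft V l)) (inflateLeft (V ⊗[R] Y) l)
      (TensorProduct.assoc R X V Y).toLinearMap := by
  unfold IsLeftColinear inflateLeft
  ext x v y
  simp only [AlgebraTensorModule.curry_apply, LinearMap.restrictScalars_self, curry_apply,
    LinearMap.comp_apply, LinearEquiv.coe_coe, TensorProduct.assoc_tmul, LinearMap.rTensor_tmul]
  generalize l x = z
  induction z with
  | zero => simp
  | add a b ha hb => simp only [add_tmul, map_add, ha, hb]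
  | tmul x c => simp

/-- For commuting coactions `l` and `ρ` on `X`, the map `l` is right colinear if and only if `ρ` is
left colinear. -/
theorem IsRightColinear.left {ρ : X →ₗ[R] X ⊗[R] C} {l : X →ₗ[R] D ⊗[R] X}
    (h : IsRightColinear ρ (inflateRight D ρ) l) : IsLeftColinear l (inflateLeft C l) ρ := by
  unfold IsLeftColinear IsRightColinear inflateLeft inflateRight at *
  rw [LinearMap.comp_assoc, ← h, LinearMap.comp_assoc, ← LinearMap.comp_assoc,
    LinearEquiv.comp_symm, LinearMap.id_comp]

end Cotensor

/-! ### Kernels and quotients of comodules -/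

section SubQuotient

variable {R C X Y K Q : Type u} [CommRing R] [AddCommGroup C] [Module R C] [Coalgebra R C]
  [AddCommGroup X] [Module R X] [AddCommGroup Y] [Module R Y]
  [AddCommGroup K] [Module R K] [AddCommGroup Q] [Module R Q]

theorem exists_comp_eq_of_range_le {A B X : Type u} [AddCommGroup A] [Module R A]
    [AddCommGroup B] [Module R B] [AddCommGroup X] [Module R X] {i : A →ₗ[R] B}
    (hi : Function.Injective i) {g : X →ₗ[R] B} (h : ∀ x, g x ∈ LinearMap.range i) :
    ∃ g' : X →ₗ[R] A, i ∘ₗ g' = g := by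
  refine ⟨(LinearEquiv.ofInjective i hi).symm.toLinearMap ∘ₗ g.codRestrict _ h, ?_⟩
  ext x
  have := LinearEquiv.apply_symm_apply (LinearEquiv.ofInjective i hi) (g.codRestrict _ h x)
  exact congrArg Subtype.val this

theorem IsRightComodule.of_surjective {ρY : Y →ₗ[R] Y ⊗[R] C} {ρQ : Q →ₗ[R] Q ⊗[R] C}
    (hY : IsRightComodule ρY) {q : Y →ₗ[R] Q} (hq : IsRightColinear ρY ρQ q)
    (hs : Function.Surjective q) : IsRightComodule ρQ := by
  unfold IsRightColinear at hq
  have e1 : (TensorProduct.assoc R Q C C).toLinearMap ∘ₗ (q.rTensor C).rTensor C =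
      q.rTensor (C ⊗[R] C) ∘ₗ (TensorProduct.assoc R Y C C).toLinearMap := by ext; simp
  constructor
  · rw [← LinearMap.cancel_right hs]
    calc _ = ((TensorProduct.assoc R Q C C).toLinearMap ∘ₗ (q.rTensor C).rTensor C) ∘ₗ
          ρY.rTensor C ∘ₗ ρY := by
          simp only [LinearMap.comp_assoc, hq]
          rw [← LinearMap.comp_assoc ρY (q.rTensor C), ← LinearMap.rTensor_comp, hq,
            LinearMap.rTensor_comp, LinearMap.comp_assoc]
      _ = _ := by
          rw [e1, LinearMap.comp_assoc, hY.coassoc, LinearMap.comp_assoc, hq,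
            ← LinearMap.comp_assoc, ← LinearMap.comp_assoc, LinearMap.rTensor_comp_lTensor,
            LinearMap.lTensor_comp_rTensor]
  · rw [← LinearMap.cancel_right hs, LinearMap.comp_assoc, hq, ← LinearMap.comp_assoc,
      LinearMap.lTensor_comp_rTensor, ← LinearMap.rTensor_comp_lTensor, LinearMap.comp_assoc,
      hY.counit]
    ext; simp

theorem IsLeftComodule.of_surjective {lY : Y →ₗ[R] C ⊗[R] Y} {lQ : Q →ₗ[R] C ⊗[R] Q}
    (hY : IsLeftComodule lY) {q : Y →ₗ[R] Q} (hq : IsLeftColinear lY lQ q)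
    (hs : Function.Surjective q) : IsLeftComodule lQ := by
  unfold IsLeftColinear at hq
  have e1 : (TensorProduct.assoc R C C Q).toLinearMap ∘ₗ q.lTensor (C ⊗[R] C) =
      (q.lTensor C).lTensor C ∘ₗ (TensorProduct.assoc R C C Y).toLinearMap := by ext; simp
  constructor
  · rw [← LinearMap.cancel_right hs]
    calc _ = ((TensorProduct.assoc R C C Q).toLinearMap ∘ₗ q.lTensor (C ⊗[R] C)) ∘ₗ
          Coalgebra.comul.rTensor Y ∘ₗ lY := by
          simp only [LinearMap.comp_assoc, hq]
          rw [← LinearMap.comp_assoc lY (q.lTensor C), LinearMap.rTensor_comp_lTensor,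
            ← LinearMap.lTensor_comp_rTensor, LinearMap.comp_assoc]
      _ = _ := by
          rw [e1, LinearMap.comp_assoc, hY.coassoc, LinearMap.comp_assoc, hq,
            ← LinearMap.comp_assoc, ← LinearMap.comp_assoc, ← LinearMap.lTensor_comp,
            ← LinearMap.lTensor_comp, hq]
  · rw [← LinearMap.cancel_right hs, LinearMap.comp_assoc, hq, ← LinearMap.comp_assoc,
      LinearMap.rTensor_comp_lTensor, ← LinearMap.lTensor_comp_rTensor, LinearMap.comp_assoc,
      hY.counit]
    ext; simp

theorem IsLeftComodule.of_injective [Module.Flat R C] {lY : Y →ₗ[R] C ⊗[R] Y}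
    {lK : K →ₗ[R] C ⊗[R] K} (hY : IsLeftComodule lY) {i : K →ₗ[R] Y}
    (hi : IsLeftColinear lK lY i) (hs : Function.Injective i) : IsLeftComodule lK := by
  unfold IsLeftColinear at hi
  have e1 : (TensorProduct.assoc R C C Y).toLinearMap ∘ₗ i.lTensor (C ⊗[R] C) =
      (i.lTensor C).lTensor C ∘ₗ (TensorProduct.assoc R C C K).toLinearMap := by ext; simp
  have hs1 := Module.Flat.lTensor_preserves_injective_linearMap (M := C) i hs
  have hs2 := Module.Flat.lTensor_preserves_injective_linearMap (M := C) _ hs1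
  have hs3 := Module.Flat.lTensor_preserves_injective_linearMap (M := R) i hs
  constructor
  · rw [← LinearMap.cancel_left hs2, ← LinearMap.comp_assoc, ← e1, LinearMap.comp_assoc,
      ← LinearMap.comp_assoc lK, LinearMap.lTensor_comp_rTensor, ← LinearMap.rTensor_comp_lTensor,
      LinearMap.comp_assoc, ← hi]
    rw [← LinearMap.comp_assoc, ← LinearMap.comp_assoc, LinearMap.comp_assoc _ _
      (TensorProduct.assoc R C C Y).toLinearMap, hY.coassoc, ← LinearMap.comp_assoc lK,
      ← LinearMap.lTensor_comp, ← hi, LinearMap.lTensor_comp, LinearMap.comp_assoc,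
      LinearMap.comp_assoc, hi]
  · rw [← LinearMap.cancel_left hs3, ← LinearMap.comp_assoc, LinearMap.lTensor_comp_rTensor,
      ← LinearMap.rTensor_comp_lTensor, LinearMap.comp_assoc, ← hi, ← LinearMap.comp_assoc,
      hY.counit]
    ext; simp

theorem IsRightComodule.exists_quotient {ρX : X →ₗ[R] X ⊗[R] C} {ρY : Y →ₗ[R] Y ⊗[R] C}
    (hY : IsRightComodule ρY) {f : X →ₗ[R] Y} (hf : IsRightColinear ρX ρY f) :
    ∃ ρQ : (Y ⧸ LinearMap.range f) →ₗ[R] (Y ⧸ LinearMap.range f) ⊗[R] C,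
      IsRightComodule ρQ ∧ IsRightColinear ρY ρQ (LinearMap.range f).mkQ := by
  have h : LinearMap.range f ≤ LinearMap.ker ((LinearMap.range f).mkQ.rTensor C ∘ₗ ρY) := by
    rw [LinearMap.range_le_ker_iff, LinearMap.comp_assoc, hf, ← LinearMap.comp_assoc,
      ← LinearMap.rTensor_comp, LinearMap.range_mkQ_comp, LinearMap.rTensor_zero,
      LinearMap.zero_comp]
  have hc : IsRightColinear ρY ((LinearMap.range f).liftQ _ h) (LinearMap.range f).mkQ :=
    Submodule.liftQ_mkQ _ _ h
  exact ⟨_, hY.of_surjective hc (Submodule.mkQ_surjective _), hc⟩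

theorem IsLeftComodule.exists_quotient {lX : X →ₗ[R] C ⊗[R] X} {lY : Y →ₗ[R] C ⊗[R] Y}
    (hY : IsLeftComodule lY) {f : X →ₗ[R] Y} (hf : IsLeftColinear lX lY f) :
    ∃ lQ : (Y ⧸ LinearMap.range f) →ₗ[R] C ⊗[R] (Y ⧸ LinearMap.range f),
      IsLeftComodule lQ ∧ IsLeftColinear lY lQ (LinearMap.range f).mkQ := by
  have h : LinearMap.range f ≤ LinearMap.ker ((LinearMap.range f).mkQ.lTensor C ∘ₗ lY) := by
    rw [LinearMap.range_le_ker_iff, LinearMap.comp_assoc, hf, ← LinearMap.comp_assoc,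
      ← LinearMap.lTensor_comp, LinearMap.range_mkQ_comp, LinearMap.lTensor_zero,
      LinearMap.zero_comp]
  have hc : IsLeftColinear lY ((LinearMap.range f).liftQ _ h) (LinearMap.range f).mkQ :=
    Submodule.liftQ_mkQ _ _ h
  exact ⟨_, hY.of_surjective hc (Submodule.mkQ_surjective _), hc⟩

/-- Kernels of morphisms of comodules are comodules: this is where flatness of the coalgebra
enters. -/
theorem IsLeftComodule.exists_ker [Module.Flat R C] {lX : X →ₗ[R] C ⊗[R] X}
    {lY : Y →ₗ[R] C ⊗[R] Y} (hX : IsLeftComodule lX) {f : X →ₗ[R] Y}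
    (hf : IsLeftColinear lX lY f) :
    ∃ lK : LinearMap.ker f →ₗ[R] C ⊗[R] LinearMap.ker f,
      IsLeftComodule lK ∧ IsLeftColinear lK lX (LinearMap.ker f).subtype := by
  have hs := Submodule.subtype_injective (LinearMap.ker f)
  have hex := Module.Flat.lTensor_exact C (LinearMap.exact_subtype_ker_map f)
  have hr : ∀ x : LinearMap.ker f, (lX ∘ₗ (LinearMap.ker f).subtype) x ∈
      LinearMap.range ((LinearMap.ker f).subtype.lTensor C) := by
    intro x
    refine (hex _).1 ?_
    have := LinearMap.congr_fun hf x.1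
    simp only [LinearMap.comp_apply] at this
    rw [LinearMap.comp_apply, Submodule.subtype_apply, ← this, x.2, map_zero]
  obtain ⟨lK, hK⟩ := exists_comp_eq_of_range_le
    (Module.Flat.lTensor_preserves_injective_linearMap (M := C) _ hs) hr
  exact ⟨lK, hX.of_injective hK.symm hs, hK.symm⟩

theorem IsRightComodule.injective {ρ : X →ₗ[R] X ⊗[R] C} (h : IsRightComodule ρ) :
    Function.Injective ρ := by
  intro x y hxy
  have e1 := LinearMap.congr_fun h.counit x
  have e2 := LinearMap.congr_fun h.counit y
  rw [LinearMap.comp_apply, hxy] at e1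
  rw [LinearMap.comp_apply, e1] at e2
  simpa using congrArg (TensorProduct.rid R X) e2

theorem IsLeftComodule.injective {l : X →ₗ[R] C ⊗[R] X} (h : IsLeftComodule l) :
    Function.Injective l := by
  intro x y hxy
  have e1 := LinearMap.congr_fun h.counit x
  have e2 := LinearMap.congr_fun h.counit y
  rw [LinearMap.comp_apply, hxy] at e1
  rw [LinearMap.comp_apply, e1] at e2
  simpa using congrArg (TensorProduct.lid R X) e2

/-- The inclusion `X □_C C ⊆ ρ(X)`, so that `ρ : X → X □_C C` is bijective. -/
theorem exists_of_mem_cotensor_comul {ρ : X →ₗ[R] X ⊗[R] C} {z : X ⊗[R] C}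
    (hz : z ∈ cotensor ρ (comul : C →ₗ[R] C ⊗[R] C)) : ∃ x, ρ x = z := by
  refine ⟨TensorProduct.rid R X (counit.lTensor X z), ?_⟩
  rw [mem_cotensor_iff] at hz
  have e1 : ((TensorProduct.rid R C).toLinearMap ∘ₗ counit.lTensor C).lTensor X ∘ₗ
      (TensorProduct.assoc R X C C).toLinearMap ∘ₗ ρ.rTensor C =
      ρ ∘ₗ (TensorProduct.rid R X).toLinearMap ∘ₗ counit.lTensor X := by
    apply TensorProduct.ext'
    intro x c
    simp only [LinearMap.comp_apply, LinearEquiv.coe_coe, LinearMap.rTensor_tmul,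
      LinearMap.lTensor_tmul, TensorProduct.rid_tmul, map_smul]
    generalize ρ x = y
    induction y with
    | zero => simp
    | add a b ha hb => simp only [add_tmul, map_add, ha, hb, smul_add]
    | tmul x' c' => simp
  have e2 : ((TensorProduct.rid R C).toLinearMap ∘ₗ counit.lTensor C).lTensor X ∘ₗ
      comul.lTensor X = LinearMap.id := by
    rw [← LinearMap.lTensor_comp, LinearMap.comp_assoc, lTensor_counit_comp_comul]
    ext; simp
  refine (LinearMap.congr_fun e1 z).symm.trans (Eq.trans ?_ (LinearMap.congr_fun e2 z))
  simp only [LinearMap.comp_apply, LinearEquiv.coe_coe, hz]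

/-- The inclusion `C □_C X ⊆ l(X)`, so that `l : X → C □_C X` is bijective. -/
theorem exists_of_mem_comul_cotensor {l : X →ₗ[R] C ⊗[R] X} {z : C ⊗[R] X}
    (hz : z ∈ cotensor (comul : C →ₗ[R] C ⊗[R] C) l) : ∃ x, l x = z := by
  refine ⟨TensorProduct.lid R X (counit.rTensor X z), ?_⟩
  rw [mem_cotensor_iff] at hz
  have e1 : (TensorProduct.lid R (C ⊗[R] X)).toLinearMap ∘ₗ counit.rTensor (C ⊗[R] X) ∘ₗ
      l.lTensor C = l ∘ₗ (TensorProduct.lid R X).toLinearMap ∘ₗ counit.rTensor X := by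
    ext; simp
  have e2 : (TensorProduct.lid R (C ⊗[R] X)).toLinearMap ∘ₗ counit.rTensor (C ⊗[R] X) ∘ₗ
      (TensorProduct.assoc R C C X).toLinearMap ∘ₗ comul.rTensor X = LinearMap.id := by
    have e3 : (TensorProduct.lid R (C ⊗[R] X)).toLinearMap ∘ₗ counit.rTensor (C ⊗[R] X) ∘ₗ
        (TensorProduct.assoc R C C X).toLinearMap =
        ((TensorProduct.lid R C).toLinearMap ∘ₗ counit.rTensor C).rTensor X := by
      ext; simp [smul_tmul']
    have e4 : ((TensorProduct.lid R C).toLinearMap ∘ₗ counit.rTensor C) ∘ₗ comul =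
        (LinearMap.id : C →ₗ[R] C) := by
      rw [LinearMap.comp_assoc, rTensor_counit_comp_comul]
      ext; simp
    rw [← LinearMap.comp_assoc _ _ (counit.rTensor (C ⊗[R] X)), ← LinearMap.comp_assoc, e3,
      ← LinearMap.rTensor_comp, e4, LinearMap.rTensor_id]
  refine (LinearMap.congr_fun e1 z).symm.trans (Eq.trans ?_ (LinearMap.congr_fun e2 z))
  simp only [LinearMap.comp_apply, LinearEquiv.coe_coe, hz]

end SubQuotient

/-! ### The inverse bicomodule -/

section Inverse

variable {R C D V X Y Y' E E' M N : Type u} [CommRing R] [AddCommGroup C] [Module R C]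
  [AddCommGroup D] [Module R D] [AddCommGroup V] [Module R V]
  [AddCommGroup X] [Module R X] [AddCommGroup Y] [Module R Y] [AddCommGroup Y'] [Module R Y']
  [AddCommGroup E] [Module R E] [AddCommGroup E'] [Module R E'] [AddCommGroup M] [Module R M]
  [AddCommGroup N] [Module R N]
  {lM : M →ₗ[R] C ⊗[R] M} {ρM : M →ₗ[R] M ⊗[R] D}

/-- The value `CoHom(M, f)` of the left adjoint at a morphism `f`. -/
theorem IsCoHom.exists_map [Coalgebra R C] {ρY : Y →ₗ[R] Y ⊗[R] D} {ρE : E →ₗ[R] E ⊗[R] C}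
    {θ : Y →ₗ[R] E ⊗[R] M}
    {ρY' : Y' →ₗ[R] Y' ⊗[R] D} {ρE' : E' →ₗ[R] E' ⊗[R] C} {θ' : Y' →ₗ[R] E' ⊗[R] M}
    (h : IsCoHom lM ρM ρY ρE θ) (h' : IsCoHom lM ρM ρY' ρE' θ') {f : Y →ₗ[R] Y'}
    (hf : IsRightColinear ρY ρY' f) :
    ∃ F : E →ₗ[R] E', IsRightColinear ρE ρE' F ∧ F.rTensor M ∘ₗ θ = θ' ∘ₗ f :=
  (h.universal E' ρE' _ h'.comodule (h'.unit.precomp hf)).exists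

/-- `N` is inverse to the `(C, D)`-bicomodule `M`: it is a `(D, C)`-bicomodule with coactions `ρN`
and `lN`, and `η : D → N □_C M` and `γ : C → M □_D N` are colinear maps that satisfy a triangle
identity, with `γ` bijective. That `η` is bijective too is a consequence. -/
structure IsInverseBicomodule [Coalgebra R C] [Coalgebra R D]
    (lM : M →ₗ[R] C ⊗[R] M) (ρM : M →ₗ[R] M ⊗[R] D)
    (ρN : N →ₗ[R] N ⊗[R] C) (lN : N →ₗ[R] D ⊗[R] N) (η : D →ₗ[R] N ⊗[R] M)
    (γ : C →ₗ[R] M ⊗[R] N) : Prop where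
  left : IsLeftComodule lN
  comm : IsRightColinear ρN (inflateRight D ρN) lN
  unit : IsCotensorMorphism lM ρM ρN comul η
  unit_left : IsLeftColinear comul (inflateLeft M lN) η
  coev : IsRightColinear comul (inflateRight M ρN) γ
  coev_unit : γ.rTensor M ∘ₗ lM = (TensorProduct.assoc R M N M).symm.toLinearMap ∘ₗ
    η.lTensor M ∘ₗ ρM
  coev_injective : Function.Injective γ
  coev_exact : Function.Exact γ
    (ρM.rTensor N - (TensorProduct.assoc R M D N).symm.toLinearMap ∘ₗ lN.lTensor M)

theorem isRightColinear_assoc (ρ : X →ₗ[R] X ⊗[R] C) :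
    IsRightColinear (inflateRight (V ⊗[R] Y) ρ) (inflateRight V (inflateRight Y ρ))
      (TensorProduct.assoc R V Y X).toLinearMap := by
  unfold IsRightColinear inflateRight
  ext v y x
  simp only [AlgebraTensorModule.curry_apply, LinearMap.restrictScalars_self, curry_apply,
    LinearMap.comp_apply, LinearEquiv.coe_coe, TensorProduct.assoc_tmul, LinearMap.lTensor_tmul]
  generalize ρ x = z
  induction z with
  | zero => simp
  | add a b ha hb => simp only [tmul_add, map_add, ha, hb]
  | tmul x c => simp

/-- The `D`-coaction on `CoHom(M, D)` that the comultiplication of `D` induces is coassociative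
and counital, since morphisms out of `CoHom(M, D)` are determined by their restriction to the
unit. -/
theorem IsCoHom.isLeftComodule [Coalgebra R C] [Coalgebra R D] {ρN : N →ₗ[R] N ⊗[R] C}
    {η : D →ₗ[R] N ⊗[R] M}
    (h : IsCoHom lM ρM comul ρN η) {lN : N →ₗ[R] D ⊗[R] N}
    (hc : IsRightColinear ρN (inflateRight D ρN) lN)
    (hl : lN.rTensor M ∘ₗ η =
      ((TensorProduct.assoc R D N M).symm.toLinearMap ∘ₗ η.lTensor D) ∘ₗ comul) :
    IsLeftComodule lN := by
  constructor
  · refine h.hom_ext h.comodule.inflate.inflate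
      (hc.trans ((isRightColinear_rTensor ρN _).trans (isRightColinear_assoc ρN)))
      (hc.trans hc.inflate) ?_
    have e1 : ((TensorProduct.assoc R D D N).toLinearMap ∘ₗ
        (comul (R := R) (A := D)).rTensor N).rTensor M ∘ₗ
          (TensorProduct.assoc R D N M).symm.toLinearMap =
        (TensorProduct.assoc R D (D ⊗[R] N) M).symm.toLinearMap ∘ₗ
          (TensorProduct.assoc R D N M).symm.toLinearMap.lTensor D ∘ₗ
            (TensorProduct.assoc R D D (N ⊗[R] M)).toLinearMap ∘ₗ comul.rTensor (N ⊗[R] M) := by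
      ext c n m
      simp only [AlgebraTensorModule.curry_apply, LinearMap.restrictScalars_self, curry_apply,
        LinearMap.comp_apply, LinearEquiv.coe_coe, TensorProduct.assoc_symm_tmul,
        LinearMap.rTensor_tmul]
      generalize comul (R := R) c = z
      induction z with
      | zero => simp
      | add a b ha hb => simp only [add_tmul, map_add, ha, hb]
      | tmul c c' => simp
    have e2 : (lN.lTensor D).rTensor M ∘ₗ (TensorProduct.assoc R D N M).symm.toLinearMap =
        (TensorProduct.assoc R D (D ⊗[R] N) M).symm.toLinearMap ∘ₗ (lN.rTensor M).lTensor D := by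
      ext; simp
    have e3 : (TensorProduct.assoc R D D (N ⊗[R] M)).toLinearMap ∘ₗ η.lTensor (D ⊗[R] D) =
        (η.lTensor D).lTensor D ∘ₗ (TensorProduct.assoc R D D D).toLinearMap := by
      ext; simp
    calc _ = (((TensorProduct.assoc R D D N).toLinearMap ∘ₗ
          (comul (R := R) (A := D)).rTensor N).rTensor M ∘ₗ
          (TensorProduct.assoc R D N M).symm.toLinearMap) ∘ₗ η.lTensor D ∘ₗ comul := by
          rw [← LinearMap.comp_assoc, LinearMap.rTensor_comp, LinearMap.comp_assoc, hl]
          simp only [LinearMap.comp_assoc]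
      _ = (TensorProduct.assoc R D (D ⊗[R] N) M).symm.toLinearMap ∘ₗ
          (TensorProduct.assoc R D N M).symm.toLinearMap.lTensor D ∘ₗ
            ((TensorProduct.assoc R D D (N ⊗[R] M)).toLinearMap ∘ₗ η.lTensor (D ⊗[R] D)) ∘ₗ
              comul.rTensor D ∘ₗ comul := by
          rw [e1]
          simp only [LinearMap.comp_assoc]
          rw [← LinearMap.comp_assoc _ (η.lTensor D), LinearMap.rTensor_comp_lTensor,
            ← LinearMap.lTensor_comp_rTensor, LinearMap.comp_assoc]
      _ = (TensorProduct.assoc R D (D ⊗[R] N) M).symm.toLinearMap ∘ₗ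
          (((TensorProduct.assoc R D N M).symm.toLinearMap ∘ₗ η.lTensor D) ∘ₗ comul).lTensor D ∘ₗ
            comul := by
          rw [e3]
          simp only [LinearMap.comp_assoc, LinearMap.lTensor_comp]
          rw [Coalgebra.coassoc]
      _ = (lN.lTensor D).rTensor M ∘ₗ (TensorProduct.assoc R D N M).symm.toLinearMap ∘ₗ
          η.lTensor D ∘ₗ comul := by
          rw [← hl, LinearMap.lTensor_comp, LinearMap.comp_assoc, ← LinearMap.comp_assoc, ← e2,
            LinearMap.comp_assoc]
      _ = _ := by
          rw [LinearMap.rTensor_comp, LinearMap.comp_assoc, hl]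
          simp only [LinearMap.comp_assoc]
  · refine h.hom_ext (h.comodule.inflate (V := R)) (hc.trans (isRightColinear_rTensor ρN _))
      (isRightColinear_mk ρN 1) ?_
    have e1 : ((Coalgebra.counit (R := R) (A := D)).rTensor N).rTensor M ∘ₗ
        (TensorProduct.assoc R D N M).symm.toLinearMap =
        (TensorProduct.assoc R R N M).symm.toLinearMap ∘ₗ
          Coalgebra.counit.rTensor (N ⊗[R] M) := by
      ext; simp
    rw [LinearMap.rTensor_comp, LinearMap.comp_assoc, hl]
    calc _ = (((Coalgebra.counit (R := R) (A := D)).rTensor N).rTensor M ∘ₗ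
        (TensorProduct.assoc R D N M).symm.toLinearMap) ∘ₗ η.lTensor D ∘ₗ comul := by
          simp only [LinearMap.comp_assoc]
      _ = (TensorProduct.assoc R R N M).symm.toLinearMap ∘ₗ η.lTensor R ∘ₗ
          Coalgebra.counit.rTensor D ∘ₗ comul := by
          rw [e1, LinearMap.comp_assoc, ← LinearMap.comp_assoc _ (η.lTensor D),
            LinearMap.rTensor_comp_lTensor, ← LinearMap.lTensor_comp_rTensor, LinearMap.comp_assoc]
      _ = _ := by
          rw [Coalgebra.rTensor_counit_comp_comul]
          ext d
          simp only [LinearMap.comp_apply, TensorProduct.mk_apply, LinearMap.lTensor_tmul,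
            LinearEquiv.coe_coe]
          generalize η d = z
          induction z with
          | zero => simp
          | add a b ha hb => simp only [tmul_add, map_add, ha, hb]
          | tmul n m => simp

theorem comp_sub_eq_rTensor_sub_comp {A B P Q : Type u} [AddCommGroup A] [Module R A]
    [AddCommGroup B] [Module R B] [AddCommGroup P] [Module R P] [AddCommGroup Q] [Module R Q]
    {f g : A →ₗ[R] B} {h : B →ₗ[R] Q ⊗[R] M} {k k' : P →ₗ[R] Q} {e : A →ₗ[R] P ⊗[R] M}
    (hf : h ∘ₗ f = k.rTensor M ∘ₗ e) (hg : h ∘ₗ g = k'.rTensor M ∘ₗ e) :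
    h ∘ₗ (f - g) = (k - k').rTensor M ∘ₗ e := by
  rw [LinearMap.comp_sub, hf, hg, LinearMap.rTensor_sub, LinearMap.sub_comp]

/-- The inverse of `M` is `N = CoHom(M, D)`. Its left coaction is induced by the comultiplication of
`D`, and `γ` is `CoHom(M, ρM)`, where `CoHom(M, M) = C` and `CoHom(M, M ⊗ D) = M ⊗ N`; exactness of
`CoHom(M, -)` identifies its image with `M □_D N`. -/
theorem IsMoritaTakeuchi.exists_inverse [Coalgebra R C] [Coalgebra R D]
    (h : IsMoritaTakeuchi lM ρM) :
    ∃ (N : Type u) (_ : AddCommGroup N) (_ : Module R N) (ρN : N →ₗ[R] N ⊗[R] C)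
      (lN : N →ₗ[R] D ⊗[R] N) (η : D →ₗ[R] N ⊗[R] M) (γ : C →ₗ[R] M ⊗[R] N),
      IsInverseBicomodule lM ρM ρN lN η γ := by
  obtain ⟨N, _, _, ρN, η, hN⟩ := h.quasiFinite D comul isRightComodule_comul
  obtain ⟨lN, hc, hl⟩ := hN.exists_map (hN.inflate (V := D)) isRightComodule_comul.colinear
  obtain ⟨γ, hγ, hγu⟩ := h.coend.exists_map (hN.inflate (V := M)) h.bicomodule.right.colinear
  -- The value of `CoHom(M, -)` on the cofree resolution `0 → M → M ⊗ D → M ⊗ D ⊗ D` of `M`,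
  -- cut into two short exact sequences.
  let d : M ⊗[R] D →ₗ[R] (M ⊗[R] D) ⊗[R] D := ρM.rTensor D - inflateRight M comul
  let δ : M ⊗[R] N →ₗ[R] (M ⊗[R] D) ⊗[R] N :=
    ρM.rTensor N - (TensorProduct.assoc R M D N).symm.toLinearMap ∘ₗ lN.lTensor M
  have hd : IsRightColinear (inflateRight M comul) (inflateRight (M ⊗[R] D) comul) d :=
    (isRightColinear_rTensor comul ρM).sub
      (IsRightComodule.colinear (isRightComodule_comul.inflate (V := M)))
  have hassoc : IsRightColinear (inflateRight M (inflateRight D ρN))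
      (inflateRight (M ⊗[R] D) ρN) (TensorProduct.assoc R M D N).symm.toLinearMap :=
    (isRightColinear_assoc ρN).symm
  have hδ : IsRightColinear (inflateRight M ρN) (inflateRight (M ⊗[R] D) ρN) δ :=
    (isRightColinear_rTensor ρN ρM).sub (hc.inflate.trans hassoc)
  have hdρ : d ∘ₗ ρM = 0 := by
    rw [LinearMap.sub_comp, inflateRight, LinearMap.comp_assoc, ← h.bicomodule.right.coassoc,
      ← LinearMap.comp_assoc, LinearEquiv.symm_comp, LinearMap.id_comp]
    exact sub_self (ρM.rTensor D ∘ₗ ρM)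
  have hker : LinearMap.ker d = LinearMap.range ρM := by
    refine le_antisymm ?_ (LinearMap.range_le_ker_iff.2 hdρ)
    intro z hz
    refine exists_of_mem_cotensor_comul ?_
    rw [mem_cotensor_iff]
    have : ρM.rTensor D z = (TensorProduct.assoc R M D D).symm (comul.lTensor M z) :=
      sub_eq_zero.1 hz
    rw [this, LinearEquiv.apply_symm_apply]
  obtain ⟨ρQ, hQ, hq⟩ := IsRightComodule.exists_quotient
    (isRightComodule_comul.inflate (V := M)) h.bicomodule.right.colinear
  let j : (M ⊗[R] D ⧸ LinearMap.range ρM) →ₗ[R] (M ⊗[R] D) ⊗[R] D :=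
    (LinearMap.range ρM).liftQ d hker.ge
  have hjq : j ∘ₗ (LinearMap.range ρM).mkQ = d := Submodule.liftQ_mkQ _ _ _
  have hjinj : Function.Injective j := by
    rw [← LinearMap.ker_eq_bot, Submodule.ker_liftQ, hker, Submodule.mkQ_map_self]
  have hj : IsRightColinear ρQ (inflateRight (M ⊗[R] D) comul) j := by
    unfold IsRightColinear at *
    rw [← LinearMap.cancel_right (Submodule.mkQ_surjective (LinearMap.range ρM)),
      LinearMap.comp_assoc, LinearMap.comp_assoc, hjq, hq, hd, ← LinearMap.comp_assoc,
      ← LinearMap.rTensor_comp, hjq]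
  obtain ⟨ρQ', hQ', hq'⟩ := IsRightComodule.exists_quotient
    (isRightComodule_comul.inflate (V := M ⊗[R] D)) hj
  obtain ⟨E, _, _, ρE, θE, hE⟩ := h.quasiFinite _ ρQ hQ
  obtain ⟨E', _, _, ρE', θE', hE'⟩ := h.quasiFinite _ ρQ' hQ'
  have h2 := hN.inflate (V := M)
  have h3 := hN.inflate (V := M ⊗[R] D)
  obtain ⟨F₂, hF₂, hFu₂⟩ := h2.exists_map hE hq
  obtain ⟨F₃, hF₃, hFu₃⟩ := hE.exists_map h3 hj
  obtain ⟨F₄, hF₄, hFu₄⟩ := h3.exists_map hE' hq'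
  have ex1 := h.injector _ _ _ _ _ _ _ _ _ _ _ _ _ _ _ _ _ _ _ h.bicomodule.right
    isRightComodule_comul.inflate hQ h.bicomodule.right.colinear hq
    ⟨h.bicomodule.right.injective, LinearMap.exact_map_mkQ_range _, Submodule.mkQ_surjective _⟩
    h.coend h2 hE hγ hγu hF₂ hFu₂
  have ex2 := h.injector _ _ _ _ _ _ _ _ _ _ _ _ _ _ _ _ _ _ _ hQ
    isRightComodule_comul.inflate hQ' hj hq'
    ⟨hjinj, LinearMap.exact_map_mkQ_range _, Submodule.mkQ_surjective _⟩
    hE h3 hE' hF₃ hFu₃ hF₄ hFu₄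
  have hcomp : F₃ ∘ₗ F₂ = δ := by
    refine h2.hom_ext h3.comodule (hF₂.trans hF₃) hδ ?_
    rw [LinearMap.rTensor_comp, LinearMap.comp_assoc, hFu₂, ← LinearMap.comp_assoc, hFu₃,
      LinearMap.comp_assoc, hjq]
    refine comp_sub_eq_rTensor_sub_comp ?_ ?_
    · have e1 : (ρM.rTensor N).rTensor M ∘ₗ (TensorProduct.assoc R M N M).symm.toLinearMap =
          (TensorProduct.assoc R (M ⊗[R] D) N M).symm.toLinearMap ∘ₗ
            ρM.rTensor (N ⊗[R] M) := by ext; simp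
      rw [← LinearMap.comp_assoc, e1, LinearMap.comp_assoc, LinearMap.comp_assoc,
        LinearMap.lTensor_comp_rTensor, LinearMap.rTensor_comp_lTensor]
    · have e1 : ((TensorProduct.assoc R M D N).symm.toLinearMap ∘ₗ lN.lTensor M).rTensor M ∘ₗ
          (TensorProduct.assoc R M N M).symm.toLinearMap =
          (TensorProduct.assoc R M D N).symm.toLinearMap.rTensor M ∘ₗ
            (TensorProduct.assoc R M (D ⊗[R] N) M).symm.toLinearMap ∘ₗ
              (lN.rTensor M).lTensor M := by ext; simp
      have e2 : (TensorProduct.assoc R M D N).symm.toLinearMap.rTensor M ∘ₗ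
            (TensorProduct.assoc R M (D ⊗[R] N) M).symm.toLinearMap ∘ₗ
              (TensorProduct.assoc R D N M).symm.toLinearMap.lTensor M =
          (TensorProduct.assoc R (M ⊗[R] D) N M).symm.toLinearMap ∘ₗ
            (TensorProduct.assoc R M D (N ⊗[R] M)).symm.toLinearMap := by ext; simp
      have e3 : (TensorProduct.assoc R M D (N ⊗[R] M)).symm.toLinearMap ∘ₗ
          (η.lTensor D).lTensor M = η.lTensor (M ⊗[R] D) ∘ₗ
            (TensorProduct.assoc R M D D).symm.toLinearMap := by ext; simp
      have e4 := congrArg (fun f => f ∘ₗ (η.lTensor D).lTensor M ∘ₗ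
        (comul (R := R) (A := D)).lTensor M) e2
      have e5 := congrArg (fun f => (TensorProduct.assoc R (M ⊗[R] D) N M).symm.toLinearMap ∘ₗ
        f ∘ₗ (comul (R := R) (A := D)).lTensor M) e3
      rw [← LinearMap.comp_assoc (LinearMap.lTensor M η), e1, LinearMap.comp_assoc,
        LinearMap.comp_assoc, LinearMap.comp_assoc, ← LinearMap.lTensor_comp, hl, inflateRight,
        LinearMap.lTensor_comp, LinearMap.lTensor_comp]
      simp only [LinearMap.comp_assoc] at e4 e5 ⊢
      rw [e4, ← e5]
  refine ⟨N, inferInstance, inferInstance, ρN, lN, η, γ, hN.isLeftComodule hc hl, hc, hN.unit,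
    ?_, hγ, ?_, ex1.injective, ?_⟩
  · unfold IsLeftColinear inflateLeft
    rw [LinearMap.comp_assoc, hl, LinearMap.comp_assoc, ← LinearMap.comp_assoc,
      LinearEquiv.comp_symm, LinearMap.id_comp]
  · rw [hγu, LinearMap.comp_assoc]
  · intro z
    rw [← ex1.exact z]
    change δ z = 0 ↔ _
    rw [← hcomp, LinearMap.comp_apply, map_eq_zero_iff _ ex2.injective]

end Inverse

/-! ### Colinear endomorphisms of a Morita-Takeuchi bicomodule -/

section Duality

variable {R C D M N : Type u} [CommRing R] [AddCommGroup C] [Module R C] [Coalgebra R C]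
  [AddCommGroup D] [Module R D] [Coalgebra R D] [AddCommGroup M] [Module R M]
  [AddCommGroup N] [Module R N] {lM : M →ₗ[R] C ⊗[R] M} {ρM : M →ₗ[R] M ⊗[R] D}

/-- Every right colinear map `M → V ⊗ M` is `m ↦ χ(m₍₋₁₎) ⊗ m₍₀₎` for a unique linear map
`χ : C → V`: this is the universal property of `CoEnd(M) = C` for the cofree comodule `V ⊗ C`. -/
theorem IsMoritaTakeuchi.existsUnique_rTensor_comp (h : IsMoritaTakeuchi lM ρM) {V : Type u}
    [AddCommGroup V] [Module R V] {s : M →ₗ[R] V ⊗[R] M}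
    (hs : IsRightColinear ρM (inflateRight V ρM) s) :
    ∃! χ : C →ₗ[R] V, χ.rTensor M ∘ₗ lM = s := by
  have hcol : ∀ χ : C →ₗ[R] V, IsRightColinear comul (inflateRight V comul)
      (χ.rTensor C ∘ₗ comul) := fun χ =>
    isRightComodule_comul.colinear.trans (isRightColinear_rTensor comul χ)
  have hχ : ∀ χ : C →ₗ[R] V, (χ.rTensor C ∘ₗ comul).rTensor M ∘ₗ lM =
      (TensorProduct.assoc R V C M).symm.toLinearMap ∘ₗ lM.lTensor V ∘ₗ χ.rTensor M ∘ₗ lM := by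
    intro χ
    have e : (χ.rTensor C).rTensor M = (TensorProduct.assoc R V C M).symm.toLinearMap ∘ₗ
        χ.rTensor (C ⊗[R] M) ∘ₗ (TensorProduct.assoc R C C M).toLinearMap := by ext; simp
    rw [LinearMap.rTensor_comp, e]
    simp only [LinearMap.comp_assoc]
    rw [h.bicomodule.left.coassoc, ← LinearMap.comp_assoc lM (lM.lTensor C),
      LinearMap.rTensor_comp_lTensor, ← LinearMap.lTensor_comp_rTensor, LinearMap.comp_assoc]
  have hε : ∀ χ : C →ₗ[R] V, (TensorProduct.rid R V).toLinearMap ∘ₗ counit.lTensor V ∘ₗ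
      χ.rTensor C ∘ₗ comul = χ := by
    intro χ
    rw [← LinearMap.comp_assoc _ (χ.rTensor C), LinearMap.lTensor_comp_rTensor,
      ← LinearMap.rTensor_comp_lTensor, LinearMap.comp_assoc, lTensor_counit_comp_comul]
    ext; simp
  have ht : IsCotensorMorphism lM ρM (inflateRight V comul) ρM
      ((TensorProduct.assoc R V C M).symm.toLinearMap ∘ₗ lM.lTensor V ∘ₗ s) := by
    have := (h.coend.unit.inflate (V := V)).precomp hs
    rwa [LinearMap.comp_assoc] at this
  obtain ⟨f, ⟨hf, hft⟩, -⟩ := h.coend.universal _ _ _ isRightComodule_comul.inflate ht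
  refine ⟨(TensorProduct.rid R V).toLinearMap ∘ₗ counit.lTensor V ∘ₗ f, ?_, ?_⟩
  · have e : ((TensorProduct.rid R V).toLinearMap ∘ₗ counit.lTensor V).rTensor M ∘ₗ
        (TensorProduct.assoc R V C M).symm.toLinearMap =
        ((TensorProduct.lid R M).toLinearMap ∘ₗ counit.rTensor M).lTensor V := by
      ext; simp [smul_tmul]
    have e' : ((TensorProduct.lid R M).toLinearMap ∘ₗ counit.rTensor M) ∘ₗ lM = LinearMap.id := by
      rw [LinearMap.comp_assoc, h.bicomodule.left.counit]
      ext; simp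
    change (((TensorProduct.rid R V).toLinearMap ∘ₗ counit.lTensor V) ∘ₗ f).rTensor M ∘ₗ lM = s
    rw [LinearMap.rTensor_comp, LinearMap.comp_assoc, hft, ← LinearMap.comp_assoc, e,
      ← LinearMap.comp_assoc, ← LinearMap.lTensor_comp, e', LinearMap.lTensor_id,
      LinearMap.id_comp]
  · intro χ hχs
    have : χ.rTensor C ∘ₗ comul = f := by
      refine h.coend.hom_ext isRightComodule_comul.inflate (hcol χ) hf ?_
      rw [hft, hχ, hχs]
    rw [← this, hε]

/-- The map `χ` of `IsMoritaTakeuchi.existsUnique_rTensor_comp` is unique, stated as injectivity. -/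
theorem IsMoritaTakeuchi.rTensor_comp_injective (h : IsMoritaTakeuchi lM ρM) {V : Type u}
    [AddCommGroup V] [Module R V] {p p' : C →ₗ[R] V} (hp : p.rTensor M ∘ₗ lM = p'.rTensor M ∘ₗ lM) :
    p = p' := by
  have hs : IsRightColinear ρM (inflateRight V ρM) (p'.rTensor M ∘ₗ lM) :=
    IsRightColinear.trans (ρY := inflateRight C ρM) (by
      unfold IsRightColinear inflateRight
      rw [LinearMap.comp_assoc, ← h.bicomodule.comm, ← LinearMap.comp_assoc,
        LinearEquiv.symm_comp, LinearMap.id_comp]) (isRightColinear_rTensor ρM _)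
  exact (h.existsUnique_rTensor_comp hs).unique hp rfl

/-- A coflat comodule is flat as a module: `M □_D (D ⊗ V) = M ⊗ V`. -/
theorem IsFaithfullyCoflat.flat [Module.Flat R D] (h : IsFaithfullyCoflat ρM)
    (hρ : IsRightComodule ρM) : Module.Flat R M := by
  rw [Module.Flat.iff_lTensor_preserves_injective_linearMap]
  intro V W _ _ _ _ f hf
  have hD := isLeftComodule_comul (R := R) (C := D)
  have ex := h.exact (D ⊗[R] V) (D ⊗[R] W) (D ⊗[R] (W ⧸ LinearMap.range f)) _ _ _ _ _
    (isLeftColinear_lTensor comul f) (isLeftColinear_lTensor comul (LinearMap.range f).mkQ)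
    hD.inflate hD.inflate hD.inflate
    ⟨Module.Flat.lTensor_preserves_injective_linearMap f hf,
      lTensor_exact D (LinearMap.exact_map_mkQ_range f) (Submodule.mkQ_surjective _),
      LinearMap.lTensor_surjective D (Submodule.mkQ_surjective _)⟩
  have hmem : ∀ x : M ⊗[R] V, TensorProduct.assoc R M D V (ρM.rTensor V x) ∈
      cotensor ρM (inflateLeft V comul) := by
    intro x
    have e1 : (TensorProduct.assoc R M D (D ⊗[R] V)).toLinearMap ∘ₗ ρM.rTensor (D ⊗[R] V) ∘ₗ
        (TensorProduct.assoc R M D V).toLinearMap =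
        (TensorProduct.assoc R D D V).toLinearMap.lTensor M ∘ₗ
          (TensorProduct.assoc R M (D ⊗[R] D) V).toLinearMap ∘ₗ
          ((TensorProduct.assoc R M D D).toLinearMap ∘ₗ ρM.rTensor D).rTensor V := by
      ext m d v
      simp only [AlgebraTensorModule.curry_apply, LinearMap.restrictScalars_self, curry_apply,
        LinearMap.comp_apply, LinearEquiv.coe_coe, TensorProduct.assoc_tmul,
        LinearMap.rTensor_tmul]
      generalize ρM m = z
      induction z with
      | zero => simp
      | add a b ha hb => simp only [add_tmul, map_add, ha, hb]
      | tmul x c => simp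
    have e2 : (inflateLeft V comul).lTensor M ∘ₗ (TensorProduct.assoc R M D V).toLinearMap =
        (TensorProduct.assoc R D D V).toLinearMap.lTensor M ∘ₗ
          (TensorProduct.assoc R M (D ⊗[R] D) V).toLinearMap ∘ₗ
          (comul.lTensor M).rTensor V := by
      ext; simp [inflateLeft]
    have e1' := LinearMap.congr_fun e1 (ρM.rTensor V x)
    have e2' := LinearMap.congr_fun e2 (ρM.rTensor V x)
    rw [mem_cotensor_iff]
    refine Eq.trans e1' (Eq.trans ?_ e2'.symm)
    simp only [LinearMap.comp_apply, ← LinearMap.rTensor_comp_apply, LinearMap.comp_assoc]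
    rw [hρ.coassoc]
  rw [injective_iff_map_eq_zero]
  intro x hx
  have h0 : cotensorMap ρM _ (isLeftColinear_lTensor comul f) ⟨_, hmem x⟩ = 0 := by
    refine Subtype.ext ?_
    have e : (f.lTensor D).lTensor M ∘ₗ (TensorProduct.assoc R M D V).toLinearMap ∘ₗ
        ρM.rTensor V = (TensorProduct.assoc R M D W).toLinearMap ∘ₗ ρM.rTensor W ∘ₗ
          f.lTensor M := by
      rw [LinearMap.rTensor_comp_lTensor, ← LinearMap.lTensor_comp_rTensor,
        ← LinearMap.comp_assoc, ← LinearMap.comp_assoc]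
      congr 1
      ext; simp
    refine (LinearMap.congr_fun e x).trans ?_
    simp only [LinearMap.comp_apply, hx, map_zero]
    rfl
  have h1 := congrArg Subtype.val ((injective_iff_map_eq_zero _).1 ex.injective _ h0)
  have h2 : ρM.rTensor V x = 0 := by simpa using h1
  have e3 : ((TensorProduct.rid R M).toLinearMap ∘ₗ counit.lTensor M).rTensor V ∘ₗ
      ρM.rTensor V = LinearMap.id := by
    rw [← LinearMap.rTensor_comp, LinearMap.comp_assoc, hρ.counit]
    ext; simp
  have := LinearMap.congr_fun e3 x
  rw [LinearMap.comp_apply, h2, map_zero] at this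
  exact this.symm

/-- A comodule map that `M □_D -` annihilates is zero. -/
theorem IsFaithfullyCoflat.eq_zero (h : IsFaithfullyCoflat ρM) {Y Z : Type u} [AddCommGroup Y]
    [Module R Y] [AddCommGroup Z] [Module R Z] {lY : Y →ₗ[R] D ⊗[R] Y} {lZ : Z →ₗ[R] D ⊗[R] Z}
    {f : Y →ₗ[R] Z} (hf : IsLeftColinear lY lZ f) (hY : IsLeftComodule lY)
    (hZ : IsLeftComodule lZ) (h0 : ∀ x ∈ cotensor ρM lY, f.lTensor M x = 0) : f = 0 := by
  refine h.faithful Y Z lY lZ f 0 hf (by simp [IsLeftColinear]) hY hZ ?_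
  ext x
  change f.lTensor M x.1 = (0 : Y →ₗ[R] Z).lTensor M x.1
  rw [h0 x.1 x.2, LinearMap.lTensor_zero, LinearMap.zero_apply]

theorem rTensor_sub_apply_eq_zero_iff {A B V : Type u} [AddCommGroup A] [Module R A]
    [AddCommGroup B] [Module R B] [AddCommGroup V] [Module R V] {f g : A →ₗ[R] B} {w : A ⊗[R] V} :
    (f - g).rTensor V w = 0 ↔ f.rTensor V w = g.rTensor V w := by
  rw [LinearMap.rTensor_sub, LinearMap.sub_apply, sub_eq_zero]

variable {ρN : N →ₗ[R] N ⊗[R] C} {lN : N →ₗ[R] D ⊗[R] N} {η : D →ₗ[R] N ⊗[R] M}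
  {γ : C →ₗ[R] M ⊗[R] N}

/-- `M □_D -` annihilates the kernel of `η`, by the triangle identity and the injectivity of `γ`. -/
theorem IsInverseBicomodule.unit_injective [Module.Flat R M] [Module.Flat R D]
    (h : IsMoritaTakeuchi lM ρM) (hN : IsInverseBicomodule lM ρM ρN lN η γ) :
    Function.Injective η := by
  obtain ⟨lK, hK, hKc⟩ := isLeftComodule_comul.exists_ker hN.unit_left
  have h0 := h.faithfullyCoflat.eq_zero hKc hK isLeftComodule_comul (fun x hx => by
    have hy := lTensor_mem_cotensor ρM hKc x hx
    obtain ⟨m, hm⟩ := exists_of_mem_cotensor_comul hy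
    have e1 := LinearMap.congr_fun hN.coev_unit m
    simp only [LinearMap.comp_apply, hm] at e1
    rw [← LinearMap.comp_apply (η.lTensor M), ← LinearMap.lTensor_comp, LinearMap.comp_ker_subtype,
      LinearMap.lTensor_zero, LinearMap.zero_apply, map_zero,
      map_eq_zero_iff _ (Module.Flat.rTensor_preserves_injective_linearMap γ hN.coev_injective),
      map_eq_zero_iff _ h.bicomodule.left.injective] at e1
    rw [← hm, e1, map_zero])
  rw [← LinearMap.ker_eq_bot, ← Submodule.range_subtype (LinearMap.ker η), h0, LinearMap.range_zero]

/-- `η : D → N □_C M` is surjective. Applying `M □_D -` turns the complex `D → N ⊗ M → N ⊗ C ⊗ M`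
into the exact cobar complex of `M`, and this functor reflects exactness. -/
theorem IsInverseBicomodule.exists_unit_eq [Module.Flat R M] [Module.Flat R C] [Module.Flat R D]
    (h : IsMoritaTakeuchi lM ρM) (hN : IsInverseBicomodule lM ρM ρN lN η γ)
    {z : N ⊗[R] M} (hz : z ∈ cotensor ρN lM) : ∃ d, η d = z := by
  let κ₁ : N ⊗[R] M →ₗ[R] N ⊗[R] (C ⊗[R] M) :=
    (TensorProduct.assoc R N C M).toLinearMap ∘ₗ ρN.rTensor M
  let κ₂ : N ⊗[R] M →ₗ[R] N ⊗[R] (C ⊗[R] M) := lM.lTensor N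
  have hκ₁ : IsLeftColinear (inflateLeft M lN) (inflateLeft (C ⊗[R] M) lN) κ₁ :=
    hN.comm.left.inflate.trans (isLeftColinear_assoc lN)
  have hκ₂ : IsLeftColinear (inflateLeft M lN) (inflateLeft (C ⊗[R] M) lN) κ₂ :=
    isLeftColinear_lTensor lN lM
  obtain ⟨lK, hK, hi⟩ := hN.left.inflate.exists_ker (hκ₁.sub hκ₂)
  set i := (LinearMap.ker (κ₁ - κ₂)).subtype with hidef
  have hiinj : Function.Injective i := Submodule.subtype_injective _
  have hκi : κ₁ ∘ₗ i = κ₂ ∘ₗ i := LinearMap.ext fun x => sub_eq_zero.1 x.2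
  obtain ⟨η', hη'⟩ := exists_comp_eq_of_range_le (g := η) hiinj (by
    intro d
    rw [hidef, Submodule.range_subtype]
    exact sub_eq_zero.2 (hN.unit.mem_cotensor d))
  have hη'c : IsLeftColinear comul lK η' := by
    have e := hN.unit_left
    unfold IsLeftColinear at e hi ⊢
    rw [← LinearMap.cancel_left
        (Module.Flat.lTensor_preserves_injective_linearMap (M := D) i hiinj),
      ← LinearMap.comp_assoc, ← hi, LinearMap.comp_assoc, hη', e, ← LinearMap.comp_assoc,
      ← LinearMap.lTensor_comp, hη']
  obtain ⟨lQ, hQ, hq⟩ := hK.exists_quotient hη'c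
  have h0 := h.faithfullyCoflat.eq_zero hq hK hQ (fun x hx => by
    have hx' : i.lTensor M x ∈ cotensor ρM (inflateLeft M lN) := lTensor_mem_cotensor ρM hi x hx
    rw [mem_cotensor_iff] at hx'
    obtain ⟨w, hw⟩ : ∃ w, w = (TensorProduct.assoc R M N M).symm (i.lTensor M x) := ⟨_, rfl⟩
    -- `M □_D N` is the image of `γ`, and this persists after tensoring with the flat module `M`.
    have hw0 : (ρM.rTensor N - (TensorProduct.assoc R M D N).symm.toLinearMap ∘ₗ
        lN.lTensor M).rTensor M w = 0 := by
      have e1 : (ρM.rTensor N).rTensor M ∘ₗ (TensorProduct.assoc R M N M).symm.toLinearMap =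
          (TensorProduct.assoc R (M ⊗[R] D) N M).symm.toLinearMap ∘ₗ
            ρM.rTensor (N ⊗[R] M) := by ext; simp
      have e2 : ((TensorProduct.assoc R M D N).symm.toLinearMap ∘ₗ lN.lTensor M).rTensor M ∘ₗ
          (TensorProduct.assoc R M N M).symm.toLinearMap =
          (TensorProduct.assoc R (M ⊗[R] D) N M).symm.toLinearMap ∘ₗ
            (TensorProduct.assoc R M D (N ⊗[R] M)).symm.toLinearMap ∘ₗ
              (inflateLeft M lN).lTensor M := by
        ext m n m'
        simp only [AlgebraTensorModule.curry_apply, LinearMap.restrictScalars_self, curry_apply,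
          LinearMap.comp_apply, LinearEquiv.coe_coe, TensorProduct.assoc_symm_tmul,
          LinearMap.rTensor_tmul, LinearMap.lTensor_tmul, inflateLeft]
        generalize lN n = z
        induction z with
        | zero => simp
        | add a b ha hb => simp only [add_tmul, tmul_add, map_add, ha, hb]
        | tmul x c => simp
      rw [rTensor_sub_apply_eq_zero_iff, hw]
      refine (LinearMap.congr_fun e1 _).trans (Eq.trans ?_ (LinearMap.congr_fun e2 _).symm)
      simp only [LinearMap.comp_apply, LinearEquiv.coe_coe, ← hx', LinearEquiv.symm_apply_apply]
    obtain ⟨z, hz⟩ := (Module.Flat.rTensor_exact M hN.coev_exact w).1 hw0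
    have hxz : i.lTensor M x = TensorProduct.assoc R M N M (γ.rTensor M z) := by
      rw [hz, hw, LinearEquiv.apply_symm_apply]
    have hzc : z ∈ cotensor comul lM := by
      rw [mem_cotensor_iff]
      have e1 : κ₁.lTensor M ∘ₗ (TensorProduct.assoc R M N M).toLinearMap =
          (TensorProduct.assoc R M N (C ⊗[R] M)).toLinearMap ∘ₗ
            (TensorProduct.assoc R (M ⊗[R] N) C M).toLinearMap ∘ₗ
              (inflateRight M ρN).rTensor M := by
        ext m n m'
        simp only [AlgebraTensorModule.curry_apply, LinearMap.restrictScalars_self, curry_apply,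
          LinearMap.comp_apply, LinearEquiv.coe_coe, TensorProduct.assoc_tmul,
          LinearMap.rTensor_tmul, LinearMap.lTensor_tmul, inflateRight, κ₁]
        generalize ρN n = z
        induction z with
        | zero => simp
        | add a b ha hb => simp only [add_tmul, tmul_add, map_add, ha, hb]
        | tmul x c => simp
      have e2 : (inflateRight M ρN).rTensor M ∘ₗ γ.rTensor M =
          (γ.rTensor C).rTensor M ∘ₗ comul.rTensor M := by
        rw [← LinearMap.rTensor_comp, hN.coev, LinearMap.rTensor_comp]
      have e3 : (TensorProduct.assoc R (M ⊗[R] N) C M).toLinearMap ∘ₗ (γ.rTensor C).rTensor M =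
          γ.rTensor (C ⊗[R] M) ∘ₗ (TensorProduct.assoc R C C M).toLinearMap := by ext; simp
      have e4 : κ₂.lTensor M ∘ₗ (TensorProduct.assoc R M N M).toLinearMap ∘ₗ γ.rTensor M =
          (TensorProduct.assoc R M N (C ⊗[R] M)).toLinearMap ∘ₗ γ.rTensor (C ⊗[R] M) ∘ₗ
            lM.lTensor C := by
        rw [LinearMap.rTensor_comp_lTensor, ← LinearMap.lTensor_comp_rTensor,
          ← LinearMap.comp_assoc, ← LinearMap.comp_assoc]
        congr 1
        ext; simp [κ₂]
      have e5 : κ₁.lTensor M (i.lTensor M x) = κ₂.lTensor M (i.lTensor M x) := by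
        rw [← LinearMap.lTensor_comp_apply, hκi, LinearMap.lTensor_comp_apply]
      have e1' := LinearMap.congr_fun e1 (γ.rTensor M z)
      have e2' := LinearMap.congr_fun e2 z
      have e3' := LinearMap.congr_fun e3 (comul.rTensor M z)
      have e4' := LinearMap.congr_fun e4 z
      simp only [LinearMap.comp_apply, LinearEquiv.coe_coe] at e1' e2' e3' e4'
      rw [hxz, e1', e4', e2', e3'] at e5
      exact Module.Flat.rTensor_preserves_injective_linearMap γ hN.coev_injective
        ((TensorProduct.assoc R M N (C ⊗[R] M)).injective e5)
    obtain ⟨m, rfl⟩ := exists_of_mem_comul_cotensor hzc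
    have hm := LinearMap.congr_fun hN.coev_unit m
    simp only [LinearMap.comp_apply, LinearEquiv.coe_coe] at hm
    rw [hm, LinearEquiv.apply_symm_apply, ← hη', LinearMap.lTensor_comp_apply] at hxz
    have hxη := Module.Flat.lTensor_preserves_injective_linearMap (M := M) i hiinj hxz
    rw [hxη, ← LinearMap.lTensor_comp_apply, LinearMap.range_mkQ_comp, LinearMap.lTensor_zero,
      LinearMap.zero_apply])
  have hsurj : LinearMap.range η' = ⊤ := by
    rw [← Submodule.ker_mkQ (LinearMap.range η'), h0, LinearMap.ker_zero]
  obtain ⟨d, hd⟩ := LinearMap.range_eq_top.1 hsurj ⟨z, sub_eq_zero.2 hz⟩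
  refine ⟨d, ?_⟩
  rw [← hη', LinearMap.comp_apply, hd]
  rfl

/-- For a Morita-Takeuchi `(C, D)`-bicomodule `M` and flat `V`, every left colinear map
`M → M ⊗ V` is `m ↦ m₍₀₎ ⊗ g(m₍₁₎)` for some linear map `g : D → V`. -/
theorem IsMoritaTakeuchi.exists_lTensor_comp [Module.Flat R C] [Module.Flat R D]
    (h : IsMoritaTakeuchi lM ρM) {V : Type u} [AddCommGroup V] [Module R V] [Module.Flat R V]
    {f : M →ₗ[R] M ⊗[R] V} (hf : IsLeftColinear lM (inflateLeft V lM) f) :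
    ∃ g : D →ₗ[R] V, g.lTensor M ∘ₗ ρM = f := by
  have := h.faithfullyCoflat.flat h.bicomodule.right
  obtain ⟨N, _, _, ρN, lN, η, γ, hN⟩ := h.exists_inverse
  have hinj := hN.unit_injective h
  -- `N □_C f` is a map `D → D ⊗ V`, since `N □_C M = D`.
  have hex : Function.Exact η
      ((TensorProduct.assoc R N C M).toLinearMap ∘ₗ ρN.rTensor M - lM.lTensor N) := by
    intro z
    rw [LinearMap.sub_apply, sub_eq_zero]
    refine ⟨fun hz => hN.exists_unit_eq h hz, ?_⟩
    rintro ⟨d, rfl⟩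
    exact hN.unit.mem_cotensor d
  have hexV := Module.Flat.rTensor_exact V hex
  have hinjV := Module.Flat.rTensor_preserves_injective_linearMap (M := V) η hinj
  have hmem : ∀ d, ((TensorProduct.assoc R N M V).symm.toLinearMap ∘ₗ f.lTensor N ∘ₗ η) d ∈
      LinearMap.range (η.rTensor V) := by
    intro d
    refine (hexV _).1 ?_
    have hd := hN.unit.mem_cotensor d
    rw [mem_cotensor_iff] at hd
    have e1 : ((TensorProduct.assoc R N C M).toLinearMap ∘ₗ ρN.rTensor M).rTensor V ∘ₗ
        (TensorProduct.assoc R N M V).symm.toLinearMap ∘ₗ f.lTensor N =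
        (TensorProduct.assoc R N (C ⊗[R] M) V).symm.toLinearMap ∘ₗ
          (TensorProduct.assoc R C M V).symm.toLinearMap.lTensor N ∘ₗ
            (f.lTensor C).lTensor N ∘ₗ (TensorProduct.assoc R N C M).toLinearMap ∘ₗ
              ρN.rTensor M := by
      have a1 : (ρN.rTensor M).rTensor V ∘ₗ (TensorProduct.assoc R N M V).symm.toLinearMap =
          (TensorProduct.assoc R (N ⊗[R] C) M V).symm.toLinearMap ∘ₗ
            ρN.rTensor (M ⊗[R] V) := by ext; simp
      have a2 : (TensorProduct.assoc R N C M).toLinearMap.rTensor V ∘ₗ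
          (TensorProduct.assoc R (N ⊗[R] C) M V).symm.toLinearMap =
          (TensorProduct.assoc R N (C ⊗[R] M) V).symm.toLinearMap ∘ₗ
            (TensorProduct.assoc R C M V).symm.toLinearMap.lTensor N ∘ₗ
              (TensorProduct.assoc R N C (M ⊗[R] V)).toLinearMap := by
        ext; simp
      have a3 : (f.lTensor C).lTensor N ∘ₗ (TensorProduct.assoc R N C M).toLinearMap =
          (TensorProduct.assoc R N C (M ⊗[R] V)).toLinearMap ∘ₗ f.lTensor (N ⊗[R] C) := by
        ext; simp
      calc _ = (TensorProduct.assoc R N C M).toLinearMap.rTensor V ∘ₗ ((ρN.rTensor M).rTensor V ∘ₗ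
            (TensorProduct.assoc R N M V).symm.toLinearMap) ∘ₗ f.lTensor N := by
            rw [LinearMap.rTensor_comp]
            simp only [LinearMap.comp_assoc]
        _ = ((TensorProduct.assoc R N C M).toLinearMap.rTensor V ∘ₗ
            (TensorProduct.assoc R (N ⊗[R] C) M V).symm.toLinearMap) ∘ₗ
              f.lTensor (N ⊗[R] C) ∘ₗ ρN.rTensor M := by
            rw [a1, LinearMap.comp_assoc, LinearMap.rTensor_comp_lTensor,
              ← LinearMap.lTensor_comp_rTensor, LinearMap.comp_assoc]
        _ = _ := by
            rw [← LinearMap.comp_assoc _ _ ((f.lTensor C).lTensor N), a3, a2]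
            simp only [LinearMap.comp_assoc]
    have e2 : (lM.lTensor N).rTensor V ∘ₗ
        (TensorProduct.assoc R N M V).symm.toLinearMap ∘ₗ f.lTensor N =
        (TensorProduct.assoc R N (C ⊗[R] M) V).symm.toLinearMap ∘ₗ
          (TensorProduct.assoc R C M V).symm.toLinearMap.lTensor N ∘ₗ
            (f.lTensor C).lTensor N ∘ₗ lM.lTensor N := by
      have a1 : (lM.lTensor N).rTensor V ∘ₗ (TensorProduct.assoc R N M V).symm.toLinearMap =
          (TensorProduct.assoc R N (C ⊗[R] M) V).symm.toLinearMap ∘ₗ (lM.rTensor V).lTensor N := by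
        ext; simp
      have a2 : lM.rTensor V ∘ₗ f =
          (TensorProduct.assoc R C M V).symm.toLinearMap ∘ₗ f.lTensor C ∘ₗ lM := by
        rw [← show inflateLeft V lM ∘ₗ f = f.lTensor C ∘ₗ lM from hf, inflateLeft,
          LinearMap.comp_assoc, ← LinearMap.comp_assoc _ _
            (TensorProduct.assoc R C M V).symm.toLinearMap, LinearEquiv.symm_comp,
          LinearMap.id_comp]
      rw [← LinearMap.comp_assoc, a1, LinearMap.comp_assoc, ← LinearMap.lTensor_comp, a2,
        LinearMap.lTensor_comp, LinearMap.lTensor_comp]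
    have e1' := LinearMap.congr_fun e1 (η d)
    have e2' := LinearMap.congr_fun e2 (η d)
    rw [rTensor_sub_apply_eq_zero_iff]
    refine Eq.trans e1' (Eq.trans ?_ e2'.symm)
    simp only [LinearMap.comp_apply, LinearEquiv.coe_coe, hd]
  obtain ⟨g, hg⟩ := exists_comp_eq_of_range_le hinjV hmem
  refine ⟨(TensorProduct.lid R V).toLinearMap ∘ₗ counit.rTensor V ∘ₗ g, ?_⟩
  -- Applying `M □_D -` to `g` recovers `f`, composed with the coaction `ρM`.
  have hkey : g.lTensor M ∘ₗ ρM =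
      (TensorProduct.assoc R M D V).toLinearMap ∘ₗ ρM.rTensor V ∘ₗ f := by
    rw [← LinearMap.cancel_left
      (Module.Flat.lTensor_preserves_injective_linearMap (M := M) _ hinjV)]
    have a1 : (f.lTensor N).lTensor M ∘ₗ (TensorProduct.assoc R M N M).toLinearMap =
        (TensorProduct.assoc R M N (M ⊗[R] V)).toLinearMap ∘ₗ f.lTensor (M ⊗[R] N) := by
      ext; simp
    have a2 : γ.rTensor (M ⊗[R] V) ∘ₗ (TensorProduct.assoc R C M V).toLinearMap =
        (TensorProduct.assoc R (M ⊗[R] N) M V).toLinearMap ∘ₗ (γ.rTensor M).rTensor V := by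
      ext; simp
    have a3 : (TensorProduct.assoc R N M V).symm.toLinearMap.lTensor M ∘ₗ
        (TensorProduct.assoc R M N (M ⊗[R] V)).toLinearMap ∘ₗ
          (TensorProduct.assoc R (M ⊗[R] N) M V).toLinearMap =
        (TensorProduct.assoc R M (N ⊗[R] M) V).toLinearMap ∘ₗ
          (TensorProduct.assoc R M N M).toLinearMap.rTensor V := by
      ext; simp
    have a4 : (η.rTensor V).lTensor M ∘ₗ (TensorProduct.assoc R M D V).toLinearMap =
        (TensorProduct.assoc R M (N ⊗[R] M) V).toLinearMap ∘ₗ (η.lTensor M).rTensor V := by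
      ext; simp
    have a5 : η.lTensor M ∘ₗ ρM =
        (TensorProduct.assoc R M N M).toLinearMap ∘ₗ γ.rTensor M ∘ₗ lM := by
      rw [hN.coev_unit, ← LinearMap.comp_assoc, LinearEquiv.comp_symm, LinearMap.id_comp]
    calc _ = (TensorProduct.assoc R N M V).symm.toLinearMap.lTensor M ∘ₗ
          (f.lTensor N).lTensor M ∘ₗ η.lTensor M ∘ₗ ρM := by
          rw [← LinearMap.comp_assoc, ← LinearMap.lTensor_comp, hg, LinearMap.lTensor_comp,
            LinearMap.lTensor_comp]
          simp only [LinearMap.comp_assoc]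
      _ = (TensorProduct.assoc R N M V).symm.toLinearMap.lTensor M ∘ₗ
          (TensorProduct.assoc R M N (M ⊗[R] V)).toLinearMap ∘ₗ γ.rTensor (M ⊗[R] V) ∘ₗ
            f.lTensor C ∘ₗ lM := by
          rw [a5, ← LinearMap.comp_assoc _ _ ((f.lTensor N).lTensor M), a1, LinearMap.comp_assoc,
            ← LinearMap.comp_assoc lM (γ.rTensor M), LinearMap.lTensor_comp_rTensor,
            ← LinearMap.rTensor_comp_lTensor, LinearMap.comp_assoc]
      _ = (TensorProduct.assoc R M (N ⊗[R] M) V).toLinearMap ∘ₗ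
          ((TensorProduct.assoc R M N M).toLinearMap ∘ₗ γ.rTensor M ∘ₗ lM).rTensor V ∘ₗ f := by
          rw [← show inflateLeft V lM ∘ₗ f = f.lTensor C ∘ₗ lM from hf, inflateLeft,
            LinearMap.comp_assoc, ← LinearMap.comp_assoc _ _ (γ.rTensor (M ⊗[R] V)), a2,
            LinearMap.comp_assoc, ← LinearMap.comp_assoc _ _
              (TensorProduct.assoc R M N (M ⊗[R] V)).toLinearMap, ← LinearMap.comp_assoc _ _
              ((TensorProduct.assoc R N M V).symm.toLinearMap.lTensor M), a3,
            LinearMap.rTensor_comp, LinearMap.rTensor_comp]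
          simp only [LinearMap.comp_assoc]
      _ = _ := by
          rw [← a5, LinearMap.rTensor_comp, ← LinearMap.comp_assoc _ _ ((η.rTensor V).lTensor M),
            a4]
          simp only [LinearMap.comp_assoc]
  have e3 : ((TensorProduct.lid R V).toLinearMap ∘ₗ counit.rTensor V).lTensor M ∘ₗ
      (TensorProduct.assoc R M D V).toLinearMap =
      ((TensorProduct.rid R M).toLinearMap ∘ₗ counit.lTensor M).rTensor V := by
    ext; simp [smul_tmul]
  have e4 : ((TensorProduct.rid R M).toLinearMap ∘ₗ counit.lTensor M) ∘ₗ ρM = LinearMap.id := by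
    rw [LinearMap.comp_assoc, h.bicomodule.right.counit]
    ext; simp
  rw [← LinearMap.comp_assoc, LinearMap.lTensor_comp, LinearMap.comp_assoc, hkey,
    ← LinearMap.comp_assoc, e3, ← LinearMap.comp_assoc, ← LinearMap.rTensor_comp, e4,
    LinearMap.rTensor_id, LinearMap.id_comp]

/-- The map `g` of `IsMoritaTakeuchi.exists_lTensor_comp` is unique, as `M □_D -` is faithful. -/
theorem IsMoritaTakeuchi.lTensor_comp_injective (h : IsMoritaTakeuchi lM ρM) {V : Type u}
    [AddCommGroup V] [Module R V] {g g' : D →ₗ[R] V}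
    (hg : g.lTensor M ∘ₗ ρM = g'.lTensor M ∘ₗ ρM) : g = g' := by
  have hcol : ∀ g : D →ₗ[R] V, IsLeftColinear comul (inflateLeft V comul)
      (g.lTensor D ∘ₗ comul) := fun g =>
    IsLeftColinear.trans (lY := inflateLeft D comul) Coalgebra.coassoc
      (isLeftColinear_lTensor comul g)
  have hε : ∀ g : D →ₗ[R] V, (TensorProduct.lid R V).toLinearMap ∘ₗ counit.rTensor V ∘ₗ
      g.lTensor D ∘ₗ comul = g := by
    intro g
    rw [← LinearMap.comp_assoc _ (g.lTensor D), LinearMap.rTensor_comp_lTensor,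
      ← LinearMap.lTensor_comp_rTensor, LinearMap.comp_assoc, rTensor_counit_comp_comul]
    ext; simp
  have hM : ∀ g : D →ₗ[R] V, (g.lTensor D ∘ₗ comul).lTensor M ∘ₗ ρM =
      (TensorProduct.assoc R M D V).toLinearMap ∘ₗ ρM.rTensor V ∘ₗ g.lTensor M ∘ₗ ρM := by
    intro g
    have e : (g.lTensor D).lTensor M ∘ₗ (TensorProduct.assoc R M D D).toLinearMap =
        (TensorProduct.assoc R M D V).toLinearMap ∘ₗ g.lTensor (M ⊗[R] D) := by ext; simp
    rw [LinearMap.lTensor_comp, LinearMap.comp_assoc, ← h.bicomodule.right.coassoc,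
      ← LinearMap.comp_assoc, e, LinearMap.comp_assoc, ← LinearMap.comp_assoc ρM (ρM.rTensor D),
      LinearMap.lTensor_comp_rTensor, ← LinearMap.rTensor_comp_lTensor, LinearMap.comp_assoc]
  have : g.lTensor D ∘ₗ comul = g'.lTensor D ∘ₗ comul := by
    refine h.faithfullyCoflat.faithful _ _ _ _ _ _ (hcol g) (hcol g') isLeftComodule_comul
      isLeftComodule_comul.inflate ?_
    ext ⟨x, hx⟩
    obtain ⟨m, rfl⟩ := exists_of_mem_cotensor_comul hx
    change (g.lTensor D ∘ₗ comul).lTensor M (ρM m) = (g'.lTensor D ∘ₗ comul).lTensor M (ρM m)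
    rw [← LinearMap.comp_apply, ← LinearMap.comp_apply, hM, hM, hg]
  rw [← hε g, ← hε g', this]

end Duality

/-! ### Convolution actions on maps out of a comodule -/

section ConvolutionActions

open LinearMap WithConv MulOpposite

variable {R A B C D M X Y : Type u} [CommRing R] [Ring A] [Algebra R A] [Ring B] [Algebra R B]
  [AddCommGroup C] [Module R C] [AddCommGroup D] [Module R D] [AddCommGroup M] [Module R M]
  [AddCommGroup X] [Module R X] [AddCommGroup Y] [Module R Y]

section Left

variable [Module A X] [IsScalarTower R A X] [Module B Y] [IsScalarTower R B Y]

/-- The map `c ⊗ m ↦ φ(c) t(m)`. -/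
noncomputable def leftPairing (φ : C →ₗ[R] A) (t : M →ₗ[R] X) : C ⊗[R] M →ₗ[R] X :=
  TensorProduct.lift ((Algebra.lsmul R R X).toLinearMap.compl₁₂ φ t)

@[simp]
theorem leftPairing_tmul (φ : C →ₗ[R] A) (t : M →ₗ[R] X) (c : C) (m : M) :
    leftPairing φ t (c ⊗ₜ m) = φ c • t m := rfl

/-- The left action `(φ · t)(m) = φ(m₍₋₁₎) t(m₍₀₎)` of maps `φ : C → A` on maps `t : M → X` to a
left `A`-module, for a left `C`-coaction `l` on `M`. -/
noncomputable def lact (l : M →ₗ[R] C ⊗[R] M) (φ : WithConv (C →ₗ[R] A)) (t : M →ₗ[R] X) :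
    M →ₗ[R] X :=
  leftPairing φ.ofConv t ∘ₗ l

theorem lact_mul [Coalgebra R C] {l : M →ₗ[R] C ⊗[R] M} (hl : IsLeftComodule l)
    (φ φ' : WithConv (C →ₗ[R] A)) (t : M →ₗ[R] X) :
    lact l (φ * φ') t = lact l φ (lact l φ' t) := by
  have e1 : leftPairing (φ * φ').ofConv t = leftPairing φ.ofConv (leftPairing φ'.ofConv t) ∘ₗ
      (TensorProduct.assoc R C C M).toLinearMap ∘ₗ comul.rTensor M := by
    ext c m
    simp only [AlgebraTensorModule.curry_apply, LinearMap.restrictScalars_self, curry_apply,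
      LinearMap.comp_apply, LinearEquiv.coe_coe, LinearMap.rTensor_tmul, leftPairing_tmul,
      LinearMap.convMul_def, ofConv_toConv]
    generalize comul (R := R) c = z
    induction z with
    | zero => simp
    | add a b ha hb => simp only [add_tmul, map_add, ← ha, ← hb, add_smul]
    | tmul x c => simp [mul_smul]
  have e2 : leftPairing φ.ofConv (leftPairing φ'.ofConv t ∘ₗ l) =
      leftPairing φ.ofConv (leftPairing φ'.ofConv t) ∘ₗ l.lTensor C := by
    ext; simp
  unfold lact
  rw [e1, e2, LinearMap.comp_assoc, LinearMap.comp_assoc, hl.coassoc, LinearMap.comp_assoc]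

theorem lact_one [Coalgebra R C] {l : M →ₗ[R] C ⊗[R] M} (hl : IsLeftComodule l)
    (t : M →ₗ[R] X) : lact l (1 : WithConv (C →ₗ[R] A)) t = t := by
  have e : leftPairing (1 : WithConv (C →ₗ[R] A)).ofConv t =
      t ∘ₗ (TensorProduct.lid R M).toLinearMap ∘ₗ counit.rTensor M := by
    ext; simp
  unfold lact
  rw [e, LinearMap.comp_assoc, LinearMap.comp_assoc, hl.counit]
  ext; simp

theorem map_lact [Coalgebra R C] (l : M →ₗ[R] C ⊗[R] M) (α : A →ₐ[R] B) {f : X →ₗ[R] Y}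
    (hf : ∀ a x, f (a • x) = α a • f x) (φ : WithConv (C →ₗ[R] A)) (t : M →ₗ[R] X) :
    f ∘ₗ lact l φ t = lact l (convMap α φ) (f ∘ₗ t) := by
  unfold lact
  rw [← LinearMap.comp_assoc]
  congr 1
  ext; simp [hf, convMap]

end Left

section Right

variable [Module Aᵐᵒᵖ X] [IsScalarTower R Aᵐᵒᵖ X] [Module Bᵐᵒᵖ Y] [IsScalarTower R Bᵐᵒᵖ Y]

/-- The map `m ⊗ d ↦ t(m) ψ(d)`. -/
noncomputable def rightPairing (t : M →ₗ[R] X) (ψ : D →ₗ[R] A) : M ⊗[R] D →ₗ[R] X :=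
  TensorProduct.lift ((Algebra.lsmul R R X).toLinearMap.flip.compl₁₂ t
    ((opLinearEquiv R).toLinearMap ∘ₗ ψ))

@[simp]
theorem rightPairing_tmul (t : M →ₗ[R] X) (ψ : D →ₗ[R] A) (m : M) (d : D) :
    rightPairing t ψ (m ⊗ₜ d) = op (ψ d) • t m := rfl

/-- The right action `(t · ψ)(m) = t(m₍₀₎) ψ(m₍₁₎)` of maps `ψ : D → A` on maps `t : M → X` to a
right `A`-module, for a right `D`-coaction `ρ` on `M`. -/
noncomputable def ract (ρ : M →ₗ[R] M ⊗[R] D) (t : M →ₗ[R] X) (ψ : WithConv (D →ₗ[R] A)) :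
    M →ₗ[R] X :=
  rightPairing t ψ.ofConv ∘ₗ ρ

theorem ract_mul [Coalgebra R D] {ρ : M →ₗ[R] M ⊗[R] D} (hρ : IsRightComodule ρ)
    (t : M →ₗ[R] X) (ψ ψ' : WithConv (D →ₗ[R] A)) :
    ract ρ t (ψ * ψ') = ract ρ (ract ρ t ψ) ψ' := by
  have e1 : rightPairing t (ψ * ψ').ofConv ∘ₗ (LinearMap.id : M ⊗[R] D →ₗ[R] M ⊗[R] D) =
      rightPairing (rightPairing t ψ.ofConv) ψ'.ofConv ∘ₗ
        (TensorProduct.assoc R M D D).symm.toLinearMap ∘ₗ comul.lTensor M := by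
    ext m d
    simp only [AlgebraTensorModule.curry_apply, LinearMap.restrictScalars_self, curry_apply,
      LinearMap.comp_apply, LinearEquiv.coe_coe, LinearMap.lTensor_tmul, rightPairing_tmul,
      LinearMap.convMul_def, ofConv_toConv, LinearMap.id_apply]
    generalize comul (R := R) d = z
    induction z with
    | zero => simp
    | add a b ha hb => simp only [tmul_add, map_add, ← ha, ← hb, add_smul, op_add]
    | tmul x c => simp [mul_smul]
  have e2 : rightPairing (rightPairing t ψ.ofConv ∘ₗ ρ) ψ'.ofConv =
      rightPairing (rightPairing t ψ.ofConv) ψ'.ofConv ∘ₗ ρ.rTensor D := by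
    ext; simp
  rw [LinearMap.comp_id] at e1
  unfold ract
  rw [e1, e2, LinearMap.comp_assoc, LinearMap.comp_assoc, ← hρ.coassoc,
    ← LinearMap.comp_assoc _ _ (TensorProduct.assoc R M D D).symm.toLinearMap,
    LinearEquiv.symm_comp, LinearMap.id_comp, LinearMap.comp_assoc]

theorem ract_one [Coalgebra R D] {ρ : M →ₗ[R] M ⊗[R] D} (hρ : IsRightComodule ρ)
    (t : M →ₗ[R] X) : ract ρ t (1 : WithConv (D →ₗ[R] A)) = t := by
  have e : rightPairing t (1 : WithConv (D →ₗ[R] A)).ofConv =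
      t ∘ₗ (TensorProduct.rid R M).toLinearMap ∘ₗ counit.lTensor M := by
    ext m d
    have : algebraMap R A (counit d) = counit (R := R) d • (1 : A) :=
      Algebra.algebraMap_eq_smul_one _
    simp [this]
  unfold ract
  rw [e, LinearMap.comp_assoc, LinearMap.comp_assoc, hρ.counit]
  ext; simp

theorem map_ract [Coalgebra R D] (ρ : M →ₗ[R] M ⊗[R] D) (α : A →ₐ[R] B) {f : X →ₗ[R] Y}
    (hf : ∀ (a : A) x, f (op a • x) = op (α a) • f x) (t : M →ₗ[R] X)
    (ψ : WithConv (D →ₗ[R] A)) :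
    f ∘ₗ ract ρ t ψ = ract ρ (f ∘ₗ t) (convMap α ψ) := by
  unfold ract
  rw [← LinearMap.comp_assoc]
  congr 1
  ext; simp [hf, convMap]

end Right

/-- The two actions commute on a bicomodule. -/
theorem lact_ract [Module A X] [IsScalarTower R A X] [Module Aᵐᵒᵖ X] [IsScalarTower R Aᵐᵒᵖ X]
    [SMulCommClass A Aᵐᵒᵖ X] [Coalgebra R C] [Coalgebra R D] {l : M →ₗ[R] C ⊗[R] M}
    {ρ : M →ₗ[R] M ⊗[R] D} (h : IsBicomodule l ρ) (φ : WithConv (C →ₗ[R] A)) (t : M →ₗ[R] X)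
    (ψ : WithConv (D →ₗ[R] A)) :
    lact l φ (ract ρ t ψ) = ract ρ (lact l φ t) ψ := by
  have e1 : leftPairing φ.ofConv (rightPairing t ψ.ofConv ∘ₗ ρ) =
      leftPairing φ.ofConv (rightPairing t ψ.ofConv) ∘ₗ ρ.lTensor C := by ext; simp
  have e2 : rightPairing (leftPairing φ.ofConv t ∘ₗ l) ψ.ofConv =
      rightPairing (leftPairing φ.ofConv t) ψ.ofConv ∘ₗ l.rTensor D := by ext; simp
  have e3 : leftPairing φ.ofConv (rightPairing t ψ.ofConv) ∘ₗ
      (TensorProduct.assoc R C M D).toLinearMap =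
        rightPairing (leftPairing φ.ofConv t) ψ.ofConv := by
    ext; simp [smul_comm]
  unfold lact ract
  rw [e1, e2, ← e3]
  simp only [LinearMap.comp_assoc]
  rw [h.comm]

end ConvolutionActions

/-! ### The coaction of `H` with coefficients on the left -/

section CoactionTransport

open LinearMap WithConv MulOpposite

variable {R A B C D H M N X Y : Type u} [CommRing R] [Ring A] [Algebra R A] [Ring B] [Algebra R B]
  [AddCommGroup C] [Module R C] [AddCommGroup D] [Module R D]
  [AddCommGroup M] [Module R M] [AddCommGroup N] [Module R N]
  [AddCommGroup X] [Module R X] [AddCommGroup Y] [Module R Y] [Ring H] [HopfAlgebra R H]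

/-- The map `a ⊗ n ↦ r(n)⁽⁰⁾ ⊗ a ⊗ r(n)⁽¹⁾` for `r(n) = r(n)⁽⁰⁾ ⊗ r(n)⁽¹⁾ ∈ B ⊗ M`: the extension of
`r` to coefficients in `A`. -/
noncomputable def extend (A : Type u) [Ring A] [Algebra R A] (r : N →ₗ[R] B ⊗[R] M) :
    A ⊗[R] N →ₗ[R] (B ⊗[R] A) ⊗[R] M :=
  (TensorProduct.assoc R B A M).symm.toLinearMap ∘ₗ (TensorProduct.leftComm R A B M).toLinearMap ∘ₗ
    r.lTensor A

theorem extend_tmul (r : N →ₗ[R] B ⊗[R] M) (a : A) (n : N) :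
    extend A r (a ⊗ₜ n) = (TensorProduct.assoc R B A M).symm
      (TensorProduct.leftComm R A B M (a ⊗ₜ r n)) := rfl

theorem extend_smul (r : N →ₗ[R] B ⊗[R] M) (a : A) (x : A ⊗[R] N) :
    extend A r (a • x) =
      (Algebra.TensorProduct.includeRight : A →ₐ[R] B ⊗[R] A) a • extend A r x := by
  induction x with
  | zero => simp
  | add x y hx hy => simp only [smul_add, map_add, hx, hy]
  | tmul a' n =>
    rw [smul_tmul', extend_tmul, extend_tmul]
    generalize r n = z
    induction z with
    | zero => simp
    | add x y hx hy => simp only [tmul_add, smul_add, map_add, hx, hy]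
    | tmul b m => simp [smul_tmul']

theorem extend_op_smul (r : N →ₗ[R] B ⊗[R] M) (a : A) (x : A ⊗[R] N) :
    extend A r (op a • x) =
      op ((Algebra.TensorProduct.includeRight : A →ₐ[R] B ⊗[R] A) a) • extend A r x := by
  induction x with
  | zero => simp
  | add x y hx hy => simp only [smul_add, map_add, hx, hy]
  | tmul a' n =>
    rw [smul_tmul', extend_tmul, extend_tmul]
    generalize r n = z
    induction z with
    | zero => simp
    | add x y hx hy => simp only [tmul_add, smul_add, map_add, hx, hy]
    | tmul b m => simp [smul_tmul']

theorem rTensor_smul_algHom (α : A →ₐ[R] B) (a : A) (x : A ⊗[R] M) :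
    α.toLinearMap.rTensor M (a • x) = α a • α.toLinearMap.rTensor M x := by
  induction x with
  | zero => simp
  | add x y hx hy => simp only [smul_add, map_add, hx, hy]
  | tmul a' n => simp [smul_tmul']

theorem rTensor_op_smul_algHom (α : A →ₐ[R] B) (a : A) (x : A ⊗[R] M) :
    α.toLinearMap.rTensor M (op a • x) = op (α a) • α.toLinearMap.rTensor M x := by
  induction x with
  | zero => simp
  | add x y hx hy => simp only [smul_add, map_add, hx, hy]
  | tmul a' n => simp [smul_tmul']

/-- An `H`-coaction `m ↦ m⁽⁰⁾ ⊗ m⁽¹⁾`, written with the coefficients on the left and pushed forward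
along `α : H → A`. -/
noncomputable def coeffCoaction (δ : M →ₗ[R] M ⊗[R] H) (α : H →ₗ[R] A) : M →ₗ[R] A ⊗[R] M :=
  α.rTensor M ∘ₗ (TensorProduct.comm R M H).toLinearMap ∘ₗ δ

variable {δM : M →ₗ[R] M ⊗[R] H} {lM : M →ₗ[R] C ⊗[R] M} {ρM : M →ₗ[R] M ⊗[R] D}

/-- The map `m ↦ r(m⁽⁰⁾) ⊗ m⁽¹⁾`, with all coefficients on the left. -/
noncomputable def twist (δ : M →ₗ[R] M ⊗[R] H) (r : M →ₗ[R] B ⊗[R] M) :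
    M →ₗ[R] (B ⊗[R] H) ⊗[R] M :=
  extend H r ∘ₗ coeffCoaction δ LinearMap.id

section Coalgebras

variable [Coalgebra R C] [Coalgebra R D]

/-- Colinearity of `lM` for `H`: twisting `φ · r` replaces `φ` by `c ↦ φ(c⁽⁰⁾) ⊗ c⁽¹⁾`. -/
theorem twist_lact (a : HopfCoaction R C H) (h : IsRightColinear δM (codiag a.δ δM) lM)
    (φ : WithConv (C →ₗ[R] B)) (r : M →ₗ[R] B ⊗[R] M) :
    twist δM (lact lM φ r) = lact lM (coactMap a B φ) (twist δM r) := by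
  have e1 : extend H (leftPairing φ.ofConv r) ∘ₗ (TensorProduct.comm R (C ⊗[R] M) H).toLinearMap ∘ₗ
      (mul' R H).lTensor (C ⊗[R] M) ∘ₗ (tensorTensorTensorComm R C H M H).toLinearMap =
      leftPairing (φ.ofConv.rTensor H) (extend H r ∘ₗ (TensorProduct.comm R M H).toLinearMap) := by
    ext c h m h'
    simp only [AlgebraTensorModule.curry_apply, LinearMap.restrictScalars_self, curry_apply,
      LinearMap.comp_apply, LinearEquiv.coe_coe, tensorTensorTensorComm_tmul,
      LinearMap.lTensor_tmul, mul'_apply, TensorProduct.comm_tmul, extend_tmul, leftPairing_tmul,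
      LinearMap.rTensor_tmul]
    generalize r m = z
    induction z with
    | zero => simp
    | add x y hx hy => simp only [tmul_add, smul_add, map_add, hx, hy]
    | tmul b m => simp [smul_tmul']
  have e2 : extend H (leftPairing φ.ofConv r ∘ₗ lM) ∘ₗ (TensorProduct.comm R M H).toLinearMap =
      extend H (leftPairing φ.ofConv r) ∘ₗ (TensorProduct.comm R (C ⊗[R] M) H).toLinearMap ∘ₗ
        lM.rTensor H := by
    ext; simp [extend]
  have e3 : leftPairing (φ.ofConv.rTensor H ∘ₗ a.δ)
      ((extend H r ∘ₗ (TensorProduct.comm R M H).toLinearMap) ∘ₗ δM) =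
      leftPairing (φ.ofConv.rTensor H) (extend H r ∘ₗ (TensorProduct.comm R M H).toLinearMap) ∘ₗ
        map a.δ δM := by
    ext; simp
  unfold IsRightColinear codiag at h
  unfold twist lact coeffCoaction
  rw [LinearMap.rTensor_id, LinearMap.id_comp, ← LinearMap.comp_assoc, e2, LinearMap.comp_assoc,
    LinearMap.comp_assoc, ← h, ← LinearMap.comp_assoc _ _ (extend H r)]
  change _ = leftPairing (φ.ofConv.rTensor H ∘ₗ a.δ) _ ∘ₗ lM
  rw [e3, ← e1]
  simp only [LinearMap.comp_assoc]

theorem twist_ract (b : HopfCoaction R D H) (h : IsRightColinear δM (codiag δM b.δ) ρM)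
    (r : M →ₗ[R] B ⊗[R] M) (ψ : WithConv (D →ₗ[R] B)) :
    twist δM (ract ρM r ψ) = ract ρM (twist δM r) (coactMap b B ψ) := by
  have e1 : extend H (rightPairing r ψ.ofConv) ∘ₗ
      (TensorProduct.comm R (M ⊗[R] D) H).toLinearMap ∘ₗ
      (mul' R H).lTensor (M ⊗[R] D) ∘ₗ (tensorTensorTensorComm R M H D H).toLinearMap =
      rightPairing (extend H r ∘ₗ (TensorProduct.comm R M H).toLinearMap)
        (ψ.ofConv.rTensor H) := by
    ext m h d h'
    simp only [AlgebraTensorModule.curry_apply, LinearMap.restrictScalars_self, curry_apply,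
      LinearMap.comp_apply, LinearEquiv.coe_coe, tensorTensorTensorComm_tmul,
      LinearMap.lTensor_tmul, mul'_apply, TensorProduct.comm_tmul, extend_tmul, rightPairing_tmul,
      LinearMap.rTensor_tmul]
    generalize r m = z
    induction z with
    | zero => simp
    | add x y hx hy => simp only [tmul_add, smul_add, map_add, hx, hy]
    | tmul b m => simp [smul_tmul']
  have e2 : extend H (rightPairing r ψ.ofConv ∘ₗ ρM) ∘ₗ (TensorProduct.comm R M H).toLinearMap =
      extend H (rightPairing r ψ.ofConv) ∘ₗ (TensorProduct.comm R (M ⊗[R] D) H).toLinearMap ∘ₗ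
        ρM.rTensor H := by
    ext; simp [extend]
  have e3 : rightPairing ((extend H r ∘ₗ (TensorProduct.comm R M H).toLinearMap) ∘ₗ δM)
      (ψ.ofConv.rTensor H ∘ₗ b.δ) =
      rightPairing (extend H r ∘ₗ (TensorProduct.comm R M H).toLinearMap) (ψ.ofConv.rTensor H) ∘ₗ
        map δM b.δ := by
    ext; simp
  unfold IsRightColinear codiag at h
  unfold twist ract coeffCoaction
  rw [LinearMap.rTensor_id, LinearMap.id_comp, ← LinearMap.comp_assoc, e2, LinearMap.comp_assoc,
    LinearMap.comp_assoc, ← h, ← LinearMap.comp_assoc _ _ (extend H r)]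
  change _ = rightPairing _ (ψ.ofConv.rTensor H ∘ₗ b.δ) ∘ₗ ρM
  rw [e3, ← e1]
  simp only [LinearMap.comp_assoc]

theorem rTensor_comp_twist_lact (a : HopfCoaction R C H)
    (h : IsRightColinear δM (codiag a.δ δM) lM) (α : B ⊗[R] H →ₐ[R] A)
    (φ : WithConv (C →ₗ[R] B)) (r : M →ₗ[R] B ⊗[R] M) :
    α.toLinearMap.rTensor M ∘ₗ twist δM (lact lM φ r) =
      lact lM (convMap α (coactMap a B φ)) (α.toLinearMap.rTensor M ∘ₗ twist δM r) := by
  rw [twist_lact a h, map_lact lM α (rTensor_smul_algHom α)]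

theorem rTensor_comp_twist_ract (b : HopfCoaction R D H)
    (h : IsRightColinear δM (codiag δM b.δ) ρM) (α : B ⊗[R] H →ₐ[R] A)
    (r : M →ₗ[R] B ⊗[R] M) (ψ : WithConv (D →ₗ[R] B)) :
    α.toLinearMap.rTensor M ∘ₗ twist δM (ract ρM r ψ) =
      ract ρM (α.toLinearMap.rTensor M ∘ₗ twist δM r) (convMap α (coactMap b B ψ)) := by
  rw [twist_ract b h, map_ract ρM α (rTensor_op_smul_algHom α)]

/-- The coaction `m ↦ m⁽⁰⁾ ⊗ α(m⁽¹⁾)` is the action of `α` on `m ↦ 1 ⊗ m`. -/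
theorem coeffCoaction_eq_ract (α : H →ₗ[R] A) :
    coeffCoaction δM α = ract δM (TensorProduct.mk R A M 1) (toConv α) := by
  unfold coeffCoaction ract
  rw [← LinearMap.comp_assoc]
  congr 1
  ext; simp [smul_tmul']

theorem twist_mk_one : twist δM (TensorProduct.mk R B M 1) =
    coeffCoaction δM (Algebra.TensorProduct.includeRight : H →ₐ[R] B ⊗[R] H).toLinearMap := by
  unfold twist coeffCoaction
  rw [LinearMap.rTensor_id, LinearMap.id_comp]
  simp only [← LinearMap.comp_assoc]
  congr 2
  ext; simp [extend]

/-- Coassociativity of `δM`. -/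
theorem twist_coaction (h : IsRightComodule δM) :
    twist δM (coeffCoaction δM LinearMap.id) =
      coeffCoaction δM (Bialgebra.comulAlgHom R H).toLinearMap := by
  have e1 : extend H ((TensorProduct.comm R M H).toLinearMap ∘ₗ δM) ∘ₗ
      (TensorProduct.comm R M H).toLinearMap =
      (TensorProduct.comm R M (H ⊗[R] H)).toLinearMap ∘ₗ
        (TensorProduct.assoc R M H H).toLinearMap ∘ₗ δM.rTensor H := by
    ext m h
    simp only [AlgebraTensorModule.curry_apply, LinearMap.restrictScalars_self, curry_apply,
      LinearMap.comp_apply, LinearEquiv.coe_coe, TensorProduct.comm_tmul, extend_tmul,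
      LinearMap.rTensor_tmul]
    generalize δM m = z
    induction z with
    | zero => simp
    | add x y hx hy => simp only [tmul_add, add_tmul, map_add, hx, hy]
    | tmul m h => simp
  have e2 : (comul (R := R) (A := H)).rTensor M ∘ₗ (TensorProduct.comm R M H).toLinearMap =
      (TensorProduct.comm R M (H ⊗[R] H)).toLinearMap ∘ₗ comul.lTensor M := by
    ext; simp
  unfold twist coeffCoaction
  rw [LinearMap.rTensor_id, LinearMap.id_comp, ← LinearMap.comp_assoc, e1, LinearMap.comp_assoc,
    LinearMap.comp_assoc, h.coassoc]
  change _ = (comul (R := R) (A := H)).rTensor M ∘ₗ _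
  rw [← LinearMap.comp_assoc _ _ (comul.rTensor M), e2, LinearMap.comp_assoc]

theorem convMap_antipode_mul (α : H →ₐ[R] A) :
    (toConv (α.toLinearMap ∘ₗ HopfAlgebra.antipode R) : WithConv (H →ₗ[R] A)) *
      toConv α.toLinearMap = 1 := by
  have := congrArg (convMap α) (LinearMap.antipode_mul_id (R := R) (C := H))
  rwa [map_mul, map_one] at this

theorem convMap_mul_antipode (α : H →ₐ[R] A) :
    (toConv α.toLinearMap : WithConv (H →ₗ[R] A)) *
      toConv (α.toLinearMap ∘ₗ HopfAlgebra.antipode R) = 1 := by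
  have := congrArg (convMap α) (LinearMap.id_mul_antipode (R := R) (C := H))
  rwa [map_mul, map_one] at this

/-- The right `A`-linear extension `a ⊗ m ↦ u(m) a` of `u : M → X`. -/
noncomputable def rightExtend [Module Aᵐᵒᵖ X] [IsScalarTower R Aᵐᵒᵖ X] (u : M →ₗ[R] X) :
    A ⊗[R] M →ₗ[R] X :=
  TensorProduct.lift ((Algebra.lsmul R R X).toLinearMap.compl₁₂
    (opLinearEquiv R : A ≃ₗ[R] Aᵐᵒᵖ).toLinearMap u)

@[simp]
theorem rightExtend_tmul [Module Aᵐᵒᵖ X] [IsScalarTower R Aᵐᵒᵖ X] (u : M →ₗ[R] X) (a : A) (m : M) :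
    rightExtend u (a ⊗ₜ m) = op a • u m := rfl

theorem rightExtend_op_smul [Module Aᵐᵒᵖ X] [IsScalarTower R Aᵐᵒᵖ X] (u : M →ₗ[R] X) (a : A)
    (x : A ⊗[R] M) : rightExtend u (op a • x) = op a • rightExtend u x := by
  induction x with
  | zero => simp
  | add x y hx hy => simp only [smul_add, map_add, hx, hy]
  | tmul a' n => simp [smul_tmul', mul_smul]

theorem rightExtend_comp_coeffCoaction [Module Aᵐᵒᵖ X] [IsScalarTower R Aᵐᵒᵖ X] (u : M →ₗ[R] X)
    (κ : H →ₗ[R] A) :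
    rightExtend u ∘ₗ coeffCoaction δM κ = ract δM u (toConv κ) := by
  unfold coeffCoaction ract
  simp only [← LinearMap.comp_assoc]
  congr 1
  ext; simp

theorem rightExtend_comp_rightExtend [Module Aᵐᵒᵖ X] [IsScalarTower R Aᵐᵒᵖ X] (u : M →ₗ[R] X)
    (v : M →ₗ[R] A ⊗[R] M) :
    rightExtend (A := A) u ∘ₗ rightExtend (A := A) v =
      rightExtend (A := A) (rightExtend (A := A) u ∘ₗ v) := by
  ext; simp [rightExtend_op_smul]

theorem rightExtend_mk_one :
    rightExtend (A := A) (TensorProduct.mk R A M 1) = (LinearMap.id : A ⊗[R] M →ₗ[R] A ⊗[R] M) := by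
  ext; simp [smul_tmul']

theorem rightExtend_comp_ract [Module Aᵐᵒᵖ X] [IsScalarTower R Aᵐᵒᵖ X] (u : M →ₗ[R] X)
    (t : M →ₗ[R] A ⊗[R] M) (ψ : WithConv (D →ₗ[R] A)) :
    rightExtend u ∘ₗ ract ρM t ψ = ract ρM (rightExtend u ∘ₗ t) ψ :=
  map_ract ρM (AlgHom.id R A) (rightExtend_op_smul u) t ψ

/-- The extension of the coaction to `A ⊗ M` along an algebra homomorphism `α : H → A` is inverted
by the antipode. -/
theorem rightExtend_antipode_comp (h : IsRightComodule δM) (α : H →ₐ[R] A) :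
    rightExtend (coeffCoaction δM (α.toLinearMap ∘ₗ HopfAlgebra.antipode R)) ∘ₗ
      coeffCoaction δM α.toLinearMap = TensorProduct.mk R A M 1 := by
  rw [rightExtend_comp_coeffCoaction, coeffCoaction_eq_ract, ← ract_mul h, convMap_antipode_mul,
    ract_one h]

theorem rightExtend_comp_antipode (h : IsRightComodule δM) (α : H →ₐ[R] A) :
    rightExtend (coeffCoaction δM α.toLinearMap) ∘ₗ
      coeffCoaction δM (α.toLinearMap ∘ₗ HopfAlgebra.antipode R) = TensorProduct.mk R A M 1 := by
  rw [rightExtend_comp_coeffCoaction, coeffCoaction_eq_ract, ← ract_mul h, convMap_mul_antipode,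
    ract_one h]

/-- `m ↦ χ(m⁽⁰⁾₍₋₁₎) α(m⁽¹⁾) ⊗ m⁽⁰⁾₍₀₎` is the action of `c ↦ χ(c⁽⁰⁾) α(c⁽¹⁾)` on the coaction. -/
theorem ract_lact_mk_one (a : HopfCoaction R C H) (h : IsRightColinear δM (codiag a.δ δM) lM)
    (α : H →ₐ[R] A) (χ : WithConv (C →ₗ[R] A)) :
    ract δM (lact lM χ (TensorProduct.mk R A M 1)) (toConv α.toLinearMap) =
      lact lM (toConv (ract a.δ χ.ofConv (toConv α.toLinearMap)))
        (coeffCoaction δM α.toLinearMap) := by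
  have e1 : rightPairing (leftPairing χ.ofConv (TensorProduct.mk R A M 1)) α.toLinearMap ∘ₗ
      (mul' R H).lTensor (C ⊗[R] M) ∘ₗ (tensorTensorTensorComm R C H M H).toLinearMap =
      leftPairing (rightPairing χ.ofConv α.toLinearMap)
        (α.toLinearMap.rTensor M ∘ₗ (TensorProduct.comm R M H).toLinearMap) := by
    ext; simp [smul_tmul', mul_assoc]
  have e2 : rightPairing (leftPairing χ.ofConv (TensorProduct.mk R A M 1) ∘ₗ lM) α.toLinearMap =
      rightPairing (leftPairing χ.ofConv (TensorProduct.mk R A M 1)) α.toLinearMap ∘ₗ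
        lM.rTensor H := by
    ext; simp
  have e3 : leftPairing (rightPairing χ.ofConv α.toLinearMap ∘ₗ a.δ)
      ((α.toLinearMap.rTensor M ∘ₗ (TensorProduct.comm R M H).toLinearMap) ∘ₗ δM) =
      leftPairing (rightPairing χ.ofConv α.toLinearMap)
        (α.toLinearMap.rTensor M ∘ₗ (TensorProduct.comm R M H).toLinearMap) ∘ₗ map a.δ δM := by
    ext; simp
  unfold IsRightColinear codiag at h
  unfold lact ract coeffCoaction
  rw [ofConv_toConv, e2, LinearMap.comp_assoc, ← h, ← LinearMap.comp_assoc δM, ofConv_toConv, e3,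
    ← e1]
  simp only [LinearMap.comp_assoc]

/-- Acting by `x` and then by `β` on the `H`-side is acting by `β` and then by
`d ↦ x(d⁽⁰⁾) β(d⁽¹⁾)`, provided that the values of `x` and `β` commute. -/
theorem ract_ract_of_commute [Module Aᵐᵒᵖ X] [IsScalarTower R Aᵐᵒᵖ X] (b : HopfCoaction R D H)
    (h : IsRightColinear δM (codiag δM b.δ) ρM) (u : M →ₗ[R] X) (x : WithConv (D →ₗ[R] A))
    (β : H →ₐ[R] A) (hx : ∀ d h, Commute (x.ofConv d) (β h)) :
    ract δM (ract ρM u x) (toConv β.toLinearMap) =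
      ract ρM (ract δM u (toConv β.toLinearMap))
        (toConv (ract b.δ x.ofConv (toConv β.toLinearMap))) := by
  have e1 : rightPairing (rightPairing u x.ofConv) β.toLinearMap ∘ₗ
      (mul' R H).lTensor (M ⊗[R] D) ∘ₗ (tensorTensorTensorComm R M H D H).toLinearMap =
      rightPairing (rightPairing u β.toLinearMap) (rightPairing x.ofConv β.toLinearMap) := by
    ext m h d h'
    have := (hx d h).eq
    simp only [AlgebraTensorModule.curry_apply, LinearMap.restrictScalars_self, curry_apply,
      LinearMap.comp_apply, LinearEquiv.coe_coe, tensorTensorTensorComm_tmul,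
      LinearMap.lTensor_tmul, mul'_apply, rightPairing_tmul, AlgHom.toLinearMap_apply, map_mul,
      op_smul_eq_mul, smul_smul, ← op_mul, ← mul_assoc, this]
  have e2 : rightPairing (rightPairing u x.ofConv ∘ₗ ρM) β.toLinearMap =
      rightPairing (rightPairing u x.ofConv) β.toLinearMap ∘ₗ ρM.rTensor H := by
    ext; simp
  have e3 : rightPairing (rightPairing u β.toLinearMap ∘ₗ δM)
      (rightPairing x.ofConv β.toLinearMap ∘ₗ b.δ) =
      rightPairing (rightPairing u β.toLinearMap) (rightPairing x.ofConv β.toLinearMap) ∘ₗ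
        map δM b.δ := by
    ext; simp
  unfold IsRightColinear codiag at h
  unfold ract
  rw [ofConv_toConv, e2, LinearMap.comp_assoc, ← h, ofConv_toConv, e3, ← e1]
  simp only [LinearMap.comp_assoc]

end Coalgebras

end CoactionTransport

/-! ### Intertwining of cocharacters -/

section Intertwining

open LinearMap WithConv MulOpposite

variable {R A B C D H M : Type u} [CommRing R] [Ring A] [Algebra R A] [Ring B] [Algebra R B]
  [AddCommGroup C] [Module R C] [AddCommGroup D] [Module R D]
  [AddCommGroup M] [Module R M] [Ring H] [HopfAlgebra R H]
  {lM : M →ₗ[R] C ⊗[R] M} {ρM : M →ₗ[R] M ⊗[R] D} {δM : M →ₗ[R] M ⊗[R] H}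

/-- `φ : C → H` and `ψ : D → H` are intertwined by the coaction of `H` on `M`:
`m₍₀₎⁽⁰⁾ ⊗ φ(m₍₋₁₎) m₍₀₎⁽¹⁾ = m₍₀₎⁽⁰⁾ ⊗ m₍₀₎⁽¹⁾ ψ(m₍₁₎)`. -/
def Intertwines (lM : M →ₗ[R] C ⊗[R] M) (ρM : M →ₗ[R] M ⊗[R] D) (δM : M →ₗ[R] M ⊗[R] H)
    (φ : WithConv (C →ₗ[R] H)) (ψ : WithConv (D →ₗ[R] H)) : Prop :=
  lact lM φ (coeffCoaction δM LinearMap.id) = ract ρM (coeffCoaction δM LinearMap.id) ψ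

theorem lact_mk_one (χ : WithConv (C →ₗ[R] A)) :
    lact lM χ (TensorProduct.mk R A M 1) = χ.ofConv.rTensor M ∘ₗ lM := by
  unfold lact
  congr 1
  ext; simp [smul_tmul']

theorem ract_mk_one (χ : WithConv (D →ₗ[R] A)) :
    ract ρM (TensorProduct.mk R A M 1) χ =
      (TensorProduct.comm R M A).toLinearMap ∘ₗ χ.ofConv.lTensor M ∘ₗ ρM := by
  unfold ract
  rw [← LinearMap.comp_assoc]
  congr 1
  ext; simp [smul_tmul']

variable [Coalgebra R C] [Coalgebra R D] {a : HopfCoaction R C H} {b : HopfCoaction R D H}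

theorem IsMoritaTakeuchi.lact_mk_one_injective (h : IsMoritaTakeuchi lM ρM)
    {x y : WithConv (C →ₗ[R] A)} (hxy : lact lM x (TensorProduct.mk R A M 1) =
      lact lM y (TensorProduct.mk R A M 1)) : x = y := by
  rw [lact_mk_one, lact_mk_one] at hxy
  exact ofConv_injective (h.rTensor_comp_injective hxy)

theorem IsMoritaTakeuchi.ract_mk_one_injective (h : IsMoritaTakeuchi lM ρM)
    {x y : WithConv (D →ₗ[R] A)} (hxy : ract ρM (TensorProduct.mk R A M 1) x =
      ract ρM (TensorProduct.mk R A M 1) y) : x = y := by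
  rw [ract_mk_one, ract_mk_one, LinearMap.cancel_left (LinearEquiv.injective _)] at hxy
  exact ofConv_injective (h.lTensor_comp_injective hxy)

/-- The antipode reduces injectivity of `x ↦ (m ↦ m₍₀₎⁽⁰⁾ ⊗ α(m₍₀₎⁽¹⁾) x(m₍₁₎))` to that of
`x ↦ (m ↦ m₍₀₎ ⊗ x(m₍₁₎))`. -/
theorem IsMoritaTakeuchi.ract_coeffCoaction_injective (h : IsMoritaTakeuchi lM ρM)
    (hδ : IsRightComodule δM) (α : H →ₐ[R] A) {x y : WithConv (D →ₗ[R] A)}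
    (hxy : ract ρM (coeffCoaction δM α.toLinearMap) x =
      ract ρM (coeffCoaction δM α.toLinearMap) y) : x = y := by
  have e := congrArg (fun f => rightExtend
    (coeffCoaction δM (α.toLinearMap ∘ₗ HopfAlgebra.antipode R)) ∘ₗ f) hxy
  simp only [rightExtend_comp_ract, rightExtend_antipode_comp hδ] at e
  exact h.ract_mk_one_injective e

/-- Here the coaction of `H` cannot be cancelled directly, as its coefficients stand to the right of
those of `x`; they are first moved into `x` along the coaction of `H` on `C`. -/
theorem IsMoritaTakeuchi.lact_coeffCoaction_injective (h : IsMoritaTakeuchi lM ρM)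
    (hl : IsEquivariantLeft a lM δM) (α : H →ₐ[R] A) {x y : WithConv (C →ₗ[R] A)}
    (hxy : lact lM x (coeffCoaction δM α.toLinearMap) =
      lact lM y (coeffCoaction δM α.toLinearMap)) : x = y := by
  -- `x = χ ⋆ α` for `χ = x ⋆ αS`, where `(χ ⋆ κ)(c) = χ(c⁽⁰⁾) κ(c⁽¹⁾)`.
  have hx : ∀ x : WithConv (C →ₗ[R] A), ract a.δ (ract a.δ x.ofConv
      (toConv (α.toLinearMap ∘ₗ HopfAlgebra.antipode R))) (toConv α.toLinearMap) = x.ofConv :=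
    fun x => by rw [← ract_mul a.isComodule, convMap_antipode_mul, ract_one a.isComodule]
  have key : ∀ x : WithConv (C →ₗ[R] A), ract δM (lact lM x (coeffCoaction δM α.toLinearMap))
      (toConv (α.toLinearMap ∘ₗ HopfAlgebra.antipode R)) =
      lact lM (toConv (ract a.δ x.ofConv (toConv (α.toLinearMap ∘ₗ HopfAlgebra.antipode R))))
        (TensorProduct.mk R A M 1) := by
    intro x
    have e := ract_lact_mk_one a hl.compatible α (toConv (ract a.δ x.ofConv
      (toConv (α.toLinearMap ∘ₗ HopfAlgebra.antipode R))))
    rw [ofConv_toConv, hx, toConv_ofConv] at e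
    rw [← e, ← ract_mul hl.coaction, convMap_mul_antipode, ract_one hl.coaction]
  have e := h.lact_mk_one_injective ((key x).symm.trans ((congrArg (fun t => ract δM t
    (toConv (α.toLinearMap ∘ₗ HopfAlgebra.antipode R))) hxy).trans (key y)))
  have e' := congrArg (fun f => ract a.δ f (toConv α.toLinearMap)) (toConv_injective e)
  simp only [hx] at e'
  exact ofConv_injective e'

theorem Intertwines.mul (hM : IsBicomodule lM ρM) {φ φ' : WithConv (C →ₗ[R] H)}
    {ψ ψ' : WithConv (D →ₗ[R] H)} (h : Intertwines lM ρM δM φ ψ)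
    (h' : Intertwines lM ρM δM φ' ψ') : Intertwines lM ρM δM (φ * φ') (ψ * ψ') := by
  unfold Intertwines at *
  rw [lact_mul hM.left, h', lact_ract hM, h, ract_mul hM.right]

theorem Intertwines.one (hM : IsBicomodule lM ρM) : Intertwines lM ρM δM 1 1 := by
  unfold Intertwines
  rw [lact_one hM.left, ract_one hM.right]

theorem Intertwines.map {φ : WithConv (C →ₗ[R] H)} {ψ : WithConv (D →ₗ[R] H)}
    (h : Intertwines lM ρM δM φ ψ) (α : H →ₐ[R] A) :
    lact lM (convMap α φ) (coeffCoaction δM α.toLinearMap) =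
      ract ρM (coeffCoaction δM α.toLinearMap) (convMap α ψ) := by
  have e : coeffCoaction δM α.toLinearMap =
      α.toLinearMap.rTensor M ∘ₗ coeffCoaction δM LinearMap.id := by
    unfold coeffCoaction
    rw [LinearMap.rTensor_id, LinearMap.id_comp]
  rw [e, ← map_lact lM α (rTensor_smul_algHom α), ← map_ract ρM α (rTensor_op_smul_algHom α)]
  exact congrArg _ h

theorem Intertwines.twist {φ : WithConv (C →ₗ[R] H)} {ψ : WithConv (D →ₗ[R] H)}
    (h : Intertwines lM ρM δM φ ψ) (r : M →ₗ[R] B ⊗[R] M) :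
    lact lM (convMap (Algebra.TensorProduct.includeRight : H →ₐ[R] B ⊗[R] H) φ)
        (MoritaTakeuchi.twist δM r) =
      ract ρM (MoritaTakeuchi.twist δM r)
        (convMap (Algebra.TensorProduct.includeRight : H →ₐ[R] B ⊗[R] H) ψ) := by
  unfold MoritaTakeuchi.twist
  rw [← map_lact lM _ (extend_smul r), ← map_ract ρM _ (extend_op_smul r)]
  exact congrArg _ h

/-- The right-hand sides of the coaction conditions on `φ` and `ψ` are intertwined by the iterated
coaction of `H` on `M`, as are the left-hand sides by `Intertwines.map`. -/
theorem Intertwines.comul_factor (hM : IsEquivariantBicomodule a b lM ρM δM)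
    {φ : WithConv (C →ₗ[R] H)} {ψ : WithConv (D →ₗ[R] H)} (h : Intertwines lM ρM δM φ ψ) :
    lact lM (coactMap a H φ * convMap Algebra.TensorProduct.includeRight φ)
        (coeffCoaction δM (Bialgebra.comulAlgHom R H).toLinearMap) =
      ract ρM (coeffCoaction δM (Bialgebra.comulAlgHom R H).toLinearMap)
        (coactMap b H ψ * convMap Algebra.TensorProduct.includeRight ψ) := by
  rw [← twist_coaction hM.left.coaction, lact_mul hM.left.comodule, h.twist,
    lact_ract hM.bicomodule, ← twist_lact a hM.left.compatible,
    show lact lM φ _ = _ from h, twist_ract b hM.right.compatible, ract_mul hM.right.comodule]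

variable (hMT : IsMoritaTakeuchi lM ρM) (hM : IsEquivariantBicomodule a b lM ρM δM)

include hMT hM

/-- Each condition on `ψ` follows from the same condition on `φ` by injectivity of the action of
`D`, except for the comodule condition on `ψ`, which expresses that the two actions commute. -/
theorem Intertwines.isCocharacter_right {φ : WithConv (C →ₗ[R] H)} {ψ : WithConv (D →ₗ[R] H)}
    (h : Intertwines lM ρM δM φ ψ) (hφ : IsCocharacter a φ.ofConv) :
    IsCocharacter b ψ.ofConv := by
  rw [isCocharacter_iff] at hφ ⊢
  obtain ⟨h1, h2, -⟩ := hφ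
  refine ⟨?_, ?_, ?_⟩
  · refine hMT.ract_coeffCoaction_injective hM.left.coaction (Bialgebra.counitAlgHom R H) ?_
    rw [← h.map, h1, lact_one hM.left.comodule, ract_one hM.right.comodule]
  · refine hMT.ract_coeffCoaction_injective hM.left.coaction (Bialgebra.comulAlgHom R H) ?_
    rw [← h.map, h2, h.comul_factor hM]
  · rw [commute_iff_eq]
    refine hMT.ract_coeffCoaction_injective hM.left.coaction Algebra.TensorProduct.includeRight ?_
    rw [← twist_mk_one, ract_mul hM.right.comodule, ract_mul hM.right.comodule, ← h.twist,
      ← twist_ract b hM.right.compatible, ← lact_ract hM.bicomodule,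
      ← twist_ract b hM.right.compatible, h.twist]

theorem Intertwines.isCocharacter_left {φ : WithConv (C →ₗ[R] H)} {ψ : WithConv (D →ₗ[R] H)}
    (h : Intertwines lM ρM δM φ ψ) (hψ : IsCocharacter b ψ.ofConv) :
    IsCocharacter a φ.ofConv := by
  rw [isCocharacter_iff] at hψ ⊢
  obtain ⟨h1, h2, -⟩ := hψ
  refine ⟨?_, ?_, ?_⟩
  · refine hMT.lact_coeffCoaction_injective hM.left (Bialgebra.counitAlgHom R H) ?_
    rw [h.map, h1, lact_one hM.left.comodule, ract_one hM.right.comodule]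
  · refine hMT.lact_coeffCoaction_injective hM.left (Bialgebra.comulAlgHom R H) ?_
    rw [h.map, h2, h.comul_factor hM]
  · rw [commute_iff_eq]
    refine hMT.lact_coeffCoaction_injective hM.left Algebra.TensorProduct.includeRight ?_
    rw [← twist_mk_one, lact_mul hM.left.comodule, lact_mul hM.left.comodule, h.twist,
      ← twist_lact a hM.left.compatible, lact_ract hM.bicomodule,
      ← twist_lact a hM.left.compatible, h.twist]

theorem Intertwines.right_unique {φ : WithConv (C →ₗ[R] H)} {ψ ψ' : WithConv (D →ₗ[R] H)}
    (h : Intertwines lM ρM δM φ ψ) (h' : Intertwines lM ρM δM φ ψ') : ψ = ψ' :=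
  hMT.ract_coeffCoaction_injective hM.left.coaction (AlgHom.id R H)
    ((show _ = _ from h).symm.trans h')

theorem Intertwines.left_unique {φ φ' : WithConv (C →ₗ[R] H)} {ψ : WithConv (D →ₗ[R] H)}
    (h : Intertwines lM ρM δM φ ψ) (h' : Intertwines lM ρM δM φ' ψ) : φ = φ' :=
  hMT.lact_coeffCoaction_injective hM.left (AlgHom.id R H)
    ((show _ = _ from h).trans (show _ = _ from h').symm)

/-- Every cocharacter of `D` is intertwined with a map `C → H`. With `d` the coaction of `H` on `M`,
the comodule condition on `ψ` says that `(d · ψ) · S` is right `D`-colinear, so that it is given by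
the left coaction of `C` and a map `χ : C → H`. -/
theorem exists_intertwines_left {ψ : WithConv (D →ₗ[R] H)} (hψ : IsCocharacter b ψ.ofConv) :
    ∃ φ, Intertwines lM ρM δM φ ψ := by
  have hδ := hM.left.coaction
  set d := coeffCoaction δM (LinearMap.id : H →ₗ[R] H) with hd
  set t := ract ρM d ψ with ht
  set s := ract δM t (toConv (HopfAlgebra.antipode R (A := H))) with hs
  have hst : ract δM s (toConv LinearMap.id) = t := by
    rw [hs, ← ract_mul hδ, LinearMap.antipode_mul_id, ract_one hδ]
  -- The maps `ι : D → T(D) ⊗ H` and `β : H → T(D) ⊗ H` express right colinearity of `s`.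
  let β : H →ₐ[R] TensorAlgebra R D ⊗[R] H := Algebra.TensorProduct.includeRight
  let ι : WithConv (D →ₗ[R] TensorAlgebra R D) := toConv (TensorAlgebra.ι R)
  let ι' : WithConv (D →ₗ[R] TensorAlgebra R D ⊗[R] H) :=
    convMap Algebra.TensorProduct.includeLeft ι
  let r : M →ₗ[R] TensorAlgebra R D ⊗[R] M := ract ρM (TensorProduct.mk R _ M 1) ι
  let one : M →ₗ[R] TensorAlgebra R D ⊗[R] M := TensorProduct.mk R _ M 1
  have hcomm := ((isCocharacter_iff b ψ).1 hψ).2.2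
  have hcoact : ract b.δ ι'.ofConv (toConv β.toLinearMap) = (coactMap b _ ι).ofConv := by
    change rightPairing _ _ ∘ₗ b.δ = (TensorAlgebra.ι R).rTensor H ∘ₗ b.δ
    congr 1
    ext
    simp [ι', ι, β, convMap]
  have hrt : extend H r ∘ₗ t = ract ρM (extend H one ∘ₗ t) (coactMap b _ ι) := by
    have e1 : extend H r ∘ₗ t = ract ρM (twist δM r) (convMap β ψ) :=
      map_ract ρM _ (extend_op_smul r) d ψ
    have e2 : extend H one ∘ₗ t = ract ρM (twist δM one) (convMap β ψ) :=
      map_ract ρM _ (extend_op_smul one) d ψ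
    rw [e1, e2, twist_ract b hM.right.compatible, ← ract_mul hM.right.comodule,
      ← ract_mul hM.right.comodule, hcomm.eq]
  have hrs : extend H r ∘ₗ s = ract ρM (extend H one ∘ₗ s) ι' := by
    have e1 : ract δM (extend H r ∘ₗ s) (toConv β.toLinearMap) = extend H r ∘ₗ t := by
      rw [← hst]
      exact (map_ract δM β (extend_op_smul r) s (toConv LinearMap.id)).symm
    have e2 : ract δM (ract ρM (extend H one ∘ₗ s) ι') (toConv β.toLinearMap) =
        ract ρM (extend H one ∘ₗ t) (coactMap b _ ι) := by
      rw [ract_ract_of_commute b hM.right.compatible _ _ _ (fun d h => ?_), hcoact, ← hst]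
      · exact congrArg (fun x => ract ρM x (coactMap b _ ι))
          (map_ract δM β (extend_op_smul one) s (toConv LinearMap.id)).symm
      · simp [ι', ι, β, convMap, commute_iff_eq]
    have e3 := congrArg (fun x => ract δM x (toConv (β.toLinearMap ∘ₗ HopfAlgebra.antipode R)))
      (e1.trans (hrt.trans e2.symm))
    simpa only [← ract_mul hδ, convMap_mul_antipode, ract_one hδ] using e3
  have hcol : IsRightColinear ρM (inflateRight H ρM) s := by
    -- Replacing coefficients in `D` by their images in the tensor algebra loses no information.
    let j : (H ⊗[R] M) ⊗[R] D →ₗ[R] (TensorAlgebra R D ⊗[R] H) ⊗[R] M :=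
      (TensorProduct.assoc R _ H M).symm.toLinearMap ∘ₗ
        (TensorProduct.comm R (H ⊗[R] M) _).toLinearMap ∘ₗ (TensorAlgebra.ι R).lTensor (H ⊗[R] M)
    have hj : Function.Injective j := by
      refine (TensorProduct.assoc R _ H M).symm.injective.comp
        ((TensorProduct.comm R (H ⊗[R] M) _).injective.comp ?_)
      refine Function.LeftInverse.injective
        (g := (TensorAlgebra.ιInv (R := R) (M := D)).lTensor (H ⊗[R] M)) fun x => ?_
      rw [← LinearMap.lTensor_comp_apply, show TensorAlgebra.ιInv ∘ₗ TensorAlgebra.ι R =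
        (LinearMap.id : D →ₗ[R] D) from LinearMap.ext TensorAlgebra.ι_leftInverse,
        LinearMap.lTensor_id, LinearMap.id_apply]
    have e1 : j ∘ₗ inflateRight H ρM = extend H r := by
      ext h m
      simp only [AlgebraTensorModule.curry_apply, LinearMap.restrictScalars_self, curry_apply,
        LinearMap.comp_apply, LinearEquiv.coe_coe, LinearMap.lTensor_tmul, inflateRight, j,
        extend_tmul, r, ract]
      generalize ρM m = z
      induction z with
      | zero => simp
      | add x y hx hy => simp only [tmul_add, map_add, hx, hy]
      | tmul m d => simp [ι, smul_tmul']
    have e2 : j ∘ₗ s.rTensor D = rightPairing (extend H one ∘ₗ s) ι'.ofConv := by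
      ext m d
      simp only [AlgebraTensorModule.curry_apply, LinearMap.restrictScalars_self, curry_apply,
        LinearMap.comp_apply, LinearEquiv.coe_coe, LinearMap.rTensor_tmul, rightPairing_tmul, j]
      generalize s m = z
      induction z with
      | zero => simp
      | add x y hx hy => simp only [add_tmul, smul_add, map_add, hx, hy]
      | tmul h m => simp [ι', ι, convMap, extend_tmul, one, smul_tmul']
    unfold IsRightColinear
    rw [← LinearMap.cancel_left hj, ← LinearMap.comp_assoc, e1, ← LinearMap.comp_assoc, e2, hrs]
    rfl
  obtain ⟨χ, hχ, -⟩ := hMT.existsUnique_rTensor_comp hcol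
  refine ⟨toConv (ract a.δ χ (toConv LinearMap.id)), ?_⟩
  have e := ract_lact_mk_one a hM.left.compatible (AlgHom.id R H) (toConv χ)
  rw [lact_mk_one, ofConv_toConv, hχ] at e
  exact e.symm.trans hst

end Intertwining

/-! ### Totality of the intertwining relation on cocharacters of `C` -/

section Shear

open LinearMap MulOpposite

variable {R C D H M X : Type u} [CommRing R] [AddCommGroup C] [Module R C]
  [AddCommGroup M] [Module R M] [AddCommGroup X] [Module R X] [Ring H] [HopfAlgebra R H]

/-- The map `(h ⊗ c) ⊗ x ↦ c ⊗ h x`. -/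
noncomputable def smulSnd (R C H X : Type u) [CommRing R] [AddCommGroup C] [Module R C] [Ring H]
    [Algebra R H] [AddCommGroup X] [Module R X] [Module H X] [IsScalarTower R H X] :
    (H ⊗[R] C) ⊗[R] X →ₗ[R] C ⊗[R] X :=
  (leftPairing (LinearMap.id : H →ₗ[R] H) (LinearMap.id : X →ₗ[R] X)).lTensor C ∘ₗ
    (TensorProduct.leftComm R H C X).toLinearMap ∘ₗ (TensorProduct.assoc R H C X).toLinearMap

/-- For an `H`-comodule `C` and an `H`-module `X`, the shear map `c ⊗ x ↦ c⁽⁰⁾ ⊗ c⁽¹⁾ x` is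
injective; the antipode provides an inverse. -/
theorem smulSnd_comp_coeffCoaction_injective [Module H X] [IsScalarTower R H X]
    {δ : C →ₗ[R] C ⊗[R] H} (hδ : IsRightComodule δ) :
    Function.Injective (smulSnd R C H X ∘ₗ (coeffCoaction δ LinearMap.id).rTensor X) := by
  have e1 : (smulSnd R C H X ∘ₗ (coeffCoaction δ (HopfAlgebra.antipode R (A := H))).rTensor X) ∘ₗ
      smulSnd R C H X = smulSnd R C H X ∘ₗ
        (rightExtend (A := H) (coeffCoaction δ (HopfAlgebra.antipode R (A := H)))).rTensor X := by
    ext h c x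
    simp only [AlgebraTensorModule.curry_apply, LinearMap.restrictScalars_self, curry_apply,
      LinearMap.comp_apply, LinearEquiv.coe_coe, LinearMap.rTensor_tmul, smulSnd,
      TensorProduct.assoc_tmul, TensorProduct.leftComm_tmul, LinearMap.lTensor_tmul,
      leftPairing_tmul, LinearMap.id_apply, rightExtend_tmul]
    generalize coeffCoaction δ (HopfAlgebra.antipode R (A := H)) c = z
    induction z with
    | zero => simp
    | add a b ha hb => simp only [add_tmul, smul_add, map_add, ha, hb]
    | tmul k c => simp [smul_tmul', mul_smul]
  have e2 : (smulSnd R C H X ∘ₗ (coeffCoaction δ (HopfAlgebra.antipode R (A := H))).rTensor X) ∘ₗ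
      smulSnd R C H X ∘ₗ (coeffCoaction δ LinearMap.id).rTensor X = LinearMap.id := by
    have e3 := rightExtend_antipode_comp hδ (AlgHom.id R H)
    rw [← LinearMap.comp_assoc, e1, LinearMap.comp_assoc, ← LinearMap.rTensor_comp]
    refine Eq.trans (congrArg (fun f => smulSnd R C H X ∘ₗ LinearMap.rTensor X f) e3) ?_
    ext; simp [smulSnd]
  exact LinearMap.injective_of_comp_eq_id _ _ e2

end Shear

section Intertwining

open LinearMap WithConv MulOpposite

variable {R C D H M : Type u} [CommRing R]
  [AddCommGroup C] [Module R C] [Coalgebra R C] [AddCommGroup D] [Module R D] [Coalgebra R D]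
  [AddCommGroup M] [Module R M] [Ring H] [HopfAlgebra R H]
  {lM : M →ₗ[R] C ⊗[R] M} {ρM : M →ₗ[R] M ⊗[R] D} {δM : M →ₗ[R] M ⊗[R] H}
  {a : HopfCoaction R C H} {b : HopfCoaction R D H}

/-- Every cocharacter of `C` is intertwined with a map `D → H`. With `d` the coaction of `H` on `M`,
let `s` be the map for which `φ · d` is `s` followed by the `H`-linear extension of `d`. The
comodule condition on `φ` says that `s` is left `C`-colinear, so that it is given by the right
coaction of `D` and a map `D → H`. -/
theorem exists_intertwines_right [Module.Flat R C] [Module.Flat R D] [Module.Flat R H]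
    (hMT : IsMoritaTakeuchi lM ρM) (hM : IsEquivariantBicomodule a b lM ρM δM)
    {φ : WithConv (C →ₗ[R] H)} (hφ : IsCocharacter a φ.ofConv) :
    ∃ ψ, Intertwines lM ρM δM φ ψ := by
  have hδ := hM.left.coaction
  have hid : rightExtend (A := H) (TensorProduct.mk R H M 1) =
      (LinearMap.id : H ⊗[R] M →ₗ[R] H ⊗[R] M) := rightExtend_mk_one
  set d := coeffCoaction δM (LinearMap.id : H →ₗ[R] H) with hd
  set d' := coeffCoaction δM (HopfAlgebra.antipode R (A := H)) with hd'
  set t := lact lM φ d with ht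
  set s := rightExtend (A := H) d' ∘ₗ t with hs
  have hdd' : rightExtend (A := H) d ∘ₗ rightExtend (A := H) d' = LinearMap.id := by
    rw [rightExtend_comp_rightExtend, ← hid]
    exact congrArg _ (rightExtend_comp_antipode hδ (AlgHom.id R H))
  have hd'd : rightExtend (A := H) d' ∘ₗ rightExtend (A := H) d = LinearMap.id := by
    rw [rightExtend_comp_rightExtend, ← hid]
    exact congrArg _ (rightExtend_antipode_comp hδ (AlgHom.id R H))
  have hst : rightExtend (A := H) d ∘ₗ s = t := by
    rw [hs, ← LinearMap.comp_assoc, hdd', LinearMap.id_comp]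
  let ι : WithConv (C →ₗ[R] TensorAlgebra R C) := toConv (TensorAlgebra.ι R)
  let one : M →ₗ[R] TensorAlgebra R C ⊗[R] M := TensorProduct.mk R _ M 1
  let r : M →ₗ[R] TensorAlgebra R C ⊗[R] M := lact lM ι one
  let κ := (coactMap a (TensorAlgebra R C) ι).ofConv
  let β : H →ₐ[R] TensorAlgebra R C ⊗[R] H := Algebra.TensorProduct.includeRight
  -- The comodule condition on `φ`, transported to the bicomodule.
  have hrt : extend H r ∘ₗ t = lact lM (toConv κ) (extend H one ∘ₗ t) := by
    have e1 : extend H r ∘ₗ t = lact lM (convMap β φ) (twist δM r) := map_lact lM β (extend_smul r)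
      φ d
    have e2 : extend H one ∘ₗ t = lact lM (convMap β φ) (twist δM one) := map_lact lM β (extend_smul
      one) φ d
    rw [e1, e2, twist_lact a hM.left.compatible, ← lact_mul hM.left.comodule]
    change _ = lact lM (coactMap a _ ι) _
    rw [← lact_mul hM.left.comodule, ((isCocharacter_iff a φ).1 hφ).2.2.eq]
  -- Both sides factor through the injective map `w : c ⊗ x ↦ c⁽⁰⁾ ⊗ c⁽¹⁾ x`.
  let l' : H ⊗[R] M →ₗ[R] C ⊗[R] (H ⊗[R] M) :=
    (TensorProduct.leftComm R H C M).toLinearMap ∘ₗ lM.lTensor H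
  let w : C ⊗[R] (H ⊗[R] M) →ₗ[R] (TensorAlgebra R C ⊗[R] H) ⊗[R] M :=
    leftPairing κ (extend H one ∘ₗ rightExtend (A := H) d)
  have hw : Function.Injective w := by
    have e : w = (TensorProduct.assoc R _ H M).symm.toLinearMap ∘ₗ
        (TensorAlgebra.ι R).rTensor (H ⊗[R] M) ∘ₗ
        (smulSnd R C H (H ⊗[R] M) ∘ₗ (coeffCoaction a.δ LinearMap.id).rTensor (H ⊗[R] M)) ∘ₗ
          (rightExtend (A := H) d).lTensor C := by
      have e1 : w = leftPairing κ (extend H one) ∘ₗ (rightExtend (A := H) d).lTensor C := by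
        ext; simp [w]
      rw [e1]
      simp only [← LinearMap.comp_assoc]
      congr 1
      ext c h m
      simp only [AlgebraTensorModule.curry_apply, LinearMap.restrictScalars_self, curry_apply,
        LinearMap.comp_apply, LinearEquiv.coe_coe, LinearMap.rTensor_tmul, leftPairing_tmul,
        coeffCoaction, LinearMap.rTensor_id, LinearMap.id_apply, κ, coactMap, MonoidHom.coe_mk,
        OneHom.coe_mk, ofConv_toConv]
      generalize a.δ c = z
      induction z with
      | zero => simp
      | add a b ha hb => simp only [add_tmul, add_smul, map_add, ha, hb]
      | tmul c k => simp [smulSnd, extend_tmul, one, ι, smul_tmul']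
    have hι : Function.Injective ((TensorAlgebra.ι R : C →ₗ[R] _).rTensor (H ⊗[R] M)) := by
      refine Function.LeftInverse.injective
        (g := (TensorAlgebra.ιInv (R := R) (M := C)).rTensor (H ⊗[R] M)) fun x => ?_
      rw [← LinearMap.rTensor_comp_apply, show TensorAlgebra.ιInv ∘ₗ TensorAlgebra.ι R =
        (LinearMap.id : C →ₗ[R] C) from LinearMap.ext TensorAlgebra.ι_leftInverse,
        LinearMap.rTensor_id, LinearMap.id_apply]
    have hr : Function.Injective ((rightExtend (A := H) d).lTensor C) := by
      refine Function.LeftInverse.injective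
        (g := (rightExtend (A := H) d').lTensor C) fun x => ?_
      rw [← LinearMap.lTensor_comp_apply, hd'd, LinearMap.lTensor_id, LinearMap.id_apply]
    rw [e]
    exact (TensorProduct.assoc R _ H M).symm.injective.comp (hι.comp
      ((smulSnd_comp_coeffCoaction_injective a.isComodule).comp hr))
  have hcol : IsLeftColinear lM l' s := by
    have e1 : extend H r ∘ₗ rightExtend (A := H) d = w ∘ₗ l' := by
      have e2 : extend H r ∘ₗ d = lact lM (toConv κ) (extend H one ∘ₗ d) :=
        twist_lact a hM.left.compatible ι one
      ext h m
      have e3 := LinearMap.congr_fun e2 m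
      simp only [AlgebraTensorModule.curry_apply, LinearMap.restrictScalars_self, curry_apply,
        LinearMap.comp_apply, rightExtend_tmul, extend_op_smul, lact, LinearMap.lTensor_tmul,
        LinearEquiv.coe_coe, l'] at e3 ⊢
      rw [e3]
      generalize lM m = z
      induction z with
      | zero => simp
      | add a b ha hb => simp only [tmul_add, smul_add, map_add, ha, hb]
      | tmul c m =>
        simp only [w, leftPairing_tmul, LinearMap.comp_apply, extend_op_smul,
          TensorProduct.leftComm_tmul, rightExtend_tmul]
        rw [smul_comm]
    have e4 : lact lM (toConv κ) (extend H one ∘ₗ t) = w ∘ₗ s.lTensor C ∘ₗ lM := by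
      rw [← hst, ← LinearMap.comp_assoc, ← LinearMap.comp_assoc lM]
      unfold lact
      congr 1
      ext; simp [w]
    unfold IsLeftColinear
    rw [← LinearMap.cancel_left hw, ← e4, ← hrt, ← LinearMap.comp_assoc, ← e1, LinearMap.comp_assoc,
      hst]
  have hcol' : IsLeftColinear lM (inflateLeft H lM)
      ((TensorProduct.comm R H M).toLinearMap ∘ₗ s) := by
    refine hcol.trans ?_
    unfold IsLeftColinear inflateLeft
    ext h m
    simp only [AlgebraTensorModule.curry_apply, LinearMap.restrictScalars_self, curry_apply,
      LinearMap.comp_apply, LinearEquiv.coe_coe, TensorProduct.comm_tmul, LinearMap.rTensor_tmul,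
      LinearMap.lTensor_tmul, l']
    generalize lM m = z
    induction z with
    | zero => simp
    | add a b ha hb => simp only [tmul_add, add_tmul, map_add, ha, hb]
    | tmul c m => simp
  obtain ⟨g, hg⟩ := hMT.exists_lTensor_comp hcol'
  refine ⟨toConv g, ?_⟩
  have e : ract ρM (TensorProduct.mk R H M 1) (toConv g) = s := by
    rw [ract_mk_one, ofConv_toConv, hg, ← LinearMap.comp_assoc]
    ext; simp
  unfold Intertwines
  rw [← hd, ← ht, ← hst, ← e, rightExtend_comp_ract]
  congr 1
  ext; simp

end Intertwining

/-! ### Correspondence of cocentral maps -/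

section Cocentre

variable {R C D M V W : Type u} [CommRing R]
  [AddCommGroup C] [Module R C] [AddCommGroup D] [Module R D]
  [AddCommGroup M] [Module R M] [AddCommGroup V] [Module R V] [AddCommGroup W] [Module R W]
  {lM : M →ₗ[R] C ⊗[R] M} {ρM : M →ₗ[R] M ⊗[R] D}

/-- `p : C → V` and `q : D → V` correspond to each other under `M` if
`p(m₍₋₁₎) ⊗ m₍₀₎ = q(m₍₁₎) ⊗ m₍₀₎` for all `m`. -/
def Corresponds (lM : M →ₗ[R] C ⊗[R] M) (ρM : M →ₗ[R] M ⊗[R] D) (p : C →ₗ[R] V) (q : D →ₗ[R] V) :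
    Prop :=
  p.rTensor M ∘ₗ lM = (TensorProduct.comm R M V).toLinearMap ∘ₗ q.lTensor M ∘ₗ ρM

theorem Corresponds.comp {p : C →ₗ[R] V} {q : D →ₗ[R] V} (h : Corresponds lM ρM p q)
    (f : V →ₗ[R] W) : Corresponds lM ρM (f ∘ₗ p) (f ∘ₗ q) := by
  have e : (TensorProduct.comm R M W).toLinearMap ∘ₗ f.lTensor M =
      f.rTensor M ∘ₗ (TensorProduct.comm R M V).toLinearMap := by ext; simp
  unfold Corresponds at *
  rw [LinearMap.rTensor_comp, LinearMap.lTensor_comp, LinearMap.comp_assoc, h,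
    ← LinearMap.comp_assoc _ _ (f.rTensor M), ← e]
  simp only [LinearMap.comp_assoc]

theorem Corresponds.symm {p : C →ₗ[R] V} {q : D →ₗ[R] V} (h : Corresponds lM ρM p q) :
    q.lTensor M ∘ₗ ρM = (TensorProduct.comm R V M).toLinearMap ∘ₗ p.rTensor M ∘ₗ lM := by
  unfold Corresponds at h
  rw [h, ← LinearMap.comp_assoc]
  ext; simp

variable [Coalgebra R C] [Coalgebra R D]

theorem corresponds_counit (hM : IsBicomodule lM ρM) :
    Corresponds lM ρM (counit : C →ₗ[R] R) (counit : D →ₗ[R] R) := by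
  unfold Corresponds
  rw [hM.left.counit, hM.right.counit]
  ext; simp

/-- The correspondence is compatible with convolution products, since the coactions of `C` and `D`
commute. -/
theorem Corresponds.map_comul (hM : IsBicomodule lM ρM) {p : C →ₗ[R] V} {q : D →ₗ[R] V}
    {p' : C →ₗ[R] W} {q' : D →ₗ[R] W} (h : Corresponds lM ρM p q) (h' : Corresponds lM ρM p' q') :
    Corresponds lM ρM (map p p' ∘ₗ comul) (map q q' ∘ₗ comul) := by
  have e1 : (map p p').rTensor M = (TensorProduct.assoc R V W M).symm.toLinearMap ∘ₗ
      map p (p'.rTensor M) ∘ₗ (TensorProduct.assoc R C C M).toLinearMap := by ext; simp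
  have e2 : (TensorProduct.assoc R V W M).symm.toLinearMap ∘ₗ
      map p ((TensorProduct.comm R M W).toLinearMap ∘ₗ q'.lTensor M) ∘ₗ
        (TensorProduct.assoc R C M D).toLinearMap =
      (TensorProduct.rightComm R V M W).toLinearMap ∘ₗ map (p.rTensor M) q' := by ext; simp
  have e3 : (TensorProduct.comm R M (V ⊗[R] W)).toLinearMap ∘ₗ (map q q').lTensor M ∘ₗ
      (TensorProduct.assoc R M D D).toLinearMap = (TensorProduct.rightComm R V M W).toLinearMap ∘ₗ
        map ((TensorProduct.comm R M V).toLinearMap ∘ₗ q.lTensor M) q' := by ext; simp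
  have f1 : map p (p'.rTensor M) ∘ₗ lM.lTensor C =
      map p ((TensorProduct.comm R M W).toLinearMap ∘ₗ q'.lTensor M) ∘ₗ ρM.lTensor C := by
    rw [LinearMap.map_comp_lTensor, LinearMap.map_comp_lTensor, LinearMap.comp_assoc]
    exact congrArg _ h'
  have f2 : map (p.rTensor M) q' ∘ₗ lM.rTensor D =
      map ((TensorProduct.comm R M V).toLinearMap ∘ₗ q.lTensor M) q' ∘ₗ ρM.rTensor D := by
    rw [LinearMap.map_comp_rTensor, LinearMap.map_comp_rTensor, LinearMap.comp_assoc]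
    exact congrArg (fun f => map f q') h
  unfold Corresponds
  rw [LinearMap.rTensor_comp, LinearMap.lTensor_comp, e1]
  simp only [LinearMap.comp_assoc]
  rw [← hM.right.coassoc, hM.left.coassoc, ← LinearMap.comp_assoc _ (lM.lTensor C), f1,
    LinearMap.comp_assoc, ← hM.comm]
  have e2' := congrArg (fun f => f ∘ₗ lM.rTensor D ∘ₗ ρM) e2
  have e3' := congrArg (fun f => f ∘ₗ ρM.rTensor D ∘ₗ ρM) e3
  simp only [LinearMap.comp_assoc] at e2' e3'
  rw [e2', e3', ← LinearMap.comp_assoc ρM, f2, LinearMap.comp_assoc]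

theorem IsMoritaTakeuchi.corresponds_right_unique (hM : IsMoritaTakeuchi lM ρM) {p : C →ₗ[R] V}
    {q q' : D →ₗ[R] V} (h : Corresponds lM ρM p q) (h' : Corresponds lM ρM p q') : q = q' :=
  hM.lTensor_comp_injective (h.symm.trans h'.symm.symm)

theorem IsMoritaTakeuchi.corresponds_left_unique (hM : IsMoritaTakeuchi lM ρM)
    {p p' : C →ₗ[R] V} {q : D →ₗ[R] V} (h : Corresponds lM ρM p q) (h' : Corresponds lM ρM p' q) :
    p = p' :=
  hM.rTensor_comp_injective (Eq.trans h (Eq.symm h'))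

theorem IsCocentral.isLeftColinear (hl : IsLeftComodule lM) {p : C →ₗ[R] V}
    (hp : IsCocentral p) : IsLeftColinear lM (inflateLeft V lM)
      ((TensorProduct.comm R V M).toLinearMap ∘ₗ p.rTensor M ∘ₗ lM) := by
  let N : (V ⊗[R] C) ⊗[R] M →ₗ[R] C ⊗[R] (M ⊗[R] V) :=
    (TensorProduct.assoc R C M V).toLinearMap ∘ₗ
      (TensorProduct.comm R V (C ⊗[R] M)).toLinearMap ∘ₗ (TensorProduct.assoc R V C M).toLinearMap
  have e1 : inflateLeft V lM ∘ₗ (TensorProduct.comm R V M).toLinearMap ∘ₗ p.rTensor M =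
      N ∘ₗ (p.rTensor C).rTensor M ∘ₗ (TensorProduct.assoc R C C M).symm.toLinearMap ∘ₗ
        lM.lTensor C := by
    ext c m
    simp only [AlgebraTensorModule.curry_apply, LinearMap.restrictScalars_self, curry_apply,
      LinearMap.comp_apply, LinearEquiv.coe_coe, TensorProduct.comm_tmul, LinearMap.rTensor_tmul,
      LinearMap.lTensor_tmul, inflateLeft]
    generalize lM m = z
    induction z with
    | zero => simp
    | add a b ha hb => simp only [tmul_add, add_tmul, map_add, ha, hb]
    | tmul c m => simp [N]
  have e2 : ((TensorProduct.comm R V M).toLinearMap ∘ₗ p.rTensor M).lTensor C =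
      N ∘ₗ (p.rTensor C ∘ₗ (TensorProduct.comm R C C).toLinearMap).rTensor M ∘ₗ
        (TensorProduct.assoc R C C M).symm.toLinearMap := by ext; simp [N]
  have e3 : (TensorProduct.assoc R C C M).symm.toLinearMap ∘ₗ lM.lTensor C ∘ₗ lM =
      comul.rTensor M ∘ₗ lM := by
    rw [← hl.coassoc, ← LinearMap.comp_assoc, LinearEquiv.symm_comp, LinearMap.id_comp]
  have e1' := congrArg (fun f => f ∘ₗ lM) e1
  simp only [LinearMap.comp_assoc] at e1'
  unfold IsLeftColinear
  rw [e1', ← LinearMap.comp_assoc lM (p.rTensor M), LinearMap.lTensor_comp _ _ lM, e2]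
  simp only [LinearMap.comp_assoc]
  rw [e3, ← LinearMap.comp_assoc lM _ ((p.rTensor C).rTensor M),
    ← LinearMap.comp_assoc lM (comul.rTensor M) (LinearMap.rTensor M (p.rTensor C ∘ₗ _)),
    ← LinearMap.rTensor_comp, ← LinearMap.rTensor_comp, LinearMap.comp_assoc _ _ (p.rTensor C),
    ← show _ = _ from hp]

theorem IsCocentral.isRightColinear (hρ : IsRightComodule ρM) {q : D →ₗ[R] V}
    (hq : IsCocentral q) : IsRightColinear ρM (inflateRight V ρM)
      ((TensorProduct.comm R M V).toLinearMap ∘ₗ q.lTensor M ∘ₗ ρM) := by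
  let N : M ⊗[R] (V ⊗[R] D) →ₗ[R] (V ⊗[R] M) ⊗[R] D :=
    (TensorProduct.comm R M V).toLinearMap.rTensor D ∘ₗ
      (TensorProduct.assoc R M V D).symm.toLinearMap
  have e1 : inflateRight V ρM ∘ₗ (TensorProduct.comm R M V).toLinearMap ∘ₗ q.lTensor M =
      N ∘ₗ (q.rTensor D ∘ₗ (TensorProduct.comm R D D).toLinearMap).lTensor M ∘ₗ
        (TensorProduct.assoc R M D D).toLinearMap ∘ₗ ρM.rTensor D := by
    ext m d
    simp only [AlgebraTensorModule.curry_apply, LinearMap.restrictScalars_self, curry_apply,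
      LinearMap.comp_apply, LinearEquiv.coe_coe, TensorProduct.comm_tmul, LinearMap.rTensor_tmul,
      LinearMap.lTensor_tmul, inflateRight]
    generalize ρM m = z
    induction z with
    | zero => simp
    | add a b ha hb => simp only [tmul_add, add_tmul, map_add, ha, hb]
    | tmul m d => simp [N]
  have e2 : ((TensorProduct.comm R M V).toLinearMap ∘ₗ q.lTensor M).rTensor D =
      N ∘ₗ (q.rTensor D).lTensor M ∘ₗ (TensorProduct.assoc R M D D).toLinearMap := by
    ext; simp [N]
  have e1' := congrArg (fun f => f ∘ₗ ρM) e1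
  simp only [LinearMap.comp_assoc] at e1'
  unfold IsRightColinear
  rw [e1', ← LinearMap.comp_assoc ρM (q.lTensor M), LinearMap.rTensor_comp _ _ ρM, e2]
  simp only [LinearMap.comp_assoc]
  rw [hρ.coassoc, ← LinearMap.comp_assoc ρM _ ((q.rTensor D).lTensor M),
    ← LinearMap.comp_assoc ρM (comul.lTensor M) (LinearMap.lTensor M (q.rTensor D ∘ₗ _)),
    ← LinearMap.lTensor_comp, ← LinearMap.lTensor_comp, LinearMap.comp_assoc _ _ (q.rTensor D),
    ← show _ = _ from hq]

/-- If `q : D → V` corresponds to some `p : C → V`, then it is cocentral: applying `p` to the left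
coefficient of `m` commutes with the right coaction. -/
theorem Corresponds.isCocentral_right (hM : IsMoritaTakeuchi lM ρM) {p : C →ₗ[R] V}
    {q : D →ₗ[R] V} (h : Corresponds lM ρM p q) : IsCocentral q := by
  let K : C ⊗[R] (M ⊗[R] D) →ₗ[R] M ⊗[R] (V ⊗[R] D) :=
    (TensorProduct.leftComm R V M D).toLinearMap ∘ₗ p.rTensor (M ⊗[R] D)
  let K' : (M ⊗[R] D) ⊗[R] V →ₗ[R] M ⊗[R] (V ⊗[R] D) :=
    (TensorProduct.comm R D V).toLinearMap.lTensor M ∘ₗ (TensorProduct.assoc R M D V).toLinearMap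
  have hco := hM.bicomodule.right.coassoc
  have e1 : (q.rTensor D).lTensor M ∘ₗ (TensorProduct.assoc R M D D).toLinearMap =
      (TensorProduct.assoc R M V D).toLinearMap ∘ₗ (q.lTensor M).rTensor D := by ext; simp
  have e2 : (TensorProduct.assoc R M V D).toLinearMap ∘ₗ
      ((TensorProduct.comm R V M).toLinearMap ∘ₗ p.rTensor M).rTensor D =
      K ∘ₗ (TensorProduct.assoc R C M D).toLinearMap := by ext; simp [K]
  have e3 : (q.rTensor D ∘ₗ (TensorProduct.comm R D D).toLinearMap).lTensor M ∘ₗ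
      (TensorProduct.assoc R M D D).toLinearMap ∘ₗ ρM.rTensor D =
      K' ∘ₗ ρM.rTensor V ∘ₗ q.lTensor M := by
    ext m d
    simp only [AlgebraTensorModule.curry_apply, LinearMap.restrictScalars_self, curry_apply,
      LinearMap.comp_apply, LinearEquiv.coe_coe, LinearMap.rTensor_tmul, LinearMap.lTensor_tmul]
    generalize ρM m = z
    induction z with
    | zero => simp
    | add a b ha hb => simp only [add_tmul, map_add, ha, hb]
    | tmul m d => simp [K']
  have e4 : K' ∘ₗ ρM.rTensor V ∘ₗ (TensorProduct.comm R V M).toLinearMap ∘ₗ p.rTensor M =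
      K ∘ₗ ρM.lTensor C := by
    ext c m
    simp only [AlgebraTensorModule.curry_apply, LinearMap.restrictScalars_self, curry_apply,
      LinearMap.comp_apply, LinearEquiv.coe_coe, LinearMap.rTensor_tmul, LinearMap.lTensor_tmul,
      TensorProduct.comm_tmul]
    generalize ρM m = z
    induction z with
    | zero => simp
    | add a b ha hb => simp only [add_tmul, tmul_add, map_add, ha, hb]
    | tmul m d => simp [K, K']
  refine hM.lTensor_comp_injective ?_
  calc (q.rTensor D ∘ₗ comul).lTensor M ∘ₗ ρM
      = ((q.rTensor D).lTensor M ∘ₗ (TensorProduct.assoc R M D D).toLinearMap) ∘ₗ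
          ρM.rTensor D ∘ₗ ρM := by
        rw [LinearMap.lTensor_comp, LinearMap.comp_assoc, ← hco, LinearMap.comp_assoc]
    _ = (TensorProduct.assoc R M V D).toLinearMap ∘ₗ (q.lTensor M ∘ₗ ρM).rTensor D ∘ₗ ρM := by
        rw [e1, LinearMap.rTensor_comp, LinearMap.comp_assoc, LinearMap.comp_assoc]
    _ = ((TensorProduct.assoc R M V D).toLinearMap ∘ₗ
          ((TensorProduct.comm R V M).toLinearMap ∘ₗ p.rTensor M).rTensor D) ∘ₗ
            lM.rTensor D ∘ₗ ρM := by
        rw [h.symm, ← LinearMap.comp_assoc lM, LinearMap.rTensor_comp _ _ lM]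
        simp only [LinearMap.comp_assoc]
    _ = (K ∘ₗ ρM.lTensor C) ∘ₗ lM := by
        rw [e2, LinearMap.comp_assoc _ _ K, hM.bicomodule.comm, LinearMap.comp_assoc _ _ K]
    _ = (K' ∘ₗ ρM.rTensor V ∘ₗ q.lTensor M) ∘ₗ ρM := by
        rw [← e4]
        simp only [LinearMap.comp_assoc]
        rw [h.symm]
    _ = (q.rTensor D ∘ₗ (TensorProduct.comm R D D).toLinearMap ∘ₗ comul).lTensor M ∘ₗ ρM := by
        rw [← e3, ← LinearMap.comp_assoc comul, LinearMap.lTensor_comp _ _ comul]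
        simp only [LinearMap.comp_assoc]
        rw [hco]

theorem Corresponds.isCocentral_left (hM : IsMoritaTakeuchi lM ρM) {p : C →ₗ[R] V}
    {q : D →ₗ[R] V} (h : Corresponds lM ρM p q) : IsCocentral p := by
  let K : (C ⊗[R] M) ⊗[R] D →ₗ[R] (V ⊗[R] C) ⊗[R] M :=
    (TensorProduct.assoc R V C M).symm.toLinearMap ∘ₗ
      (TensorProduct.comm R (C ⊗[R] M) V).toLinearMap ∘ₗ q.lTensor (C ⊗[R] M)
  have hco := hM.bicomodule.left.coassoc
  have hco' : comul.rTensor M ∘ₗ lM =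
      (TensorProduct.assoc R C C M).symm.toLinearMap ∘ₗ lM.lTensor C ∘ₗ lM := by
    rw [← hco, ← LinearMap.comp_assoc, LinearEquiv.symm_comp, LinearMap.id_comp]
  have e1 : (p.rTensor C ∘ₗ (TensorProduct.comm R C C).toLinearMap).rTensor M ∘ₗ
      (TensorProduct.assoc R C C M).symm.toLinearMap =
      (TensorProduct.assoc R V C M).symm.toLinearMap ∘ₗ
        (TensorProduct.leftComm R C V M).toLinearMap ∘ₗ (p.rTensor M).lTensor C := by
    ext; simp
  have e2 : (TensorProduct.assoc R V C M).symm.toLinearMap ∘ₗ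
      (TensorProduct.leftComm R C V M).toLinearMap ∘ₗ
        ((TensorProduct.comm R M V).toLinearMap ∘ₗ q.lTensor M).lTensor C ∘ₗ
          (TensorProduct.assoc R C M D).toLinearMap = K := by ext; simp [K]
  have e3 : (p.rTensor C).rTensor M ∘ₗ (TensorProduct.assoc R C C M).symm.toLinearMap ∘ₗ
      lM.lTensor C =
      (TensorProduct.assoc R V C M).symm.toLinearMap ∘ₗ lM.lTensor V ∘ₗ p.rTensor M := by
    ext c m
    simp only [AlgebraTensorModule.curry_apply, LinearMap.restrictScalars_self, curry_apply,
      LinearMap.comp_apply, LinearEquiv.coe_coe, LinearMap.rTensor_tmul, LinearMap.lTensor_tmul]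
    generalize lM m = z
    induction z with
    | zero => simp
    | add a b ha hb => simp only [tmul_add, map_add, ha, hb]
    | tmul m d => simp
  have e4 : (TensorProduct.assoc R V C M).symm.toLinearMap ∘ₗ lM.lTensor V ∘ₗ
      (TensorProduct.comm R M V).toLinearMap ∘ₗ q.lTensor M = K ∘ₗ lM.rTensor D := by
    ext m d
    simp [K]
  refine hM.rTensor_comp_injective ?_
  calc (p.rTensor C ∘ₗ comul).rTensor M ∘ₗ lM
      = ((p.rTensor C).rTensor M ∘ₗ (TensorProduct.assoc R C C M).symm.toLinearMap ∘ₗ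
          lM.lTensor C) ∘ₗ lM := by
        rw [LinearMap.rTensor_comp, LinearMap.comp_assoc, hco']
        simp only [LinearMap.comp_assoc]
    _ = ((TensorProduct.assoc R V C M).symm.toLinearMap ∘ₗ lM.lTensor V ∘ₗ
          (TensorProduct.comm R M V).toLinearMap ∘ₗ q.lTensor M) ∘ₗ ρM := by
        rw [e3]
        simp only [LinearMap.comp_assoc]
        rw [show _ = _ from h]
    _ = (TensorProduct.assoc R V C M).symm.toLinearMap ∘ₗ
          (TensorProduct.leftComm R C V M).toLinearMap ∘ₗ
            ((TensorProduct.comm R M V).toLinearMap ∘ₗ q.lTensor M).lTensor C ∘ₗ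
              ρM.lTensor C ∘ₗ lM := by
        rw [e4, LinearMap.comp_assoc, ← e2, ← hM.bicomodule.comm]
        simp only [LinearMap.comp_assoc]
    _ = ((TensorProduct.assoc R V C M).symm.toLinearMap ∘ₗ
          (TensorProduct.leftComm R C V M).toLinearMap ∘ₗ (p.rTensor M).lTensor C) ∘ₗ
            lM.lTensor C ∘ₗ lM := by
        rw [← LinearMap.comp_assoc lM (ρM.lTensor C), ← LinearMap.lTensor_comp,
          LinearMap.comp_assoc ρM, ← show _ = _ from h, LinearMap.lTensor_comp]
        simp only [LinearMap.comp_assoc]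
    _ = (p.rTensor C ∘ₗ (TensorProduct.comm R C C).toLinearMap ∘ₗ comul).rTensor M ∘ₗ lM := by
        rw [← e1, ← LinearMap.comp_assoc comul, LinearMap.rTensor_comp _ _ comul]
        simp only [LinearMap.comp_assoc]
        rw [hco']

end Cocentre

/-! ### Functionals on the cocentre and the comparison of homoschism groups -/

section CocentreUnits

open LinearMap WithConv

variable {R C D M : Type u} [CommRing R] [AddCommGroup C] [Module R C] [Coalgebra R C]
  [AddCommGroup D] [Module R D] [Coalgebra R D] [AddCommGroup M] [Module R M]
  {lM : M →ₗ[R] C ⊗[R] M} {ρM : M →ₗ[R] M ⊗[R] D}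

/-- The quotient of a coalgebra `E` by its torsion submodule is a flat coalgebra with the same
linear functionals. The comultiplication descends because the tensor square of the quotient is flat, hence
torsion-free. -/
theorem exists_coalgebra_quotient_torsion (R E : Type u) [CommRing R] [IsDomain R]
    [IsPrincipalIdealRing R] [AddCommGroup E] [Module R E] [Coalgebra R E] :
    ∃ (E' : Type u) (_ : AddCommGroup E') (_ : Module R E') (_ : Coalgebra R E')
      (π : E →ₗc[R] E'), Module.Flat R E' ∧
        ∀ g : E →ₗ[R] R, ∃ g' : E' →ₗ[R] R, g = g' ∘ₗ π.toLinearMap := by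
  let T := Submodule.torsion R E
  let π : E →ₗ[R] E ⧸ T := T.mkQ
  have hπ : Function.Surjective π := T.mkQ_surjective
  have hflat : Module.Flat R (E ⧸ T) :=
    Module.Flat.flat_iff_torsion_eq_bot_of_isBezout.2 Submodule.QuotientTorsion.torsion_eq_bot
  -- Every map to a flat module kills torsion.
  have hkill : ∀ {X : Type u} [AddCommGroup X] [Module R X] [Module.Flat R X] (f : E →ₗ[R] X),
      T ≤ LinearMap.ker f := by
    intro X _ _ _ f x hx
    obtain ⟨r, hr⟩ := hx
    have h0 : r • f x = 0 := by rw [← map_smul_of_tower, hr, map_zero]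
    have hX : Submodule.torsion R X = ⊥ := Module.Flat.torsion_eq_bot
    have : f x ∈ Submodule.torsion R X := ⟨r, h0⟩
    rw [hX] at this
    exact this
  let Δ : E ⧸ T →ₗ[R] (E ⧸ T) ⊗[R] (E ⧸ T) := T.liftQ (map π π ∘ₗ comul) (hkill _)
  let ε : E ⧸ T →ₗ[R] R := T.liftQ counit (hkill _)
  have hΔ : Δ ∘ₗ π = map π π ∘ₗ comul := T.liftQ_mkQ _ _
  have hε : ε ∘ₗ π = counit := T.liftQ_mkQ _ _
  let inst : Coalgebra R (E ⧸ T) :=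
    { comul := Δ
      counit := ε
      coassoc := by
        rw [← LinearMap.cancel_right hπ]
        have e1 : Δ.rTensor (E ⧸ T) ∘ₗ map π π = map (map π π) π ∘ₗ comul.rTensor E := by
          rw [rTensor_comp_map, hΔ, map_comp_rTensor]
        have e2 : Δ.lTensor (E ⧸ T) ∘ₗ map π π = map π (map π π) ∘ₗ comul.lTensor E := by
          rw [lTensor_comp_map, hΔ, map_comp_lTensor]
        have e3 : (TensorProduct.assoc R (E ⧸ T) (E ⧸ T) (E ⧸ T)).toLinearMap ∘ₗ
            map (map π π) π = map π (map π π) ∘ₗ (TensorProduct.assoc R E E E).toLinearMap := by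
          ext; simp
        simp only [LinearMap.comp_assoc]
        rw [hΔ, ← LinearMap.comp_assoc comul, e1, ← LinearMap.comp_assoc comul _ (Δ.lTensor _), e2,
          LinearMap.comp_assoc, LinearMap.comp_assoc, ← Coalgebra.coassoc,
          ← LinearMap.comp_assoc _ _ (map π (map π π)), ← e3, LinearMap.comp_assoc]
      rTensor_counit_comp_comul := by
        rw [← LinearMap.cancel_right hπ, LinearMap.comp_assoc, hΔ, ← LinearMap.comp_assoc,
          rTensor_comp_map, hε]
        have e : map counit π = π.lTensor R ∘ₗ (counit : E →ₗ[R] R).rTensor E := by ext; simp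
        rw [e, LinearMap.comp_assoc, rTensor_counit_comp_comul]
        ext; simp
      lTensor_counit_comp_comul := by
        rw [← LinearMap.cancel_right hπ, LinearMap.comp_assoc, hΔ, ← LinearMap.comp_assoc,
          lTensor_comp_map, hε]
        have e : map π counit = π.rTensor R ∘ₗ (counit : E →ₗ[R] R).lTensor E := by ext; simp
        rw [e, LinearMap.comp_assoc, lTensor_counit_comp_comul]
        ext; simp }
  refine ⟨E ⧸ T, inferInstance, inferInstance, inst,
    { π with counit_comp := hε, map_comp_comul := hΔ.symm }, hflat, fun g => ?_⟩
  exact ⟨T.liftQ g (hkill g), (T.liftQ_mkQ _ _).symm⟩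

/-- A functional on the cocentre of `C` factors through a flat cocentral quotient `p : C → E`; the
corresponding map `q : D → E` is a cocentral coalgebra morphism because it is unique. -/
theorem exists_corresponds_right [IsDomain R] [IsPrincipalIdealRing R] [Module.Flat R C]
    [Module.Flat R D] (hM : IsMoritaTakeuchi lM ρM) {f : C →ₗ[R] R} (hf : IsCocentreFunctional f) :
    ∃ f' : D →ₗ[R] R, IsCocentreFunctional f' ∧ Corresponds lM ρM f f' := by
  obtain ⟨E₀, _, _, _, p₀, g₀, hp₀, rfl⟩ := hf
  obtain ⟨E, _, _, _, π, _, hπ⟩ := exists_coalgebra_quotient_torsion R E₀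
  obtain ⟨g, rfl⟩ := hπ g₀
  let p : C →ₗc[R] E := π.comp p₀
  have hp : IsCocentral p.toLinearMap := by
    unfold IsCocentral at hp₀ ⊢
    change (π.toLinearMap ∘ₗ p₀.toLinearMap).rTensor C ∘ₗ _ =
      (π.toLinearMap ∘ₗ p₀.toLinearMap).rTensor C ∘ₗ _
    rw [rTensor_comp, LinearMap.comp_assoc, hp₀, LinearMap.comp_assoc]
  obtain ⟨q, hq⟩ := hM.exists_lTensor_comp (hp.isLeftColinear hM.bicomodule.left)
  have hpq : Corresponds lM ρM p.toLinearMap q := by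
    unfold Corresponds
    rw [hq, ← LinearMap.comp_assoc]
    ext; simp
  let q' : D →ₗc[R] E :=
    { q with
      counit_comp := hM.corresponds_right_unique (hpq.comp counit) (by
        rw [p.counit_comp]
        exact corresponds_counit hM.bicomodule)
      map_comp_comul := hM.corresponds_right_unique (hpq.map_comul hM.bicomodule hpq) (by
        rw [p.map_comp_comul]
        exact hpq.comp comul) }
  exact ⟨g ∘ₗ q, ⟨E, _, _, _, q', g, hpq.isCocentral_right hM, rfl⟩, hpq.comp g⟩

theorem exists_corresponds_left (hM : IsMoritaTakeuchi lM ρM) {f : D →ₗ[R] R}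
    (hf : IsCocentreFunctional f) :
    ∃ f' : C →ₗ[R] R, IsCocentreFunctional f' ∧ Corresponds lM ρM f' f := by
  obtain ⟨E, _, _, _, q, g, hq, rfl⟩ := hf
  obtain ⟨p, hpq, -⟩ := hM.existsUnique_rTensor_comp (hq.isRightColinear hM.bicomodule.right)
  replace hpq : Corresponds lM ρM p q.toLinearMap := hpq
  let p' : C →ₗc[R] E :=
    { p with
      counit_comp := hM.corresponds_left_unique (hpq.comp counit) (by
        rw [q.counit_comp]
        exact corresponds_counit hM.bicomodule)
      map_comp_comul := hM.corresponds_left_unique (hpq.map_comul hM.bicomodule hpq) (by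
        rw [q.map_comp_comul]
        exact hpq.comp comul) }
  exact ⟨g ∘ₗ p, ⟨E, _, _, _, p', g, hpq.isCocentral_left hM, rfl⟩, hpq.comp g⟩

theorem Corresponds.mul (hM : IsBicomodule lM ρM) {v v' : WithConv (C →ₗ[R] R)}
    {w w' : WithConv (D →ₗ[R] R)} (h : Corresponds lM ρM v.ofConv w.ofConv)
    (h' : Corresponds lM ρM v'.ofConv w'.ofConv) :
    Corresponds lM ρM (v * v').ofConv (w * w').ofConv :=
  (h.map_comul hM h').comp (mul' R R)

theorem corresponds_one (hM : IsBicomodule lM ρM) :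
    Corresponds lM ρM (1 : WithConv (C →ₗ[R] R)).ofConv (1 : WithConv (D →ₗ[R] R)).ofConv :=
  (corresponds_counit hM).comp (Algebra.linearMap R R)

/-- A multiplicative relation which is single-valued from left to right and relates `u` and `u⁻¹` to
something relates `u` to a unit. -/
theorem exists_unit_of_rel {X Y : Type*} [Monoid X] [Monoid Y] {r : X → Y → Prop}
    (one : r 1 1) (mul : ∀ {x x' y y'}, r x y → r x' y' → r (x * x') (y * y'))
    (unique : ∀ {x y y'}, r x y → r x y' → y = y') {u : Xˣ} {y y' : Y} (h : r u y)
    (h' : r ↑u⁻¹ y') : ∃ w : Yˣ, (w : Y) = y ∧ ((w⁻¹ : Yˣ) : Y) = y' :=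
  ⟨⟨y, y', unique (mul h h') (by rwa [Units.mul_inv]), unique (mul h' h) (by rwa [Units.inv_mul])⟩,
    rfl, rfl⟩

/-- A multiplicative one-to-one correspondence between two groups is a group isomorphism. -/
theorem exists_mulEquiv_of_rel {X Y : Type*} [Group X] [Group Y] {r : X → Y → Prop}
    (mul : ∀ {x x' y y'}, r x y → r x' y' → r (x * x') (y * y'))
    (unique_right : ∀ {x y y'}, r x y → r x y' → y = y')
    (unique_left : ∀ {x x' y}, r x y → r x' y → x = x')
    (total_right : ∀ x, ∃ y, r x y) (total_left : ∀ y, ∃ x, r x y) :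
    ∃ e : X ≃* Y, ∀ x y, r x y → e x = y := by
  choose f hf using total_right
  choose g hg using total_left
  exact ⟨⟨⟨f, g, fun x => unique_left (hg _) (hf x), fun y => unique_right (hf _) (hg y)⟩,
    fun x x' => unique_right (hf _) (mul (hf x) (hf x'))⟩, fun x y h => unique_right (hf x) h⟩

theorem exists_cocentreUnits_right [IsDomain R] [IsPrincipalIdealRing R] [Module.Flat R C]
    [Module.Flat R D] (hM : IsMoritaTakeuchi lM ρM) {v : (WithConv (C →ₗ[R] R))ˣ}
    (hv : v ∈ cocentreUnits R C) :
    ∃ w ∈ cocentreUnits R D, Corresponds lM ρM (v : WithConv (C →ₗ[R] R)).ofConv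
        (w : WithConv (D →ₗ[R] R)).ofConv ∧
      Corresponds lM ρM ((v⁻¹ : (WithConv (C →ₗ[R] R))ˣ) : WithConv (C →ₗ[R] R)).ofConv
        ((w⁻¹ : (WithConv (D →ₗ[R] R))ˣ) : WithConv (D →ₗ[R] R)).ofConv := by
  obtain ⟨f, hf, hvf⟩ := exists_corresponds_right hM hv.1
  obtain ⟨f', hf', hvf'⟩ := exists_corresponds_right hM hv.2
  obtain ⟨w, e, e'⟩ := exists_unit_of_rel
    (r := fun (x : WithConv (C →ₗ[R] R)) (y : WithConv (D →ₗ[R] R)) =>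
      Corresponds lM ρM x.ofConv y.ofConv)
    (corresponds_one hM.bicomodule) (fun h h' => h.mul hM.bicomodule h')
    (fun h h' => ofConv_injective (hM.corresponds_right_unique h h')) (u := v)
    (y := toConv f) (y' := toConv f') hvf hvf'
  refine ⟨w, ⟨?_, ?_⟩, ?_, ?_⟩
  · rwa [e]
  · rwa [e']
  · rwa [e]
  · rwa [e']

theorem exists_cocentreUnits_left (hM : IsMoritaTakeuchi lM ρM) {w : (WithConv (D →ₗ[R] R))ˣ}
    (hw : w ∈ cocentreUnits R D) :
    ∃ v ∈ cocentreUnits R C, Corresponds lM ρM (v : WithConv (C →ₗ[R] R)).ofConv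
        (w : WithConv (D →ₗ[R] R)).ofConv ∧
      Corresponds lM ρM ((v⁻¹ : (WithConv (C →ₗ[R] R))ˣ) : WithConv (C →ₗ[R] R)).ofConv
        ((w⁻¹ : (WithConv (D →ₗ[R] R))ˣ) : WithConv (D →ₗ[R] R)).ofConv := by
  obtain ⟨f, hf, hwf⟩ := exists_corresponds_left hM hw.1
  obtain ⟨f', hf', hwf'⟩ := exists_corresponds_left hM hw.2
  obtain ⟨v, e, e'⟩ := exists_unit_of_rel
    (r := fun (y : WithConv (D →ₗ[R] R)) (x : WithConv (C →ₗ[R] R)) =>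
      Corresponds lM ρM x.ofConv y.ofConv)
    (corresponds_one hM.bicomodule) (fun h h' => h.mul hM.bicomodule h')
    (fun h h' => ofConv_injective (hM.corresponds_left_unique h h')) (u := w)
    (y := toConv f) (y' := toConv f') hwf hwf'
  refine ⟨v, ⟨?_, ?_⟩, ?_, ?_⟩
  · rwa [e]
  · rwa [e']
  · rwa [e]
  · rwa [e']

end CocentreUnits

section Comparison

open LinearMap WithConv

variable {R C D H M : Type u} [CommRing R] [AddCommGroup C] [Module R C] [Coalgebra R C]
  [AddCommGroup D] [Module R D] [Coalgebra R D] [AddCommGroup M] [Module R M]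
  [Ring H] [HopfAlgebra R H] {lM : M →ₗ[R] C ⊗[R] M} {ρM : M →ₗ[R] M ⊗[R] D}
  {δM : M →ₗ[R] M ⊗[R] H} {a : HopfCoaction R C H} {b : HopfCoaction R D H}

theorem Corresponds.intertwines_scalarFunctional {v : WithConv (C →ₗ[R] R)}
    {w : WithConv (D →ₗ[R] R)} (h : Corresponds lM ρM v.ofConv w.ofConv) :
    Intertwines lM ρM δM (scalarFunctional H v) (scalarFunctional H w) := by
  have e1 : leftPairing (scalarFunctional H v).ofConv (coeffCoaction δM LinearMap.id) =
      coeffCoaction δM (LinearMap.id : H →ₗ[R] H) ∘ₗ (TensorProduct.lid R M).toLinearMap ∘ₗ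
        v.ofConv.rTensor M := by
    ext; simp [scalarFunctional, convMap, Algebra.ofId_apply]
  have e2 : rightPairing (coeffCoaction δM LinearMap.id) (scalarFunctional H w).ofConv =
      coeffCoaction δM (LinearMap.id : H →ₗ[R] H) ∘ₗ (TensorProduct.lid R M).toLinearMap ∘ₗ
        (TensorProduct.comm R M R).toLinearMap ∘ₗ w.ofConv.lTensor M := by
    ext; simp [scalarFunctional, convMap, Algebra.ofId_apply, Algebra.algebraMap_eq_smul_one]
  unfold Intertwines lact ract
  rw [e1, e2]
  simp only [LinearMap.comp_assoc]
  rw [← show _ = _ from h]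

/-- Twisting the correspondence by the coaction of `H` on `M`. -/
theorem Corresponds.intertwines_coactFunctional (hM : IsEquivariantBicomodule a b lM ρM δM)
    {v : WithConv (C →ₗ[R] R)} {w : WithConv (D →ₗ[R] R)}
    (h : Corresponds lM ρM v.ofConv w.ofConv) :
    Intertwines lM ρM δM (coactFunctional a v) (coactFunctional b w) := by
  let α : R ⊗[R] H →ₐ[R] H := (Algebra.TensorProduct.lid R H).toAlgHom
  have e1 : lact lM v (TensorProduct.mk R R M 1) = ract ρM (TensorProduct.mk R R M 1) w := by
    rw [lact_mk_one, ract_mk_one]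
    exact h
  have e2 := congrArg (fun r => α.toLinearMap.rTensor M ∘ₗ twist δM r) e1
  have e3 : α.toLinearMap.rTensor M ∘ₗ twist δM (TensorProduct.mk R R M 1) =
      coeffCoaction δM LinearMap.id := by
    rw [twist_mk_one]
    unfold coeffCoaction
    rw [← LinearMap.comp_assoc, ← rTensor_comp]
    congr 2
    ext; simp [α]
  simp only [rTensor_comp_twist_lact a hM.left.compatible,
    rTensor_comp_twist_ract b hM.right.compatible, e3] at e2
  exact e2

theorem Corresponds.intertwines_innerMap (hM : IsEquivariantBicomodule a b lM ρM δM)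
    {v : (WithConv (C →ₗ[R] R))ˣ} {w : (WithConv (D →ₗ[R] R))ˣ}
    (h : Corresponds lM ρM (v : WithConv (C →ₗ[R] R)).ofConv (w : WithConv (D →ₗ[R] R)).ofConv)
    (h' : Corresponds lM ρM ((v⁻¹ : (WithConv (C →ₗ[R] R))ˣ) : WithConv (C →ₗ[R] R)).ofConv
      ((w⁻¹ : (WithConv (D →ₗ[R] R))ˣ) : WithConv (D →ₗ[R] R)).ofConv) :
    Intertwines lM ρM δM (innerMap a v : (WithConv (C →ₗ[R] H))ˣ)
      (innerMap b w : (WithConv (D →ₗ[R] H))ˣ) := by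
  unfold innerMap
  rw [← map_inv, ← map_inv]
  exact (h.intertwines_coactFunctional hM).mul hM.bicomodule h'.intertwines_scalarFunctional

/-- Intertwining defines an isomorphism of the groups of cocharacters. -/
theorem exists_cocharacterGroup_mulEquiv [Module.Flat R C] [Module.Flat R D] [Module.Flat R H]
    (hMT : IsMoritaTakeuchi lM ρM) (hM : IsEquivariantBicomodule a b lM ρM δM) :
    ∃ e : cocharacterGroup a ≃* cocharacterGroup b,
      ∀ (φ : cocharacterGroup a) (ψ : cocharacterGroup b),
        Intertwines lM ρM δM φ.1.val ψ.1.val → e φ = ψ := by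
  refine exists_mulEquiv_of_rel
    (r := fun (φ : cocharacterGroup a) (ψ : cocharacterGroup b) =>
      Intertwines lM ρM δM φ.1.val ψ.1.val)
    (fun h h' => h.mul hM.bicomodule h')
    (fun h h' => Subtype.ext (Units.ext (h.right_unique hMT hM h')))
    (fun h h' => Subtype.ext (Units.ext (h.left_unique hMT hM h')))
    (fun φ => ?_) (fun ψ => ?_)
  · obtain ⟨y, hy⟩ := exists_intertwines_right hMT hM φ.2
    obtain ⟨y', hy'⟩ := exists_intertwines_right hMT hM (φ⁻¹).2
    obtain ⟨ψ, hψ, -⟩ := exists_unit_of_rel (r := Intertwines lM ρM δM)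
      (Intertwines.one hM.bicomodule) (fun h h' => h.mul hM.bicomodule h')
      (fun h h' => h.right_unique hMT hM h') (u := φ.1) hy hy'
    refine ⟨⟨ψ, ?_⟩, ?_⟩
    · change IsCocharacter b (ψ : WithConv (D →ₗ[R] H)).ofConv
      rw [hψ]
      exact hy.isCocharacter_right hMT hM φ.2
    · rwa [hψ]
  · obtain ⟨x, hx⟩ := exists_intertwines_left hMT hM ψ.2
    obtain ⟨x', hx'⟩ := exists_intertwines_left hMT hM (ψ⁻¹).2
    obtain ⟨φ, hφ, -⟩ := exists_unit_of_rel (r := fun y x => Intertwines lM ρM δM x y)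
      (Intertwines.one hM.bicomodule) (fun h h' => h.mul hM.bicomodule h')
      (fun h h' => h.left_unique hMT hM h') (u := ψ.1) hx hx'
    refine ⟨⟨φ, ?_⟩, ?_⟩
    · change IsCocharacter a (φ : WithConv (C →ₗ[R] H)).ofConv
      rw [hφ]
      exact hx.isCocharacter_left hMT hM ψ.2
    · rwa [hφ]

/-- The isomorphism of cocharacter groups maps inner cocharacters to inner cocharacters. -/
theorem nonempty_firstHomoschism_mulEquiv [IsDomain R] [IsPrincipalIdealRing R]
    [Module.Flat R C] [Module.Flat R D] [Module.Flat R H]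
    (hMT : IsMoritaTakeuchi lM ρM) (hM : IsEquivariantBicomodule a b lM ρM δM) :
    Nonempty (FirstHomoschism a ≃* FirstHomoschism b) := by
  obtain ⟨e, he⟩ := exists_cocharacterGroup_mulEquiv hMT hM
  have hrange : (innerCocharacter a).range.map e.toMonoidHom = (innerCocharacter b).range := by
    refine le_antisymm ?_ ?_
    · rintro _ ⟨_, ⟨v, rfl⟩, rfl⟩
      obtain ⟨w, hw, h, h'⟩ := exists_cocentreUnits_right hMT v.2
      have := he (innerCocharacter a v) (innerCocharacter b ⟨w, hw⟩) (h.intertwines_innerMap hM h')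
      exact ⟨⟨w, hw⟩, this.symm⟩
    · rintro _ ⟨w, rfl⟩
      obtain ⟨v, hv, h, h'⟩ := exists_cocentreUnits_left hMT w.2
      have := he (innerCocharacter a ⟨v, hv⟩) (innerCocharacter b w) (h.intertwines_innerMap hM h')
      exact ⟨innerCocharacter a ⟨v, hv⟩, ⟨⟨v, hv⟩, rfl⟩, this⟩
  exact ⟨QuotientGroup.congr _ _ e hrange⟩

end Comparison

end MoritaTakeuchi

theorem mainTheorem5 {R C D H : Type u} [CommRing R] [IsDomain R] [IsPrincipalIdealRing R]
    [IsLocalRing R] [CharZero R]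
    [AddCommGroup C] [Module R C] [Coalgebra R C] [Module.Flat R C]
    [AddCommGroup D] [Module R D] [Coalgebra R D] [Module.Flat R D]
    [Ring H] [HopfAlgebra R H] [Module.Flat R H]
    (a : MoritaTakeuchi.HopfCoaction R C H) (b : MoritaTakeuchi.HopfCoaction R D H)
    (hCD : MoritaTakeuchi.MoritaTakeuchiEquivalent R C D) :
    Nonempty (MoritaTakeuchi.FirstHomoschism a ≃* MoritaTakeuchi.FirstHomoschism b) ∨
      IsEmpty (MoritaTakeuchi.PicH a b) := by
  rcases isEmpty_or_nonempty (MoritaTakeuchi.PicH a b) with h | h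
  · exact Or.inr h
  · obtain ⟨x⟩ := h
    obtain ⟨M, -⟩ := Quotient.exists_rep x
    let := M.addCommGroup
    let := M.module
    exact Or.inl (MoritaTakeuchi.nonempty_firstHomoschism_mulEquiv
      M.isEquivariantMoritaTakeuchi.underlying M.isEquivariantMoritaTakeuchi.equivariant)
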